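/- Let $p$ be a prime, $\mathbb{C}_p$ the completion of an algebraic closure of $\mathbb{Q}_p$, and $\mathbb{P}^{1,\mathrm{an}}$ the analytic projective line over $\mathbb{C}_p$. Discs have radii in $\|\mathbb{C}_p^*\|_p$. A \emph{rational basic wide open} is a subspace $U\subset\mathbb{P}^{1,\mathrm{an}}$ that, in a suitable coordinate of $\mathbb{P}^1$, is the complement of finitely many closed discs contained in distinct residue discs. For a finite family $\mathcal{C}$ of distinct rational basic wide opens and $U\in\mathcal{C}$ put $U^\circ=U\setminus\bigcup_{V\in\mathcal{C},V\ne U}V$. The dual graph $\Gamma(\mathcal{C})$ has vertex set $\mathcal{C}$, one edge between $U\neq V$ for each connected component of $U\cap V$, and one self-edge at $U$ for each ordinary double point of the canonical reduction of $U^\circ$. The graph $\Gamma(\mathcal{C},S)$, for a set $S$ of $\mathbb{C}_p$-points, is obtained by attaching, for each $s\in S$, a half-open edge to the vertices $U$ with $s\in U$. A finite covering $\mathcal{C}$ of $\mathbb{P}^{1,\mathrm{an}}$ by distinct rational basic wide opens is \emph{semistable} if $\Gamma(\mathcal{C})$ is finite and (1) for distinct $U,V,W\in\mathcal{C}$, $U$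 is disconnected from every component of $V\cap W$; (2) for every $U\in\mathcal{C}$, $U^\circ$ is a nonempty affinoid subdomain whose canonical reduction $\overline{U^\circ}$ is absolutely irreducible, reduced, and has no singularities except ordinary double points; (3) $g(\mathbb{P}^1)=\sum_{U\in\mathcal{C}}g(\overline{U^\circ})+b_1(\Gamma(\mathcal{C}))$, where $g(\overline{U^\circ})$ is the geometric genus. For an open disc $Y=B(\beta,R)$, a \emph{semistable covering} of $Y$ by rational basic wide opens is defined in the same way, with (3) replaced by $b_1(\Gamma(\mathcal{C}))=0$ and (2) modified at the end of $Y$: there are a closed disc $\overline{B}(\gamma,r)\subset Y$, with $r<R$, and an element of $\mathcal{C}$, called the \emph{root}, such that the boundary annulus $Y\setminus\overline{B}(\gamma,r)$ is contained in the root and is disjoint from the other elements of $\mathcal{C}$, and for the root $U$ one takes $U^\circ=(U\cap\overline{B}(\gamma,r))\setminus\bigcup_{V\ne U}V$ in (2) and in the definition of the self-edges. A covering $\mathcal{C}$ is \emph{good} with respect to $S$ if each element of $S$ lies in at most one element of $\mathcal{C}$ and, for each $U\in\mathcal{C}$, there is a linear fractional embedding $\iota\colon U\to\mathbb{P}^{1,\mathrm{an}}$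 such that the points of $\iota(S\cap U(\mathbb{C}_p))$ lie in distinct residue discs. (a) For every finite set $S\subset\mathbb{P}^1(\mathbb{C}_p)$ there is a semistable covering $\mathcal{C}$ of $\mathbb{P}^{1,\mathrm{an}}$ by rational basic wide opens that is good with respect to $S$ and whose dual graph $\Gamma(\mathcal{C},S)$ is a tree. (b) For every $R\in\|\mathbb{C}_p^*\|_p$, every $\beta\in\mathbb{C}_p$ and every nonempty finite set $S$ of $\mathbb{C}_p$-points of $Y=B(\beta,R)$ there is a semistable covering $\mathcal{C}$ of $Y$ by rational basic wide opens that is good with respect to $S$ and whose dual graph $\Gamma(\mathcal{C},S)$ is a tree, rooted at the root of $\mathcal{C}$. -/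

import Mathlib

open Set Polynomial Topology
open scoped NNReal TensorProduct

noncomputable section

/-! ### The Berkovich projective line -/

/-- The Berkovich affine line over a normed field `K`: the multiplicative seminorms on `K[T]` that
extend the norm of `K`. -/
def BerkA1 (K : Type*) [NormedField K] : Type _ :=
  {x : MulRingSeminorm K[X] // ∀ a : K, x (C a) = ‖a‖}

/-- The topology of pointwise convergence of seminorms. -/
instance BerkA1.instTopologicalSpace (K : Type*) [NormedField K] :
    TopologicalSpace (BerkA1 K) :=
  TopologicalSpace.induced (fun (x : BerkA1 K) (f : K[X]) => x.1 f) inferInstance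

/-- The Berkovich projective line: as a topological space it is the one-point compactification of
the Berkovich affine line. -/
abbrev BerkP1 (K : Type*) [NormedField K] : Type _ := OnePoint (BerkA1 K)

/-- The `K`-point `a` of the Berkovich affine line, i.e. the seminorm `f ↦ ‖f(a)‖`. -/
def BerkA1.ofPoint {K : Type*} [NormedField K] (a : K) : BerkA1 K :=
  ⟨{ toFun := fun f => ‖f.eval a‖
     map_zero' := by simp
     add_le' := fun f g => by simpa using norm_add_le (f.eval a) (g.eval a)
     neg' := fun f => by simp
     map_one' := by simp
     map_mul' := fun f g => by simp },
   fun b => by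
    change ‖(C b : K[X]).eval a‖ = ‖b‖
    simp⟩

/-- The inclusion of `P^1(K) = K ∪ {∞}` in the Berkovich projective line. -/
def BerkP1.ofPoint {K : Type*} [NormedField K] : OnePoint K → BerkP1 K :=
  OnePoint.map BerkA1.ofPoint

/-- The absolute value `|aT + b|` at a point of the Berkovich projective line. At `∞`, where
numerators and denominators of coordinates have to be compared after division by `T`, it is read
as `|a|`. -/
def BerkP1.absLin {K : Type*} [NormedField K] (a b : K) : BerkP1 K → ℝ :=
  fun x => OnePoint.elim x ‖a‖ (fun y : BerkA1 K => y.1 (C a * X + C b))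

/-- For `g = (a b; c d)` in `GL₂(K)` consider the coordinate `z_g = (aT + b) / (cT + d)` of `P^1`
(the linear fractional transformation attached to `g`). This is the absolute value of its
numerator. -/
def BerkP1.absNum {K : Type*} [NormedField K] (g : GL (Fin 2) K) : BerkP1 K → ℝ :=
  BerkP1.absLin (g 0 0) (g 0 1)

/-- The absolute value of the denominator of the coordinate `z_g`. -/
def BerkP1.absDen {K : Type*} [NormedField K] (g : GL (Fin 2) K) : BerkP1 K → ℝ :=
  BerkP1.absLin (g 1 0) (g 1 1)

/-! ### Discs, residue discs, rational basic wide opens -/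

/-- A closed disc in the projective line: a set `|z_g| ≤ 1`, where `z_g` is a coordinate. (So the
radii are absolute values of elements of `K^*`, and the discs around `∞` are included.) -/
def IsClosedDisc {K : Type*} [NormedField K] (D : Set (BerkP1 K)) : Prop :=
  ∃ g : GL (Fin 2) K, D = {x | BerkP1.absNum g x ≤ BerkP1.absDen g x}

/-- An open disc in the projective line: a set `|z_g| < 1`, where `z_g` is a coordinate. -/
def IsOpenDisc {K : Type*} [NormedField K] (D : Set (BerkP1 K)) : Prop :=
  ∃ g : GL (Fin 2) K, D = {x | BerkP1.absNum g x < BerkP1.absDen g x}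

/-- `E` is a residue disc of the good reduction curve `P^1` with coordinate `z_g`: it is
`|z_g - a| < 1` for some `a` with `‖a‖ ≤ 1`, or the residue disc `|1 / z_g| < 1` of infinity.
Equivalently, `E` is the preimage under the linear fractional transformation `g` of a residue disc
of the standard projective line. -/
def IsResidueDisc {K : Type*} [NormedField K] (g : GL (Fin 2) K) (E : Set (BerkP1 K)) : Prop :=
  (∃ a : K, ‖a‖ ≤ 1 ∧
    E = {x | BerkP1.absLin (g 0 0 - a * g 1 0) (g 0 1 - a * g 1 1) x < BerkP1.absDen g x}) ∨
  E = {x | BerkP1.absDen g x < BerkP1.absNum g x}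

/-- A rational basic wide open: for a suitable coordinate `z_g`, the complement of finitely many
closed discs contained in distinct residue discs. -/
def IsRationalBasicWideOpen {K : Type*} [NormedField K] (U : Set (BerkP1 K)) : Prop :=
  ∃ (g : GL (Fin 2) K) (n : ℕ) (D E : Fin n → Set (BerkP1 K)),
    (∀ i, IsClosedDisc (D i)) ∧ (∀ i, IsResidueDisc g (E i)) ∧ Function.Injective E ∧
    (∀ i, D i ⊆ E i) ∧ U = (⋃ i, D i)ᶜ

/-- `U` is good with respect to `S`: some linear fractional embedding of `U` in the good reduction
curve `P^1` maps the points of `S` in `U` to points in distinct residue discs. -/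
def IsGoodElement {K : Type*} [NormedField K] (S : Set (OnePoint K)) (U : Set (BerkP1 K)) : Prop :=
  ∃ g : GL (Fin 2) K, ∀ s ∈ S, ∀ t ∈ S, BerkP1.ofPoint s ∈ U → BerkP1.ofPoint t ∈ U →
    ∀ E, IsResidueDisc g E → BerkP1.ofPoint s ∈ E → BerkP1.ofPoint t ∈ E → s = t

/-- A finite family of subspaces is good with respect to `S` if each element of `S` belongs to at
most one member, and each member is good with respect to `S`. -/
def IsGoodCovering {K : Type*} [NormedField K] (𝒞 : Finset (Set (BerkP1 K)))
    (S : Set (OnePoint K)) : Prop :=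
  (∀ s ∈ S, ∀ U ∈ 𝒞, ∀ V ∈ 𝒞, BerkP1.ofPoint s ∈ U → BerkP1.ofPoint s ∈ V → U = V) ∧
  ∀ U ∈ 𝒞, IsGoodElement S U

/-! ### Affinoid subdomains and their canonical reduction -/

/-- Connected affinoid subdomains of the projective line: the nonempty complements of finite
nonempty unions of open discs. -/
def IsConnectedAffinoid {K : Type*} [NormedField K] (V : Set (BerkP1 K)) : Prop :=
  V.Nonempty ∧ ∃ (n : ℕ) (D : Fin (n + 1) → Set (BerkP1 K)),
    (∀ i, IsOpenDisc (D i)) ∧ V = (⋃ i, D i)ᶜ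

/-- The `K`-points of a subset of the Berkovich projective line. -/
def ratPoints {K : Type*} [NormedField K] (V : Set (BerkP1 K)) : Set (OnePoint K) :=
  BerkP1.ofPoint ⁻¹' V

/-- The value of the degree `n` homogenization of `P` at `(z : 1)`, or at `(1 : 0)` for `z = ∞`. -/
def homEval {K : Type*} [NormedField K] (n : ℕ) (P : K[X]) : OnePoint K → K :=
  fun z => OnePoint.elim z (P.coeff n) (fun a => P.eval a)

/-- A function on the `K`-points of `V` given by a rational function without poles there. -/
def IsRationalFunctionOn {K : Type*} [NormedField K] (V : Set (BerkP1 K))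
    (f : ratPoints V → K) : Prop :=
  ∃ (n : ℕ) (P Q : K[X]), P.natDegree ≤ n ∧ Q.natDegree ≤ n ∧
    ∀ z : ratPoints V, homEval n Q z ≠ 0 ∧ f z = homEval n P z / homEval n Q z

/-- Analytic functions on (the `K`-points of) an affinoid subdomain of the projective line: uniform
limits of rational functions without poles. -/
def IsAnalyticOn {K : Type*} [NormedField K] (V : Set (BerkP1 K)) (f : ratPoints V → K) : Prop :=
  ∀ ε : ℝ, 0 < ε → ∃ r : ratPoints V → K, IsRationalFunctionOn V r ∧ ∀ z, ‖f z - r z‖ < ε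

/-- The valuation ring `{a | ‖a‖ ≤ 1}` of `K`. -/
abbrev valRing (K : Type*) [NormedField K] [IsUltrametricDist K] : ValuationSubring K :=
  (NormedField.valuation : Valuation K ℝ≥0).valuationSubring

/-- The residue field of `K`. -/
abbrev resField (K : Type*) [NormedField K] [IsUltrametricDist K] : Type _ :=
  IsLocalRing.ResidueField (valRing K)

theorem norm_valRing_le {K : Type*} [NormedField K] [IsUltrametricDist K] (a : valRing K) :
    ‖(a : K)‖ ≤ 1 := by
  have h := a.2
  rw [Valuation.mem_valuationSubring_iff, NormedField.valuation_apply] at h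
  exact_mod_cast h

theorem homEval_add {K : Type*} [NormedField K] (n : ℕ) (P Q : K[X]) (z : OnePoint K) :
    homEval n (P + Q) z = homEval n P z + homEval n Q z := by
  induction z using OnePoint.rec <;> simp [homEval]

theorem homEval_mul {K : Type*} [NormedField K] {m n : ℕ} {P Q : K[X]} (hP : P.natDegree ≤ m)
    (hQ : Q.natDegree ≤ n) (z : OnePoint K) :
    homEval (m + n) (P * Q) z = homEval m P z * homEval n Q z := by
  induction z using OnePoint.rec with
  | infty => simpa [homEval] using coeff_mul_add_eq_of_natDegree_le hP hQ
  | coe z => simp [homEval]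

theorem IsRationalFunctionOn.const {K : Type*} [NormedField K] (V : Set (BerkP1 K)) (a : K) :
    IsRationalFunctionOn V (fun _ => a) := by
  refine ⟨0, C a, 1, by simp, by simp, fun z => ?_⟩
  obtain ⟨z, hz⟩ := z
  induction z using OnePoint.rec <;> simp [homEval]

theorem IsRationalFunctionOn.add {K : Type*} [NormedField K] {V : Set (BerkP1 K)}
    {f g : ratPoints V → K} (hf : IsRationalFunctionOn V f) (hg : IsRationalFunctionOn V g) :
    IsRationalFunctionOn V (f + g) := by
  obtain ⟨m, P, Q, hP, hQ, h⟩ := hf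
  obtain ⟨n, P', Q', hP', hQ', h'⟩ := hg
  refine ⟨m + n, P * Q' + Q * P', Q * Q', ?_, natDegree_mul_le_of_le hQ hQ', fun z => ?_⟩
  · exact natDegree_add_le_of_degree_le (natDegree_mul_le_of_le hP hQ')
      (natDegree_mul_le_of_le hQ hP')
  · rw [homEval_add, homEval_mul hQ hQ', homEval_mul hP hQ', homEval_mul hQ hP', Pi.add_apply,
      (h z).2, (h' z).2]
    exact ⟨mul_ne_zero (h z).1 (h' z).1, div_add_div _ _ (h z).1 (h' z).1⟩

theorem IsRationalFunctionOn.mul {K : Type*} [NormedField K] {V : Set (BerkP1 K)}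
    {f g : ratPoints V → K} (hf : IsRationalFunctionOn V f) (hg : IsRationalFunctionOn V g) :
    IsRationalFunctionOn V (f * g) := by
  obtain ⟨m, P, Q, hP, hQ, h⟩ := hf
  obtain ⟨n, P', Q', hP', hQ', h'⟩ := hg
  refine ⟨m + n, P * P', Q * Q', natDegree_mul_le_of_le hP hP', natDegree_mul_le_of_le hQ hQ',
    fun z => ?_⟩
  rw [homEval_mul hQ hQ', homEval_mul hP hP', Pi.mul_apply, (h z).2, (h' z).2]
  exact ⟨mul_ne_zero (h z).1 (h' z).1, div_mul_div_comm _ _ _ _⟩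

/-- The ring `A°` of analytic functions on `V` of supremum norm at most one (the power-bounded
functions), as an algebra over the valuation ring of `K`. -/
def unitBallRing {K : Type*} [NormedField K] [IsUltrametricDist K] (V : Set (BerkP1 K)) :
    Subalgebra (valRing K) (ratPoints V → K) where
  carrier := {f | IsAnalyticOn V f ∧ ∀ z, ‖f z‖ ≤ 1}
  mul_mem' := by
    rintro f g ⟨hf, hf1⟩ ⟨hg, hg1⟩
    refine ⟨fun ε hε => ?_, fun z => ?_⟩
    · obtain ⟨r, hr, hfr⟩ := hf (min ε 1) (lt_min hε one_pos)
      obtain ⟨s, hs, hgs⟩ := hg ε hε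
      refine ⟨r * s, hr.mul hs, fun z => ?_⟩
      have hr1 : ‖r z‖ ≤ 1 := by
        have h1 : ‖f z + -(f z - r z)‖ ≤ max ‖f z‖ ‖-(f z - r z)‖ :=
          IsUltrametricDist.norm_add_le_max _ _
        rw [norm_neg, ← sub_eq_add_neg, sub_sub_cancel] at h1
        exact h1.trans (max_le (hf1 z) ((hfr z).le.trans (min_le_right _ _)))
      have e : (f * g) z - (r * s) z = (f z - r z) * g z + r z * (g z - s z) := by
        simp only [Pi.mul_apply]; ring
      rw [e]
      refine (IsUltrametricDist.norm_add_le_max _ _).trans_lt (max_lt ?_ ?_)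
      · rw [norm_mul]
        calc ‖f z - r z‖ * ‖g z‖ ≤ ‖f z - r z‖ * 1 :=
              mul_le_mul_of_nonneg_left (hg1 z) (norm_nonneg _)
          _ < ε := by rw [mul_one]; exact (hfr z).trans_le (min_le_left _ _)
      · rw [norm_mul]
        calc ‖r z‖ * ‖g z - s z‖ ≤ 1 * ‖g z - s z‖ :=
              mul_le_mul_of_nonneg_right hr1 (norm_nonneg _)
          _ < ε := by rw [one_mul]; exact hgs z
    · rw [Pi.mul_apply, norm_mul]
      exact mul_le_one₀ (hf1 z) (norm_nonneg _) (hg1 z)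
  add_mem' := by
    rintro f g ⟨hf, hf1⟩ ⟨hg, hg1⟩
    refine ⟨fun ε hε => ?_, fun z => ?_⟩
    · obtain ⟨r, hr, hfr⟩ := hf ε hε
      obtain ⟨s, hs, hgs⟩ := hg ε hε
      refine ⟨r + s, hr.add hs, fun z => ?_⟩
      have e : (f + g) z - (r + s) z = (f z - r z) + (g z - s z) := by
        simp only [Pi.add_apply]; ring
      rw [e]
      exact (IsUltrametricDist.norm_add_le_max _ _).trans_lt (max_lt (hfr z) (hgs z))
    · exact (IsUltrametricDist.norm_add_le_max _ _).trans (max_le (hf1 z) (hg1 z))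
  algebraMap_mem' := fun a =>
    ⟨fun ε hε => ⟨fun _ => (a : K), IsRationalFunctionOn.const V _, fun z => by
      change ‖(a : K) - (a : K)‖ < ε
      simpa using hε⟩, fun z => norm_valRing_le a⟩

/-- The ideal `A°°` of functions of supremum norm less than one (the topologically nilpotent
functions). -/
def openBallIdeal {K : Type*} [NormedField K] [IsUltrametricDist K] (V : Set (BerkP1 K)) :
    Ideal (unitBallRing V) where
  carrier := {f | ∃ c : ℝ, 0 ≤ c ∧ c < 1 ∧ ∀ z, ‖f.1 z‖ ≤ c}
  add_mem' := by
    rintro f g ⟨c, hc0, hc, hf⟩ ⟨d, hd0, hd, hg⟩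
    exact ⟨max c d, le_max_of_le_left hc0, max_lt hc hd, fun z =>
      (IsUltrametricDist.norm_add_le_max _ _).trans (max_le_max (hf z) (hg z))⟩
  zero_mem' := ⟨0, le_rfl, one_pos, fun z => by simp⟩
  smul_mem' := by
    rintro f g ⟨c, hc0, hc, hg⟩
    refine ⟨c, hc0, hc, fun z => ?_⟩
    change ‖f.1 z * g.1 z‖ ≤ c
    rw [norm_mul]
    calc ‖f.1 z‖ * ‖g.1 z‖ ≤ 1 * c :=
          mul_le_mul (f.2.2 z) (hg z) (norm_nonneg _) zero_le_one
      _ = c := one_mul c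

/-- The coordinate ring `A° / A°°` of the canonical reduction of an affinoid subdomain `V`. -/
def reductionRing {K : Type*} [NormedField K] [IsUltrametricDist K] (V : Set (BerkP1 K)) :
    Type _ :=
  unitBallRing V ⧸ openBallIdeal V

instance reductionRing.instCommRing {K : Type*} [NormedField K] [IsUltrametricDist K]
    (V : Set (BerkP1 K)) : CommRing (reductionRing V) :=
  inferInstanceAs (CommRing (unitBallRing V ⧸ openBallIdeal V))

theorem maximalIdeal_le_comap {K : Type*} [NormedField K] [IsUltrametricDist K]
    (V : Set (BerkP1 K)) :
    IsLocalRing.maximalIdeal (valRing K) ≤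
      (openBallIdeal V).comap (algebraMap (valRing K) (unitBallRing V)) := by
  intro a ha
  refine ⟨‖(a : K)‖, norm_nonneg _, ?_, fun z => le_rfl⟩
  have h := (Valuation.mem_maximalIdeal_iff K _).1 ha
  exact_mod_cast h

/-- The canonical reduction is an algebra over the residue field. -/
instance reductionRing.instAlgebra {K : Type*} [NormedField K] [IsUltrametricDist K]
    (V : Set (BerkP1 K)) : Algebra (resField K) (reductionRing V) :=
  Ideal.Quotient.algebraQuotientOfLEComap (A := unitBallRing V) (maximalIdeal_le_comap V)

/-- The affine variety with coordinate ring `A` over the field `k` is absolutely irreducible. -/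
def IsAbsolutelyIrreducible (k A : Type*) [Field k] [CommRing A] [Algebra k A] : Prop :=
  IrreducibleSpace (PrimeSpectrum (AlgebraicClosure k ⊗[k] A))

/-- The closed point `m` of `Spec A`, where `A` is a finitely generated algebra over the
algebraically closed field `k`, is an ordinary double point: it is singular, and the completed
local ring is `k[[x, y]] / (xy)`. -/
def IsOrdinaryDoublePoint (k : Type*) {A : Type*} [Field k] [CommRing A]
    (m : MaximalSpectrum A) : Prop :=
  ¬ IsRegularLocalRing (Localization.AtPrime m.asIdeal) ∧
  Nonempty (AdicCompletion (IsLocalRing.maximalIdeal (Localization.AtPrime m.asIdeal))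
      (Localization.AtPrime m.asIdeal) ≃+*
    (MvPowerSeries (Fin 2) k ⧸
      Ideal.span {(MvPowerSeries.X 0 * MvPowerSeries.X 1 : MvPowerSeries (Fin 2) k)}))

/-- The regular differentials of the smooth complete curve over `k` with function field `F`: those
elements of `Ω_{F/k}` which, for every valuation ring `O` of `F` containing `k`, come from
`Ω_{O/k}`. -/
def regularDifferentials (k F : Type*) [Field k] [CommRing F] [Algebra k F] :
    Submodule k (Ω[F⁄k]) :=
  ⨅ (O : Subalgebra k F) (_ : ∀ x : F, x ∈ O ∨ ∃ y ∈ O, x * y = 1),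
    (LinearMap.range (KaehlerDifferential.map k k O F)).restrictScalars k

/-- The genus of the smooth complete curve over the algebraically closed field `k` with function
field `F`. -/
def curveGenus (k F : Type*) [Field k] [CommRing F] [Algebra k F] : ℕ :=
  Module.finrank k (regularDifferentials k F)

/-- `V` is a nonempty affinoid subdomain, whose reduction is absolutely irreducible, reduced, and
has no singularities except ordinary double points. -/
structure IsSemistableAffinoid {K : Type*} [NormedField K] [IsUltrametricDist K]
    (V : Set (BerkP1 K)) : Prop where
  affinoid : IsConnectedAffinoid V
  irreducible : IsAbsolutelyIrreducible (resField K) (reductionRing V)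
  reduced : IsReduced (reductionRing V)
  singularities : ∀ m : MaximalSpectrum (reductionRing V),
    IsRegularLocalRing (Localization.AtPrime m.asIdeal) ∨ IsOrdinaryDoublePoint (resField K) m

/-- The genus of the reduction of `V` (of the smooth complete curve birational to it). -/
def reductionGenus {K : Type*} [NormedField K] [IsUltrametricDist K] (V : Set (BerkP1 K)) : ℕ :=
  curveGenus (resField K) (FractionRing (reductionRing V))

/-! ### Graphs with half-open edges -/

/-- A graph with vertices `V`, edges `E` (loops and multiple edges are allowed), and half-open
edges `H`, each of which is attached to one vertex. -/
structure HalfOpenGraph (V E H : Type*) where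
  /-- the two ends of an edge -/
  ends : E → Sym2 V
  /-- the vertex to which a half-open edge is attached -/
  attach : H → V

namespace HalfOpenGraph

/-- Two distinct vertices are adjacent if some edge joins them. -/
def toSimpleGraph {V E H : Type*} (G : HalfOpenGraph V E H) : SimpleGraph V where
  Adj u v := u ≠ v ∧ ∃ e, G.ends e = s(u, v)
  symm := ⟨fun _ _ h => ⟨h.1.symm, h.2.imp fun _ he => he.trans Sym2.eq_swap⟩⟩
  loopless := ⟨fun _ h => h.1 rfl⟩

/-- The first Betti number (of a graph with finitely many vertices and edges; half-open edges do
not contribute). -/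
def firstBetti {V E H : Type*} (G : HalfOpenGraph V E H) : ℤ :=
  (Nat.card E : ℤ) - Nat.card V + Nat.card G.toSimpleGraph.ConnectedComponent

/-- A finite graph with half-open edges is a tree if it is connected and its first Betti number
vanishes. -/
structure IsTree {V E H : Type*} (G : HalfOpenGraph V E H) : Prop where
  finite_vertices : Finite V
  finite_edges : Finite E
  finite_halfEdges : Finite H
  connected : G.toSimpleGraph.Connected
  firstBetti_eq_zero : G.firstBetti = 0

end HalfOpenGraph

/-! ### Semistable coverings and their dual graphs -/

/-- The connected components of a subset. -/
def componentsOf {X : Type*} [TopologicalSpace X] (A : Set X) : Set (Set X) :=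
  {Z | ∃ x ∈ A, Z = connectedComponentIn A x}

/-- The part of `U ∩ Z` that lies in no other member of the family `𝒞`. -/
def coreIn {X : Type*} (Z : Set X) (𝒞 : Finset (Set X)) (U : Set X) : Set X :=
  (U ∩ Z) \ ⋃ V ∈ 𝒞, ⋃ (_ : V ≠ U), V

/-- The edges of the dual graph: for each pair of distinct members the components of their
intersection, and for each member `U` the ordinary double points in the reduction of its core. -/
def DualEdge {K : Type*} [NormedField K] [IsUltrametricDist K] (Z : Set (BerkP1 K))
    (𝒞 : Finset (Set (BerkP1 K))) : Type _ :=
  {e : Sym2 𝒞 × Set (BerkP1 K) //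
    ¬ e.1.IsDiag ∧ e.2 ∈ componentsOf {x | ∀ U ∈ e.1, x ∈ U.1}} ⊕
  (Σ U : 𝒞, {m : MaximalSpectrum (reductionRing (coreIn Z 𝒞 U.1)) //
    IsOrdinaryDoublePoint (resField K) m})

/-- The half-open edges: an element `s` of `S`, and a member of the covering containing it. -/
def DualHalfEdge {K : Type*} [NormedField K] (𝒞 : Finset (Set (BerkP1 K)))
    (S : Set (OnePoint K)) : Type _ :=
  {h : S × 𝒞 // BerkP1.ofPoint h.1.1 ∈ h.2.1}

/-- The dual graph `Γ(𝒞, S)` (its edges, without the half-open ones, form `Γ(𝒞)`). The set `Z` is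
everything for coverings of the projective line; for coverings of an open disc it is the complement
of a boundary annulus of the disc. -/
def dualGraph {K : Type*} [NormedField K] [IsUltrametricDist K] (Z : Set (BerkP1 K))
    (𝒞 : Finset (Set (BerkP1 K))) (S : Set (OnePoint K)) :
    HalfOpenGraph 𝒞 (DualEdge Z 𝒞) (DualHalfEdge 𝒞 S) where
  ends e := match e with
    | Sum.inl e => e.1.1
    | Sum.inr e => s(e.1, e.1)
  attach := fun h => h.1.2

/-- What coverings of the projective line and of open discs have in common: `𝒞` is a finite
covering of `Y` by rational basic wide opens, with finite dual graph, such that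
each member is disconnected from (being open: disjoint from) every component of the
intersection of two others, and the cores are affinoids with semistable reduction. -/
structure IsPreSemistable {K : Type*} [NormedField K] [IsUltrametricDist K]
    (Y Z : Set (BerkP1 K)) (𝒞 : Finset (Set (BerkP1 K))) : Prop where
  covers : (⋃ U ∈ 𝒞, U) = Y
  wideOpen : ∀ U ∈ 𝒞, IsRationalBasicWideOpen U
  finite_edges : Finite (DualEdge Z 𝒞)
  disconnected : ∀ U ∈ 𝒞, ∀ V ∈ 𝒞, ∀ W ∈ 𝒞, U ≠ V → U ≠ W → V ≠ W →
    ∀ A ∈ componentsOf (V ∩ W), Disjoint U A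
  core : ∀ U ∈ 𝒞, IsSemistableAffinoid (coreIn Z 𝒞 U)

/-- Semistable coverings of the projective line by rational basic wide opens. -/
structure IsSemistableCoveringP1 {K : Type*} [NormedField K] [IsUltrametricDist K]
    (𝒞 : Finset (Set (BerkP1 K))) : Prop extends IsPreSemistable univ univ 𝒞 where
  genus : (curveGenus K (RatFunc K) : ℤ) =
    ∑ U ∈ 𝒞, (reductionGenus (coreIn univ 𝒞 U) : ℤ) + (dualGraph univ 𝒞 ∅).firstBetti

/-- The open disc `B(β, R)`. -/
def openDiscAt {K : Type*} [NormedField K] (β : K) (R : ℝ) : Set (BerkP1 K) :=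
  {x | ∃ y : BerkA1 K, x = y ∧ y.1 (X - C β) < R}

/-- The closed disc of centre `β` and radius `r`. -/
def closedDiscAt {K : Type*} [NormedField K] (β : K) (r : ℝ) : Set (BerkP1 K) :=
  {x | ∃ y : BerkA1 K, x = y ∧ y.1 (X - C β) ≤ r}

/-- Semistable coverings of the open disc `Y = B(β, R)` by rational basic wide opens. A boundary
annulus `Y \ B̄(γ, r)` of `Y` (any point `γ` of `Y` is a centre of `Y`) lies in the member `root`
and meets no other one; it is a boundary annulus of `root`, and is removed when the affinoid
attached to `root` is formed. The genera of the disc and of the members of the covering are zero,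
so that the genus condition says that the first Betti number of the dual graph vanishes. -/
structure IsSemistableCoveringDisc {K : Type*} [NormedField K] [IsUltrametricDist K]
    (β : K) (R : ℝ) (γ : K) (r : ℝ) (𝒞 : Finset (Set (BerkP1 K))) (root : Set (BerkP1 K)) : Prop
    extends IsPreSemistable (openDiscAt β R) (closedDiscAt γ r) 𝒞 where
  centre : ‖γ - β‖ < R
  radius : (∃ a : K, a ≠ 0 ∧ ‖a‖ = r) ∧ r < R
  root_mem : root ∈ 𝒞
  annulus_subset_root : openDiscAt β R \ closedDiscAt γ r ⊆ root
  others_subset : ∀ U ∈ 𝒞, U ≠ root → U ⊆ closedDiscAt γ r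
  genus : (dualGraph (closedDiscAt γ r) 𝒞 ∅).firstBetti = 0

end

noncomputable section

/-! ### Regular differentials of the projective line -/

/-! A finite set `S` of at least two points of `K` is organised by its clusters, the traces on `S`
of closed discs that contain at least two of its points. By the ultrametric inequality two clusters
with a common point are nested, so under inclusion the clusters form a tree whose root is `S`. To a
cluster belong the smallest closed disc containing it, whose radius is the diameter of the cluster,
and a larger open disc, whose radius is the distance to the remaining points of `S`. Below the root
that distance is the diameter of the parent cluster; at the root it is prescribed. The wide open of
a cluster is its open disc minus the closed discs of the smaller clusters. `DiscTree` records what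
is needed of this configuration, and `Cluster.discTree` supplies it.

Two of these wide opens meet only if one is the parent of the other, and then in the open annulus
between the two discs of the child (`DiscTree.wideOpen_inter_wideOpen_parent`). Annuli are
connected: a point can be thickened continuously until it becomes the maximal point of a disc about
the centre, and these maximal points form an interval (`BerkA1.isPreconnected_annulus`). So every
vertex except the root contributes exactly one edge, and the dual graph is a tree unless there are
self-edges (`IsTreeFamily.isTree`).

Self-edges and genera are excluded by computing the canonical reductions. A core is a closed disc
without some residue discs, and its affine coordinate presents the reduction as an open part of the
affine line over the residue field, which is algebraically closed
(`IsReductionCoordinate.isLocalization`). Such a curve is regular, irreducible and of genus zero, as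
a rational function field has no regular differentials (`regularDifferentials_eq_bot`). The same
fact makes the left side of the genus formula zero, so that the formula reduces to the vanishing of
the Betti number.

A point of `S` in the wide open of a cluster lies in that cluster and in no smaller one. Two such
points in one residue disc would span a smaller cluster; this gives goodness
(`Cluster.separates_discTree`).

For an open disc, the prescribed radius at the root is the radius of the disc. For the projective
line, it is any large radius, and the complement of the root's closed disc is added as a new root,
containing infinity. Auxiliary points ensure that a cluster exists; they do no harm because goodness
passes to smaller sets. -/

theorem Polynomial.degree_mul_lt_degree_mul_of_lt {R : Type*} [CommRing R] [IsDomain R]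
    {P Q T : R[X]} (h : P.degree < Q.degree) (hT : T ≠ 0) : (P * T).degree < (Q * T).degree := by
  have hQ : Q ≠ 0 := by rintro rfl; simp at h
  by_cases hP : P = 0
  · simpa [hP, bot_lt_iff_ne_bot] using ⟨hQ, hT⟩
  · rw [degree_mul, degree_mul]
    rw [degree_eq_natDegree hP, degree_eq_natDegree hQ] at *
    rw [degree_eq_natDegree hT]
    norm_cast at *
    omega

section Differentials

variable (k F : Type*) [Field k] [CommRing F] [IsDomain F] [Algebra k F] [Algebra k[X] F]
  [IsScalarTower k k[X] F] [IsFractionRing k[X] F]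

/-- The trivialization `h dX ↦ h` of the differentials of a field of rational functions. -/
def kaehlerRatEquiv : Ω[F⁄k] ≃ₗ[F] F :=
  haveI : IsLocalizedModule (nonZeroDivisors k[X])
      ((Algebra.linearMap k[X] F).comp (KaehlerDifferential.polynomialEquiv k).toLinearMap) :=
    IsLocalizedModule.of_linearEquiv_right _ _ _
  LinearEquiv.extendScalarsOfIsLocalization (nonZeroDivisors k[X]) F
    (IsLocalizedModule.linearEquiv (nonZeroDivisors k[X])
      (KaehlerDifferential.map k k k[X] F)
      ((Algebra.linearMap k[X] F).comp (KaehlerDifferential.polynomialEquiv k).toLinearMap))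

omit [IsDomain F] in
theorem kaehlerRatEquiv_D_algebraMap (P : k[X]) :
    kaehlerRatEquiv k F (KaehlerDifferential.D k F (algebraMap k[X] F P)) =
      algebraMap k[X] F (derivative P) := by
  have h := IsLocalizedModule.linearEquiv_apply (nonZeroDivisors k[X])
    (KaehlerDifferential.map k k k[X] F)
    ((Algebra.linearMap k[X] F).comp (KaehlerDifferential.polynomialEquiv k).toLinearMap)
    (KaehlerDifferential.D k k[X] P)
  rw [KaehlerDifferential.map_D] at h
  exact h.trans (by simp)

omit [IsDomain F] in
-- The quotient rule with denominators cleared. In this form the local subalgebra at `q`, and the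
-- functions vanishing at infinity, can be checked directly on numerators and denominators.
theorem mul_kaehlerRatEquiv_D {P Q : k[X]} {f : F}
    (h : algebraMap k[X] F Q * f = algebraMap k[X] F P) :
    algebraMap k[X] F (Q * Q) * kaehlerRatEquiv k F (KaehlerDifferential.D k F f) =
      algebraMap k[X] F (derivative P * Q - P * derivative Q) := by
  have h1 := congrArg (fun t => kaehlerRatEquiv k F (KaehlerDifferential.D k F t)) h
  simp only [Derivation.leibniz, map_add, map_smul, smul_eq_mul,
    kaehlerRatEquiv_D_algebraMap] at h1
  simp only [map_mul, map_sub, ← h, ← h1]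
  ring

variable {k F}

omit [IsDomain F] in
/-- If a module `N` over a subalgebra `O` contains the derivatives of the elements of `O`, then it
contains the coefficients of all differentials coming from `O`. -/
theorem kaehlerRatEquiv_mem_of_mem_range (O : Subalgebra k F) (N : AddSubmonoid F)
    (hN : ∀ a ∈ O, ∀ n ∈ N, a * n ∈ N)
    (hD : ∀ a ∈ O, kaehlerRatEquiv k F (KaehlerDifferential.D k F a) ∈ N) {w : Ω[F⁄k]}
    (hw : w ∈ (LinearMap.range (KaehlerDifferential.map k k O F)).restrictScalars k) :
    kaehlerRatEquiv k F w ∈ N := by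
  obtain ⟨v, rfl⟩ := hw
  have hv : v ∈ Submodule.span O (Set.range (KaehlerDifferential.D k O)) := by
    rw [KaehlerDifferential.span_range_derivation]; trivial
  induction hv using Submodule.span_induction with
  | mem v hv =>
    obtain ⟨a, rfl⟩ := hv
    rw [KaehlerDifferential.map_D]
    exact hD _ a.2
  | zero => simp
  | add u v _ _ hu hv =>
    rw [map_add, map_add]
    exact N.add_mem hu hv
  | smul a v _ hv =>
    rw [map_smul, ← algebraMap_smul F a, map_smul]
    exact hN _ a.2 _ hv

variable (k F)

omit [IsDomain F] [Algebra k F] [IsScalarTower k k[X] F] in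
theorem exists_mul_eq_of_isRelPrime (f : F) : ∃ P Q : k[X], Q ≠ 0 ∧ IsRelPrime P Q ∧
    algebraMap k[X] F Q * f = algebraMap k[X] F P := by
  let _ : Field F := IsFractionRing.toField k[X]
  obtain ⟨P, Q, hPQ, h⟩ := IsFractionRing.exists_reduced_fraction k[X] (K := F) f
  refine ⟨P, Q, nonZeroDivisors.ne_zero Q.2, hPQ, ?_⟩
  rw [← h, mul_comm]
  exact IsLocalization.mk'_spec F P Q

/-- The rational functions without pole at the irreducible polynomial `q`. -/
def localSubalgebra {q : k[X]} (hq : Prime q) : Subalgebra k F where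
  carrier := {f | ∃ P Q : k[X], ¬ q ∣ Q ∧ algebraMap k[X] F Q * f = algebraMap k[X] F P}
  mul_mem' := by
    rintro f g ⟨P, Q, hQ, h⟩ ⟨P', Q', hQ', h'⟩
    refine ⟨P * P', Q * Q', hq.not_dvd_mul hQ hQ', ?_⟩
    rw [map_mul, map_mul, ← h, ← h']; ring
  add_mem' := by
    rintro f g ⟨P, Q, hQ, h⟩ ⟨P', Q', hQ', h'⟩
    refine ⟨P * Q' + P' * Q, Q * Q', hq.not_dvd_mul hQ hQ', ?_⟩
    simp only [map_mul, map_add, ← h, ← h']; ring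
  algebraMap_mem' a := ⟨C a, 1, fun h => hq.not_isUnit (isUnit_of_dvd_one h), by
    rw [map_one, one_mul, IsScalarTower.algebraMap_apply k k[X] F]; rfl⟩

/-- The rational functions without pole at infinity. -/
def inftySubalgebra : Subalgebra k F where
  carrier := {f | ∃ P Q : k[X], Q ≠ 0 ∧ P.natDegree ≤ Q.natDegree ∧
    algebraMap k[X] F Q * f = algebraMap k[X] F P}
  mul_mem' := by
    rintro f g ⟨P, Q, hQ, hd, h⟩ ⟨P', Q', hQ', hd', h'⟩
    refine ⟨P * P', Q * Q', mul_ne_zero hQ hQ', ?_, ?_⟩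
    · rw [natDegree_mul hQ hQ']
      exact natDegree_mul_le.trans (add_le_add hd hd')
    · rw [map_mul, map_mul, ← h, ← h']; ring
  add_mem' := by
    rintro f g ⟨P, Q, hQ, hd, h⟩ ⟨P', Q', hQ', hd', h'⟩
    refine ⟨P * Q' + P' * Q, Q * Q', mul_ne_zero hQ hQ', ?_, ?_⟩
    · rw [natDegree_mul hQ hQ']
      refine natDegree_add_le_of_degree_le (natDegree_mul_le_of_le hd le_rfl) ?_
      rw [add_comm]
      exact natDegree_mul_le_of_le hd' le_rfl
    · simp only [map_mul, map_add, ← h, ← h']; ring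
  algebraMap_mem' a := ⟨C a, 1, one_ne_zero, by simp, by
    rw [map_one, one_mul, IsScalarTower.algebraMap_apply k k[X] F]; rfl⟩

/-- The rational functions with a zero at infinity. -/
def inftyIdeal : AddSubmonoid F where
  carrier := {f | ∃ P Q : k[X], P.degree < Q.degree ∧
    algebraMap k[X] F Q * f = algebraMap k[X] F P}
  zero_mem' := ⟨0, 1, by simp, by simp⟩
  add_mem' := by
    rintro f g ⟨P, Q, hd, h⟩ ⟨P', Q', hd', h'⟩
    refine ⟨P * Q' + P' * Q, Q * Q', ?_, ?_⟩
    · have hQ : Q ≠ 0 := by rintro rfl; simp at hd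
      have hQ' : Q' ≠ 0 := by rintro rfl; simp at hd'
      refine (degree_add_le _ _).trans_lt (max_lt ?_ ?_)
      · exact degree_mul_lt_degree_mul_of_lt hd hQ'
      · rw [mul_comm Q]
        exact degree_mul_lt_degree_mul_of_lt hd' hQ
    · simp only [map_mul, map_add, ← h, ← h']; ring

/-- Write the differential as `h dX`. Regularity at the finite places makes `h` a polynomial.
Derivatives of functions without pole at infinity vanish there, so regularity at infinity makes `h`
vanish at infinity, and such a polynomial is zero. (At infinity the derivative even has a double
zero, but a simple one is enough.) -/
theorem regularDifferentials_eq_bot : regularDifferentials k F = ⊥ := by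
  have hinj : Function.Injective (algebraMap k[X] F) := IsFractionRing.injective _ _
  rw [eq_bot_iff]
  intro w hw
  simp only [regularDifferentials, Submodule.mem_iInf] at hw
  suffices h : kaehlerRatEquiv k F w = 0 by simpa using h
  obtain ⟨P, Q, hQ0, hPQ, hw'⟩ := exists_mul_eq_of_isRelPrime k F (kaehlerRatEquiv k F w)
  -- An irreducible factor of the denominator would be a pole; the local ring there is tested.
  have hQ : IsUnit Q := by
    by_contra hQ
    obtain ⟨q, hq, hqQ⟩ := WfDvdMonoid.exists_irreducible_factor hQ hQ0
    have hq := hq.prime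
    have key : kaehlerRatEquiv k F w ∈ (localSubalgebra k F hq).toSubmodule.toAddSubmonoid := by
      refine kaehlerRatEquiv_mem_of_mem_range (localSubalgebra k F hq) _
        (fun a ha n hn => (localSubalgebra k F hq).mul_mem ha hn) ?_ (hw _ ?_)
      · rintro f ⟨P, Q, hQ, h⟩
        exact ⟨_, Q * Q, hq.not_dvd_mul hQ hQ, mul_kaehlerRatEquiv_D k F h⟩
      · intro f
        obtain ⟨P, Q, hQ0, hPQ, h⟩ := exists_mul_eq_of_isRelPrime k F f
        by_cases hqQ : q ∣ Q
        · right
          have hqP : ¬ q ∣ P := fun hqP => hq.not_isUnit (hPQ hqP hqQ)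
          have hP : P ≠ 0 := by rintro rfl; simp at hqP
          let _ : Field F := IsFractionRing.toField k[X]
          have hP' : algebraMap k[X] F P ≠ 0 := by
            rwa [Ne, ← map_zero (algebraMap k[X] F), hinj.eq_iff]
          refine ⟨(algebraMap k[X] F P)⁻¹ * algebraMap k[X] F Q, ⟨Q, P, hqP, ?_⟩, ?_⟩
          · rw [← mul_assoc, mul_inv_cancel₀ hP', one_mul]
          · rw [mul_left_comm, mul_comm f, h, inv_mul_cancel₀ hP']
        · exact Or.inl ⟨P, Q, hqQ, h⟩
    obtain ⟨P', Q', hqQ', h'⟩ := key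
    have e : P * Q' = P' * Q := hinj (by rw [map_mul, map_mul, ← hw', ← h']; ring)
    have hd : q ∣ P * Q' := e ▸ dvd_mul_of_dvd_right hqQ P'
    exact hq.not_isUnit (hPQ ((hq.dvd_or_dvd hd).resolve_right hqQ') hqQ)
  have key : kaehlerRatEquiv k F w ∈ inftyIdeal k F := by
    refine kaehlerRatEquiv_mem_of_mem_range (inftySubalgebra k F) _ ?_ ?_ (hw _ ?_)
    · rintro f ⟨P, Q, hQ, hd, h⟩ g ⟨P', Q', hd', h'⟩
      refine ⟨P * P', Q * Q', ?_, ?_⟩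
      · have hQ' : Q' ≠ 0 := by rintro rfl; simp at hd'
        by_cases hP : P = 0
        · simpa [hP, bot_lt_iff_ne_bot] using ⟨hQ, hQ'⟩
        · calc (P * P').degree < (P * Q').degree := by
                rw [mul_comm, mul_comm P]; exact degree_mul_lt_degree_mul_of_lt hd' hP
            _ ≤ (Q * Q').degree := by
                rw [degree_mul, degree_mul]
                gcongr
                rw [degree_eq_natDegree hP, degree_eq_natDegree hQ]
                exact_mod_cast hd
      · rw [map_mul, map_mul, ← h, ← h']; ring
    · rintro f ⟨P, Q, hQ, hd, h⟩
      refine ⟨_, Q * Q, ?_, mul_kaehlerRatEquiv_D k F h⟩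
      have hQQ : degree (Q * Q) = ((Q.natDegree + Q.natDegree : ℕ) : WithBot ℕ) := by
        rw [degree_mul, degree_eq_natDegree hQ]; rfl
      rw [hQQ]
      -- Differentiation lowers the degree only in positive degree. If `Q` is constant, so is `P`,
      -- and the numerator is zero.
      by_cases hn : Q.natDegree = 0
      · have hP0 := natDegree_eq_zero.1 (Nat.le_zero.1 (hn ▸ hd))
        obtain ⟨a, ha⟩ := hP0
        obtain ⟨b, hb⟩ := natDegree_eq_zero.1 hn
        rw [← ha, ← hb]
        simp
      · refine (degree_sub_le _ _).trans_lt (max_lt ?_ ?_)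
        · refine degree_le_natDegree.trans_lt (Nat.cast_lt.2 (natDegree_mul_le.trans_lt ?_))
          have := natDegree_derivative_le P
          omega
        · refine degree_le_natDegree.trans_lt (Nat.cast_lt.2 (natDegree_mul_le.trans_lt ?_))
          have := natDegree_derivative_lt hn
          omega
    · intro f
      obtain ⟨P, Q, hQ0, hPQ, h⟩ := exists_mul_eq_of_isRelPrime k F f
      rcases le_total P.natDegree Q.natDegree with hd | hd
      · exact Or.inl ⟨P, Q, hQ0, hd, h⟩
      · by_cases hP : P = 0
        · left
          refine ⟨0, 1, one_ne_zero, by simp, ?_⟩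
          rw [hP, map_zero] at h
          rcases mul_eq_zero.1 h with h | h
          · exact absurd (hinj (h.trans (map_zero _).symm)) hQ0
          · simp [h]
        · right
          let _ : Field F := IsFractionRing.toField k[X]
          have hP' : algebraMap k[X] F P ≠ 0 := by
            rwa [Ne, ← map_zero (algebraMap k[X] F), hinj.eq_iff]
          refine ⟨(algebraMap k[X] F P)⁻¹ * algebraMap k[X] F Q, ⟨Q, P, hP, hd, ?_⟩, ?_⟩
          · rw [← mul_assoc, mul_inv_cancel₀ hP', one_mul]
          · rw [mul_left_comm, mul_comm f, h, inv_mul_cancel₀ hP']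
  obtain ⟨P', Q', hd, h'⟩ := key
  have e : P * Q' = P' * Q := hinj (by rw [map_mul, map_mul, ← hw', ← h']; ring)
  -- Since `Q` has degree zero, `P * Q' = P' * Q` with `P` nonzero would force `deg Q' ≤ deg P'`.
  have hP : P = 0 := by
    by_contra hP
    have h1 := congrArg degree e
    have hP' : P' ≠ 0 := by
      rintro rfl
      rw [zero_mul] at e
      rcases mul_eq_zero.1 e with h | rfl
      · exact hP h
      · simp at hd
    have hQ' : Q' ≠ 0 := by rintro rfl; simp at hd
    rw [degree_mul, degree_mul, degree_eq_zero_of_isUnit hQ, add_zero, degree_eq_natDegree hP,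
      degree_eq_natDegree hP', degree_eq_natDegree hQ'] at h1
    rw [degree_eq_natDegree hP', degree_eq_natDegree hQ'] at hd
    norm_cast at h1 hd
    omega
  rw [hP, map_zero] at hw'
  rcases mul_eq_zero.1 hw' with h | h
  · exact absurd (hinj (h.trans (map_zero _).symm)) hQ0
  · exact h

theorem curveGenus_eq_zero : curveGenus k F = 0 := by
  rw [curveGenus, regularDifferentials_eq_bot, finrank_bot]

end Differentials

/-! ### Localizations of the polynomial ring in one variable -/

section Localization

variable (k A : Type*) [Field k] [CommRing A] [Algebra k A] [Algebra k[X] A]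
  [IsScalarTower k k[X] A] (M : Submonoid k[X]) [IsLocalization M A]

omit [Algebra k A] [IsScalarTower k k[X] A] in
include M in
theorem isDomain_of_isLocalization_polynomial [Nontrivial A] :
    IsDomain A ∧ M ≤ nonZeroDivisors k[X] := by
  have hM : M ≤ nonZeroDivisors k[X] := by
    refine le_nonZeroDivisors_of_noZeroDivisors fun h0 => ?_
    have := IsLocalization.map_units A (⟨0, h0⟩ : M)
    simp at this
  exact ⟨IsLocalization.isDomain_of_le_nonZeroDivisors A hM, hM⟩

omit [IsScalarTower k k[X] A] in
include M in
-- As `k` is algebraically closed, base change to its algebraic closure gives back the domain `A`.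
theorem isAbsolutelyIrreducible_of_isLocalization_polynomial [IsAlgClosed k] [Nontrivial A] :
    IsAbsolutelyIrreducible k A := by
  have hA := (isDomain_of_isLocalization_polynomial k A M).1
  let e : k ≃ₐ[k] AlgebraicClosure k := AlgEquiv.ofBijective (Algebra.ofId _ _)
    (IsAlgClosed.algebraMap_bijective_of_isIntegral (k := k) (K := AlgebraicClosure k))
  let e' : AlgebraicClosure k ⊗[k] A ≃ₐ[k] A :=
    (Algebra.TensorProduct.congr e.symm AlgEquiv.refl).trans (Algebra.TensorProduct.lid k A)
  have : IsDomain (AlgebraicClosure k ⊗[k] A) := e'.toMulEquiv.isDomain A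
  exact PrimeSpectrum.irreducibleSpace

omit [Algebra k A] [IsScalarTower k k[X] A] in
include M in
theorem isRegularLocalRing_of_isLocalization_polynomial [Nontrivial A] (m : MaximalSpectrum A) :
    IsRegularLocalRing (Localization.AtPrime m.asIdeal) := by
  obtain ⟨hA, hM⟩ := isDomain_of_isLocalization_polynomial k A M
  have : IsDedekindDomain A := IsLocalization.isDedekindDomain k[X] hM A
  infer_instance

include M in
-- The fraction field of `A` is also the fraction field of `k[X]`, to which the computation of
-- differentials applies.
theorem curveGenus_fractionRing_of_isLocalization_polynomial [Nontrivial A] :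
    curveGenus k (FractionRing A) = 0 := by
  obtain ⟨hA, hM⟩ := isDomain_of_isLocalization_polynomial k A M
  have h1 : IsLocalization ((nonZeroDivisors A).comap (algebraMap k[X] A)) (FractionRing A) :=
    IsLocalization.localization_localization_isLocalization_of_has_all_units M _ _
      fun x hx => hx.mem_nonZeroDivisors
  have h2 : (nonZeroDivisors A).comap (algebraMap k[X] A) = nonZeroDivisors k[X] := by
    ext x
    rw [Submonoid.mem_comap, mem_nonZeroDivisors_iff_ne_zero, mem_nonZeroDivisors_iff_ne_zero, Ne,
      ← map_zero (algebraMap k[X] A), (IsLocalization.injective A hM).eq_iff]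
  rw [h2] at h1
  exact curveGenus_eq_zero k (FractionRing A)

end Localization

/-! ### The residue field -/

section ResidueField

variable {K : Type*} [NormedField K] [IsUltrametricDist K]

theorem norm_sub_le_max_of_isUltrametricDist (a b : K) :
    ‖a - b‖ ≤ max ‖a‖ ‖b‖ := by
  rw [sub_eq_add_neg, ← norm_neg b]
  exact IsUltrametricDist.norm_add_le_max a (-b)

theorem mem_valRing_iff {a : K} : a ∈ valRing K ↔ ‖a‖ ≤ 1 := by
  rw [Valuation.mem_valuationSubring_iff, NormedField.valuation_apply]
  exact_mod_cast Iff.rfl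

theorem residue_eq_zero_iff_norm_lt_one (a : valRing K) :
    IsLocalRing.residue (valRing K) a = 0 ↔ ‖(a : K)‖ < 1 := by
  rw [IsLocalRing.residue_eq_zero_iff, Valuation.mem_maximalIdeal_iff, NormedField.valuation_apply]
  exact_mod_cast Iff.rfl

theorem residue_ne_zero_iff_norm_eq_one (a : valRing K) :
    IsLocalRing.residue (valRing K) a ≠ 0 ↔ ‖(a : K)‖ = 1 := by
  rw [Ne, residue_eq_zero_iff_norm_lt_one, not_lt]
  exact ⟨fun h => le_antisymm (norm_valRing_le a) h, fun h => h.ge⟩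

variable (K) in
-- A monic polynomial lifts to a monic one over the valuation ring. A root of the lift in `K` is
-- integral, hence lies in the valuation ring, and its residue is a root.
theorem isAlgClosed_resField [IsAlgClosed K] : IsAlgClosed (resField K) := by
  refine IsAlgClosed.of_exists_root _ fun q hq hirr => ?_
  have hl : q ∈ lifts (IsLocalRing.residue (valRing K)) :=
    (lifts_iff_coeff_lifts q).2 fun n => IsLocalRing.residue_surjective _
  obtain ⟨P, hP, hdeg, hmon⟩ := lifts_and_degree_eq_and_monic hl hq
  have hd : (P.map (algebraMap (valRing K) K)).degree ≠ 0 := by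
    rw [degree_map_eq_of_injective (FaithfulSMul.algebraMap_injective _ _), hdeg]
    exact (degree_pos_of_irreducible hirr).ne'
  obtain ⟨x, hx⟩ := IsAlgClosed.exists_root _ hd
  have hint : IsIntegral (valRing K) x := ⟨P, hmon, by rwa [← eval_map]⟩
  obtain ⟨y, rfl⟩ := IsIntegrallyClosed.isIntegral_iff.1 hint
  refine ⟨IsLocalRing.residue _ y, ?_⟩
  have h0 : P.eval y = 0 := by
    apply FaithfulSMul.algebraMap_injective (valRing K) K
    rw [map_zero, ← eval₂_at_apply, ← eval_map]
    exact hx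
  rw [← hP, eval_map, eval₂_at_apply, h0, map_zero]

/-- A polynomial with nonzero reduction takes values of norm one outside a finite number of residue
discs. -/
theorem exists_norm_eval_eq_one [IsAlgClosed K] (T : Finset (valRing K)) {P : (valRing K)[X]}
    (hP : P.map (IsLocalRing.residue (valRing K)) ≠ 0) :
    ∃ w : valRing K, (∀ a ∈ T, 1 ≤ ‖(w : K) - a‖) ∧ ‖(P.map (algebraMap _ K)).eval (w : K)‖ = 1 := by
  have := isAlgClosed_resField K
  have hinf : Infinite (resField K) := IsAlgClosed.instInfinite
  -- One nonzero polynomial over the infinite residue field encodes both requirements: avoid the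
  -- residues of `T` and the zeros of the reduction of `P`.
  have hne : P.map (IsLocalRing.residue (valRing K)) *
      ∏ a ∈ T, (X - C (IsLocalRing.residue (valRing K) a)) ≠ 0 :=
    mul_ne_zero hP (Finset.prod_ne_zero_iff.2 fun a _ => X_sub_C_ne_zero _)
  obtain ⟨x, hx⟩ : ∃ x, (P.map (IsLocalRing.residue (valRing K)) *
      ∏ a ∈ T, (X - C (IsLocalRing.residue (valRing K) a))).eval x ≠ 0 := by
    by_contra! h
    exact hne (Polynomial.funext (by simpa using h))
  obtain ⟨w, rfl⟩ := IsLocalRing.residue_surjective x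
  rw [eval_mul, eval_prod, mul_ne_zero_iff, Finset.prod_ne_zero_iff] at hx
  refine ⟨w, fun a ha => ?_, ?_⟩
  · have h := hx.2 a ha
    rw [eval_sub, eval_X, eval_C, ← map_sub, residue_ne_zero_iff_norm_eq_one] at h
    exact h.ge
  · have h := hx.1
    rw [eval_map, eval₂_at_apply, residue_ne_zero_iff_norm_eq_one] at h
    rw [eval_map]
    rw [← h]
    congr 1
    exact eval₂_at_apply (algebraMap (valRing K) K) w

/-- The complement of finitely many residue discs in the closed unit disc. -/
def unitDiscMinus (T : Finset (valRing K)) : Set K := {w | ‖w‖ ≤ 1 ∧ ∀ a ∈ T, 1 ≤ ‖w - a‖}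

theorem exists_norm_eval_eq_one_of_mem_unitDiscMinus [IsAlgClosed K] (T : Finset (valRing K))
    {P : (valRing K)[X]} (hP : P.map (IsLocalRing.residue (valRing K)) ≠ 0) :
    ∃ w ∈ unitDiscMinus T, ‖(P.map (algebraMap _ K)).eval w‖ = 1 :=
  let ⟨w, h, h'⟩ := exists_norm_eval_eq_one T hP
  ⟨w, ⟨norm_valRing_le w, h⟩, h'⟩

theorem unitDiscMinus_nonempty [IsAlgClosed K] (T : Finset (valRing K)) :
    (unitDiscMinus T).Nonempty :=
  let ⟨w, h, _⟩ := exists_norm_eval_eq_one_of_mem_unitDiscMinus T (P := 1) (by simp)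
  ⟨w, h⟩

/-- The Gauss norm of a polynomial is at most its supremum norm. -/
theorem exists_map_eq_of_norm_eval_le_one [IsAlgClosed K] (T : Finset (valRing K)) {P : K[X]}
    (hP : ∀ w ∈ unitDiscMinus T, ‖P.eval w‖ ≤ 1) :
    ∃ P' : (valRing K)[X], P'.map (algebraMap _ K) = P := by
  by_cases h0 : P = 0
  · exact ⟨0, by simp [h0]⟩
  obtain ⟨n, hn, hmax⟩ := P.support.exists_max_image (fun i => ‖P.coeff i‖)
    (support_nonempty.2 h0)
  have hmax : ∀ i, ‖P.coeff i‖ ≤ ‖P.coeff n‖ := fun i => by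
    by_cases hi : i ∈ P.support
    · exact hmax i hi
    · rw [notMem_support_iff.1 hi, norm_zero]; exact norm_nonneg _
  have hn0 : P.coeff n ≠ 0 := mem_support_iff.1 hn
  have lift : ∀ Q : K[X], (∀ i, ‖Q.coeff i‖ ≤ 1) →
      ∃ Q' : (valRing K)[X], Q'.map (algebraMap _ K) = Q := fun Q hQ =>
    (lifts_iff_coeff_lifts Q).2 fun i => ⟨⟨_, mem_valRing_iff.2 (hQ i)⟩, rfl⟩
  -- Dividing by a coefficient of maximal norm gives integral coefficients, one of them equal to
  -- one, hence a nonzero reduction.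
  obtain ⟨Q, hQ⟩ := lift (C (P.coeff n)⁻¹ * P) fun i => by
    rw [coeff_C_mul, norm_mul, norm_inv]
    exact inv_mul_le_one_of_le₀ (hmax i) (norm_nonneg _)
  have hQ0 : Q.map (IsLocalRing.residue (valRing K)) ≠ 0 := by
    intro h
    have h1 := congrArg (fun R => coeff R n) h
    have h2 := congrArg (fun R => coeff R n) hQ
    simp only [coeff_map, coeff_zero, coeff_C_mul, inv_mul_cancel₀ hn0] at h1 h2
    rw [residue_eq_zero_iff_norm_lt_one] at h1
    have h3 : ((Q.coeff n : valRing K) : K) = 1 := h2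
    rw [h3, norm_one] at h1
    exact lt_irrefl _ h1
  obtain ⟨w, hw, hw1⟩ := exists_norm_eval_eq_one_of_mem_unitDiscMinus T hQ0
  rw [hQ, eval_mul, eval_C, norm_mul, norm_inv] at hw1
  have h1 : ‖P.coeff n‖ ≤ 1 := by
    have h2 := norm_pos_iff.2 hn0
    have h3 := hP w hw
    rw [inv_mul_eq_one₀ h2.ne'] at hw1
    rwa [hw1]
  exact lift P fun i => (hmax i).trans h1

/-- A polynomial without zeros on the complement of residue discs is a constant times a polynomial
of constant norm one there. -/
theorem exists_eq_C_mul_of_eval_ne_zero [IsAlgClosed K] (T : Finset (valRing K)) {Q : K[X]}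
    (hQ : ∀ w ∈ unitDiscMinus T, Q.eval w ≠ 0) :
    ∃ (c : K) (Q' : (valRing K)[X]), c ≠ 0 ∧ Q = C c * Q'.map (algebraMap _ K) ∧
      ∀ w ∈ unitDiscMinus T, ‖(Q'.map (algebraMap _ K)).eval w‖ = 1 := by
  have hQ0 : Q ≠ 0 := by
    rintro rfl
    obtain ⟨w, hw⟩ := unitDiscMinus_nonempty T
    exact hQ w hw (by simp)
  have key : ∀ s : Multiset K, (∀ b ∈ s, b ∉ unitDiscMinus T) →
      ∃ (c : K) (Q' : (valRing K)[X]), c ≠ 0 ∧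
        (s.map fun b => X - C b).prod = C c * Q'.map (algebraMap _ K) ∧
        ∀ w ∈ unitDiscMinus T, ‖(Q'.map (algebraMap _ K)).eval w‖ = 1 := by
    intro s
    induction s using Multiset.induction_on with
    | empty => exact fun _ => ⟨1, 1, one_ne_zero, by simp, by simp⟩
    | cons b s ih =>
      intro hs
      obtain ⟨c, Q', hc, h, h1⟩ := ih fun b' hb' => hs b' (Multiset.mem_cons_of_mem hb')
      rw [Multiset.map_cons, Multiset.prod_cons, h]
      -- A zero in the unit disc lies in a removed residue disc, so `w - b` has norm one for all `w`
      -- that remain. A zero `b` outside the unit disc contributes `-b` times `1 - b⁻¹ X`, and the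
      -- latter has norm one on the whole unit disc.
      by_cases hb : ‖b‖ ≤ 1
      · let b' : valRing K := ⟨b, mem_valRing_iff.2 hb⟩
        refine ⟨c, (X - C b') * Q', hc, ?_, fun w hw => ?_⟩
        · rw [Polynomial.map_mul, Polynomial.map_sub, map_X, map_C]
          change _ = C c * ((X - C b) * _)
          ring
        · rw [Polynomial.map_mul, Polynomial.map_sub, map_X, map_C, eval_mul, norm_mul, h1 w hw,
            mul_one, eval_sub, eval_X, eval_C]
          change ‖w - b‖ = 1
          have hb2 := hs b (Multiset.mem_cons_self b s)
          simp only [unitDiscMinus, mem_ofPred_eq, not_and, not_forall, not_le] at hb2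
          obtain ⟨a, ha, hab⟩ := hb2 hb
          refine le_antisymm ((norm_sub_le_max_of_isUltrametricDist _ _).trans (max_le hw.1 hb)) ?_
          by_contra! hlt
          have h3 : w - a = (w - b) + (b - a) := by ring
          have h4 := hw.2 a ha
          rw [h3] at h4
          exact absurd (h4.trans (IsUltrametricDist.norm_add_le_max _ _))
            (not_le.2 (max_lt hlt hab))
      · push Not at hb
        have hb0 : b ≠ 0 := by rintro rfl; simp at hb; linarith
        have hb1 : ‖b⁻¹‖ < 1 := by rw [norm_inv]; exact inv_lt_one_of_one_lt₀ hb
        let b' : valRing K := ⟨b⁻¹, mem_valRing_iff.2 hb1.le⟩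
        refine ⟨-b * c, (1 - C b' * X) * Q', mul_ne_zero (neg_ne_zero.2 hb0) hc, ?_,
          fun w hw => ?_⟩
        · rw [Polynomial.map_mul, Polynomial.map_sub, Polynomial.map_mul, map_X, map_C,
            Polynomial.map_one]
          change _ = C (-b * c) * ((1 - C b⁻¹ * X) * _)
          have h5 : C b * C b⁻¹ = (1 : K[X]) := by rw [← C_mul, mul_inv_cancel₀ hb0, C_1]
          rw [C_mul, C_neg]
          linear_combination (-(C c * X * Q'.map (algebraMap _ K))) * h5
        · rw [Polynomial.map_mul, Polynomial.map_sub, Polynomial.map_mul, map_X, map_C,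
            Polynomial.map_one, eval_mul, norm_mul, h1 w hw, mul_one, eval_sub, eval_mul, eval_X,
            eval_C, eval_one]
          change ‖1 - b⁻¹ * w‖ = 1
          have h6 : ‖b⁻¹ * w‖ < 1 := by
            rw [norm_mul]
            exact (mul_le_of_le_one_right (norm_nonneg _) hw.1).trans_lt hb1
          have h7 := IsUltrametricDist.norm_sub_eq_max_of_norm_sub_ne_norm_sub
            (1 : K) 0 (b⁻¹ * w) (by simpa using h6.ne')
          simp only [sub_zero, zero_sub, norm_neg, norm_one] at h7
          rw [h7, max_eq_left h6.le]
  obtain ⟨c, Q', hc, h, h1⟩ := key Q.roots fun b hb hbT => hQ b hbT (mem_roots hQ0 |>.1 hb)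
  refine ⟨Q.leadingCoeff * c, Q', mul_ne_zero (leadingCoeff_ne_zero.2 hQ0) hc, ?_, h1⟩
  conv_lhs => rw [(IsAlgClosed.splits Q).eq_prod_roots, h]
  rw [C_mul, mul_assoc]

end ResidueField

/-! ### The canonical reduction of the complement of residue discs -/

section Reduction

variable {K : Type*} [NormedField K] {V : Set (BerkP1 K)}

theorem IsRationalFunctionOn.inv {f : ratPoints V → K} (hf : IsRationalFunctionOn V f)
    (h0 : ∀ v, f v ≠ 0) : IsRationalFunctionOn V (fun v => (f v)⁻¹) := by
  obtain ⟨n, P, Q, hP, hQ, h⟩ := hf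
  refine ⟨n, Q, P, hQ, hP, fun v => ⟨fun h1 => h0 v ?_, ?_⟩⟩
  · rw [(h v).2, h1, zero_div]
  · change (f v)⁻¹ = _
    rw [(h v).2, inv_div]

theorem IsRationalFunctionOn.eval {f : ratPoints V → K} (hf : IsRationalFunctionOn V f)
    (P : K[X]) : IsRationalFunctionOn V (fun v => P.eval (f v)) := by
  induction P using Polynomial.induction_on' with
  | add P Q hP hQ => simpa only [eval_add] using! hP.add hQ
  | monomial n a =>
    simp only [eval_monomial]
    refine (IsRationalFunctionOn.const V a).mul (g := fun v => f v ^ n) ?_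
    induction n with
    | zero => simpa using IsRationalFunctionOn.const V 1
    | succ n ih => simpa only [pow_succ] using! ih.mul hf

theorem IsRationalFunctionOn.isAnalyticOn {f : ratPoints V → K} (hf : IsRationalFunctionOn V f) :
    IsAnalyticOn V f := fun ε hε => ⟨f, hf, fun z => by simpa using hε⟩

variable [IsUltrametricDist K]

/-- `z` is a coordinate that identifies `V` with the complement of finitely many residue discs in
the closed unit disc. -/
structure IsReductionCoordinate (V : Set (BerkP1 K)) (T : Finset (valRing K))
    (z : ratPoints V → K) : Prop where
  range_eq : Set.range z = unitDiscMinus T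
  rational : IsRationalFunctionOn V z
  exists_eq_div : ∀ r, IsRationalFunctionOn V r →
    ∃ P Q : K[X], ∀ v, Q.eval (z v) ≠ 0 ∧ r v = P.eval (z v) / Q.eval (z v)

/-- The canonical projection `A° → A° / A°°`. -/
def toReductionRing (V : Set (BerkP1 K)) : unitBallRing V →+* reductionRing V :=
  Ideal.Quotient.mk (openBallIdeal V)

theorem toReductionRing_surjective : Function.Surjective (toReductionRing V) :=
  Ideal.Quotient.mk_surjective

theorem toReductionRing_eq_zero_iff (f : unitBallRing V) :
    toReductionRing V f = 0 ↔ ∃ c : ℝ, 0 ≤ c ∧ c < 1 ∧ ∀ z, ‖f.1 z‖ ≤ c :=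
  Ideal.Quotient.eq_zero_iff_mem

variable {T : Finset (valRing K)} {z : ratPoints V → K}

namespace IsReductionCoordinate

theorem mem (hz : IsReductionCoordinate V T z) (v : ratPoints V) : z v ∈ unitDiscMinus T :=
  hz.range_eq ▸ mem_range_self v

/-- The coordinate, as a function of supremum norm at most one. -/
def toUnitBall (hz : IsReductionCoordinate V T z) : unitBallRing V :=
  ⟨z, hz.rational.isAnalyticOn, fun v => (hz.mem v).1⟩

theorem aeval_toUnitBall (hz : IsReductionCoordinate V T z) (P : (valRing K)[X])
    (v : ratPoints V) :
    (aeval hz.toUnitBall P).1 v = (P.map (algebraMap (valRing K) K)).eval (z v) := by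
  have h := aeval_algHom_apply (((Pi.evalAlgHom (valRing K) (fun _ : ratPoints V => K) v).comp
    (unitBallRing V).val)) hz.toUnitBall P
  rw [eval_map_algebraMap]
  exact h.symm

/-- The homomorphism from the polynomial ring over the residue field that sends the variable to
the reduction of the coordinate. -/
def reductionHom (hz : IsReductionCoordinate V T z) : (resField K)[X] →ₐ[resField K]
    reductionRing V :=
  aeval (toReductionRing V hz.toUnitBall)

theorem reductionHom_map (hz : IsReductionCoordinate V T z) (P : (valRing K)[X]) :
    hz.reductionHom (P.map (IsLocalRing.residue (valRing K))) =
      toReductionRing V (aeval hz.toUnitBall P) := by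
  rw [reductionHom, aeval_def, eval₂_map, aeval_def, hom_eval₂]
  rfl

/-- A polynomial with nonzero reduction has norm one at some point of `V`, so it is not
topologically nilpotent. -/
theorem reductionHom_injective [IsAlgClosed K] (hz : IsReductionCoordinate V T z) :
    Function.Injective hz.reductionHom := by
  rw [injective_iff_map_eq_zero]
  intro p hp
  obtain ⟨P, rfl⟩ := map_surjective _ (IsLocalRing.residue_surjective (R := valRing K)) p
  by_contra h0
  rw [reductionHom_map, toReductionRing_eq_zero_iff] at hp
  obtain ⟨c, -, hc, h⟩ := hp
  obtain ⟨w, hw, hw1⟩ := exists_norm_eval_eq_one_of_mem_unitDiscMinus T h0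
  rw [← hz.range_eq] at hw
  obtain ⟨v, rfl⟩ := hw
  have := h v
  rw [aeval_toUnitBall, hw1] at this
  linarith

theorem isUnit_reductionHom (hz : IsReductionCoordinate V T z) (Q : (valRing K)[X])
    (hQ : ∀ w ∈ unitDiscMinus T, ‖(Q.map (algebraMap _ K)).eval w‖ = 1) :
    IsUnit (hz.reductionHom (Q.map (IsLocalRing.residue (valRing K)))) := by
  rw [reductionHom_map]
  refine IsUnit.map (toReductionRing V) (IsUnit.of_mul_eq_one
    ⟨fun v => ((Q.map (algebraMap _ K)).eval (z v))⁻¹, ?_, ?_⟩ ?_)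
  · refine ((hz.rational.eval _).inv fun v h => ?_).isAnalyticOn
    have h1 := hQ _ (hz.mem v)
    rw [h, norm_zero] at h1
    exact zero_ne_one h1
  · intro v
    rw [norm_inv, hQ _ (hz.mem v), inv_one]
  · ext v
    change (aeval hz.toUnitBall Q).1 v * _ = 1
    rw [aeval_toUnitBall, mul_inv_cancel₀]
    intro h
    have h1 := hQ _ (hz.mem v)
    rw [h, norm_zero] at h1
    exact zero_ne_one h1

/-- Every class in the reduction is represented by a rational function. Its denominator can be
scaled to have constant norm one on `V`; the numerator is then bounded by one, so it has integral
coefficients, and both can be reduced. -/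
theorem exists_mul_reductionHom_eq [IsAlgClosed K] (hz : IsReductionCoordinate V T z)
    (x : reductionRing V) : ∃ p q : (resField K)[X], IsUnit (hz.reductionHom q) ∧
      x * hz.reductionHom q = hz.reductionHom p := by
  obtain ⟨f, rfl⟩ := toReductionRing_surjective x
  -- Any bound below one would do: an error of norm at most `1 / 2` lies in the ideal that is
  -- divided out.
  obtain ⟨r, hr, hfr⟩ := f.2.1 (1 / 2) (by norm_num)
  obtain ⟨P, Q, h⟩ := hz.exists_eq_div r hr
  obtain ⟨c, Q', hc, hQ, hQ1⟩ := exists_eq_C_mul_of_eval_ne_zero T (Q := Q) fun w hw => by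
    rw [← hz.range_eq] at hw
    obtain ⟨v, rfl⟩ := hw
    exact (h v).1
  have hr1 : ∀ v, ‖r v‖ ≤ 1 := fun v => by
    have h1 : r v = f.1 v - (f.1 v - r v) := by ring
    rw [h1]
    refine (norm_sub_le_max_of_isUltrametricDist _ _).trans (max_le (f.2.2 v) ?_)
    exact (hfr v).le.trans (by norm_num)
  have hP : ∀ v, (C c⁻¹ * P).eval (z v) = r v * (Q'.map (algebraMap _ K)).eval (z v) := fun v => by
    have h1 := (h v).1
    rw [hQ, eval_mul, eval_C] at h1
    rw [(h v).2, hQ, eval_mul, eval_C, eval_mul, eval_C]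
    have h2 := (mul_ne_zero_iff.1 h1).2
    field_simp
  obtain ⟨P', hP'⟩ := exists_map_eq_of_norm_eval_le_one T (P := C c⁻¹ * P) fun w hw => by
    rw [← hz.range_eq] at hw
    obtain ⟨v, rfl⟩ := hw
    rw [hP, norm_mul, hQ1 _ (hz.mem v), mul_one]
    exact hr1 v
  refine ⟨P'.map (IsLocalRing.residue _), Q'.map (IsLocalRing.residue _),
    hz.isUnit_reductionHom Q' hQ1, ?_⟩
  rw [reductionHom_map, reductionHom_map, ← map_mul, ← sub_eq_zero, ← map_sub,
    toReductionRing_eq_zero_iff]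
  refine ⟨1 / 2, by norm_num, by norm_num, fun v => ?_⟩
  change ‖f.1 v * (aeval hz.toUnitBall Q').1 v - (aeval hz.toUnitBall P').1 v‖ ≤ _
  rw [aeval_toUnitBall, aeval_toUnitBall, hP', hP, ← sub_mul, norm_mul, hQ1 _ (hz.mem v), mul_one]
  exact (hfr v).le

/-- The canonical reduction is an open subscheme of the affine line. -/
theorem isLocalization [IsAlgClosed K] (hz : IsReductionCoordinate V T z) :
    letI := hz.reductionHom.toRingHom.toAlgebra
    IsLocalization ((IsUnit.submonoid (reductionRing V)).comap hz.reductionHom)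
      (reductionRing V) := by
  let _ := hz.reductionHom.toRingHom.toAlgebra
  refine ⟨fun y => y.2, fun x => ?_, fun {p q} h => ⟨1, ?_⟩⟩
  · obtain ⟨p, q, hq, h⟩ := hz.exists_mul_reductionHom_eq x
    exact ⟨(p, ⟨q, hq⟩), h⟩
  · rw [hz.reductionHom_injective h]

theorem nontrivial [IsAlgClosed K] (hz : IsReductionCoordinate V T z) :
    Nontrivial (reductionRing V) :=
  hz.reductionHom_injective.nontrivial

theorem isRegularLocalRing [IsAlgClosed K] (hz : IsReductionCoordinate V T z)
    (m : MaximalSpectrum (reductionRing V)) :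
    IsRegularLocalRing (Localization.AtPrime m.asIdeal) := by
  let _ := hz.reductionHom.toRingHom.toAlgebra
  have := hz.isLocalization
  have := hz.nontrivial
  have : IsScalarTower (resField K) (resField K)[X] (reductionRing V) :=
    IsScalarTower.of_algebraMap_eq fun a => (hz.reductionHom.commutes a).symm
  exact isRegularLocalRing_of_isLocalization_polynomial (resField K) _
    ((IsUnit.submonoid (reductionRing V)).comap hz.reductionHom) m

theorem not_isOrdinaryDoublePoint [IsAlgClosed K] (hz : IsReductionCoordinate V T z)
    (m : MaximalSpectrum (reductionRing V)) : ¬ IsOrdinaryDoublePoint (resField K) m :=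
  fun h => h.1 (hz.isRegularLocalRing m)

theorem isSemistableAffinoid [IsAlgClosed K] (hz : IsReductionCoordinate V T z)
    (hV : IsConnectedAffinoid V) : IsSemistableAffinoid V := by
  let _ := hz.reductionHom.toRingHom.toAlgebra
  have := hz.isLocalization
  have := hz.nontrivial
  have : IsScalarTower (resField K) (resField K)[X] (reductionRing V) :=
    IsScalarTower.of_algebraMap_eq fun a => (hz.reductionHom.commutes a).symm
  have := isAlgClosed_resField K
  have hd := (isDomain_of_isLocalization_polynomial (resField K) (reductionRing V)
    ((IsUnit.submonoid (reductionRing V)).comap hz.reductionHom)).1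
  exact ⟨hV, isAbsolutelyIrreducible_of_isLocalization_polynomial (resField K) _
    ((IsUnit.submonoid (reductionRing V)).comap hz.reductionHom), inferInstance,
    fun m => Or.inl (hz.isRegularLocalRing m)⟩

theorem reductionGenus_eq_zero [IsAlgClosed K] (hz : IsReductionCoordinate V T z) :
    reductionGenus V = 0 := by
  let _ := hz.reductionHom.toRingHom.toAlgebra
  have := hz.isLocalization
  have := hz.nontrivial
  have : IsScalarTower (resField K) (resField K)[X] (reductionRing V) :=
    IsScalarTower.of_algebraMap_eq fun a => (hz.reductionHom.commutes a).symm
  exact curveGenus_fractionRing_of_isLocalization_polynomial (resField K) _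
    ((IsUnit.submonoid (reductionRing V)).comap hz.reductionHom)

end IsReductionCoordinate

end Reduction

/-! ### Coordinates on discs -/

section Coordinates

variable {K : Type*} [NormedField K]

/-- The part of the closed disc of centre `s` and radius `ρ` outside the open discs of radius `ρ`
around the points of `T`. -/
def closedDiscMinus (s : K) (ρ : ℝ) (T : Finset K) : Set (BerkP1 K) :=
  {x | ∃ y : BerkA1 K, x = y ∧ y.1 (X - C s) ≤ ρ ∧ ∀ a ∈ T, ρ ≤ y.1 (X - C a)}

theorem BerkA1.ofPoint_X_sub_C (t a : K) : (BerkA1.ofPoint t).1 (X - C a) = ‖t - a‖ := by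
  change ‖(X - C a).eval t‖ = _
  simp

theorem coe_mem_ratPoints_closedDiscMinus {s : K} {ρ : ℝ} {T : Finset K} {t : K} :
    (t : OnePoint K) ∈ ratPoints (closedDiscMinus s ρ T) ↔ ‖t - s‖ ≤ ρ ∧ ∀ a ∈ T, ρ ≤ ‖t - a‖ := by
  simp only [← BerkA1.ofPoint_X_sub_C]
  constructor
  · rintro ⟨y, hy, h⟩
    obtain rfl : BerkA1.ofPoint t = y := OnePoint.coe_injective hy
    exact h
  · exact fun h => ⟨BerkA1.ofPoint t, rfl, h⟩

theorem infty_notMem_ratPoints_closedDiscMinus {s : K} {ρ : ℝ} {T : Finset K} :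
    (OnePoint.infty : OnePoint K) ∉ ratPoints (closedDiscMinus s ρ T) := by
  rintro ⟨y, hy, -⟩
  exact OnePoint.coe_ne_infty y hy.symm

/-- The coordinate `(T - s) / c`; its value at `∞` is irrelevant. -/
def affineCoordinate (s c : K) (x : OnePoint K) : K := OnePoint.elim x 0 (fun t => (t - s) / c)

/-- The coordinate `c / (T - s)`, with value zero at `∞`. -/
def inftyCoordinate (s c : K) (x : OnePoint K) : K := OnePoint.elim x 0 (fun t => c / (t - s))


theorem isReductionCoordinate_affineCoordinate [IsUltrametricDist K] {s c : K} (hc : c ≠ 0) {T : Finset K}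
    (hT : ∀ a ∈ T, ‖a - s‖ ≤ ‖c‖) :
    ∃ T' : Finset (valRing K), IsReductionCoordinate (closedDiscMinus s ‖c‖ T) T'
      (fun v => affineCoordinate s c v) := by
  classical
  have hc0 : 0 < ‖c‖ := norm_pos_iff.2 hc
  -- The removed discs in the new coordinate; `hT` says that their centres lie in the unit disc.
  let f : T → valRing K := fun a => ⟨(a - s) / c, mem_valRing_iff.2 <| by
    rw [norm_div]; exact div_le_one_of_le₀ (hT a a.2) hc0.le⟩
  have hmem : ∀ t : K, (t : OnePoint K) ∈ ratPoints (closedDiscMinus s ‖c‖ T) ↔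
      (t - s) / c ∈ unitDiscMinus (T.attach.image f) := by
    intro t
    rw [coe_mem_ratPoints_closedDiscMinus]
    refine and_congr ?_ ?_
    · rw [norm_div, div_le_one hc0]
    · have e : ∀ a : T, 1 ≤ ‖(t - s) / c - (f a : K)‖ ↔ ‖c‖ ≤ ‖t - a‖ := fun a => by
        change 1 ≤ ‖(t - s) / c - (a - s) / c‖ ↔ _
        rw [← sub_div, sub_sub_sub_cancel_right, norm_div, one_le_div hc0]
      constructor
      · intro h a ha
        obtain ⟨b, -, rfl⟩ := Finset.mem_image.1 ha
        exact (e b).2 (h b b.2)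
      · exact fun h a ha => (e ⟨a, ha⟩).1
          (h _ (Finset.mem_image_of_mem f (Finset.mem_attach T ⟨a, ha⟩)))
  refine ⟨T.attach.image f, ?_, ?_, ?_⟩
  · ext w
    constructor
    · rintro ⟨⟨v, hv⟩, rfl⟩
      induction v using OnePoint.rec with
      | infty => exact absurd hv infty_notMem_ratPoints_closedDiscMinus
      | coe t => exact (hmem t).1 hv
    · intro hw
      have e : (s + c * w - s) / c = w := by field_simp; ring
      exact ⟨⟨((s + c * w : K) : OnePoint K), (hmem _).2 (by rwa [e])⟩, e⟩
  · refine ⟨1, C c⁻¹ * X - C (c⁻¹ * s), 1, ?_, by simp, ?_⟩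
    · compute_degree
    · rintro ⟨v, hv⟩
      induction v using OnePoint.rec with
      | infty => exact absurd hv infty_notMem_ratPoints_closedDiscMinus
      | coe t =>
        simp only [homEval, affineCoordinate, OnePoint.elim_some, eval_one, ne_eq, one_ne_zero,
          not_false_eq_true, eval_sub, eval_mul, eval_C, eval_X, true_and, div_one]
        field_simp
  · rintro r ⟨n, P, Q, -, -, h⟩
    refine ⟨P.comp (C c * X + C s), Q.comp (C c * X + C s), ?_⟩
    rintro ⟨v, hv⟩
    induction v using OnePoint.rec with
    | infty => exact absurd hv infty_notMem_ratPoints_closedDiscMinus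
    | coe t =>
      have h1 := h ⟨t, hv⟩
      have e : c * ((t - s) / c) + s = t := by field_simp; ring
      simp only [eval_comp, eval_add, eval_mul, eval_C, eval_X, affineCoordinate,
        OnePoint.elim_some, e]
      exact h1

theorem coe_mem_ratPoints_compl_openDiscAt {s : K} {R : ℝ} {t : K} :
    (t : OnePoint K) ∈ ratPoints (openDiscAt s R)ᶜ ↔ R ≤ ‖t - s‖ := by
  rw [← not_lt, ← BerkA1.ofPoint_X_sub_C]
  refine not_congr ⟨?_, fun h => ⟨BerkA1.ofPoint t, rfl, h⟩⟩
  rintro ⟨y, hy, h⟩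
  obtain rfl : BerkA1.ofPoint t = y := OnePoint.coe_injective hy
  exact h

/-- The substitution `T = s + c / w` followed by multiplication by `w ^ n`. Numerator and
denominator of a rational function acquire the same factor, so their quotient becomes a rational
function of `w`; the value `w = 0` corresponds to infinity. -/
theorem eval_reflect_comp (s : K) {c : K} (hc : c ≠ 0) {n : ℕ} {P : K[X]} (hP : P.natDegree ≤ n) :
    (reflect n (P.comp (C s + C c * X))).eval 0 = c ^ n * P.coeff n ∧
    ∀ t, t ≠ s → (t - s) ^ n * (reflect n (P.comp (C s + C c * X))).eval (c / (t - s)) =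
      c ^ n * P.eval t := by
  have hq : (C s + C c * X).natDegree = 1 := by
    rw [add_comm]; exact natDegree_linear hc
  constructor
  · rw [← coeff_zero_eq_eval_zero, coeff_reflect, revAt_le (Nat.zero_le n), Nat.sub_zero, mul_comm (c ^ n)]
    rcases hP.lt_or_eq with h | rfl
    · rw [coeff_eq_zero_of_natDegree_lt h, zero_mul]
      refine coeff_eq_zero_of_natDegree_lt ?_
      rwa [natDegree_comp, hq, mul_one]
    · have h := coeff_comp_degree_mul_degree (p := P) (q := C s + C c * X) (by rw [hq]; simp)
      rw [hq, mul_one] at h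
      rw [h, leadingCoeff, leadingCoeff, hq]
      simp [coeff_C]
  · intro t ht
    have ht := sub_ne_zero.2 ht
    let _ : Invertible ((t - s) / c) := invertibleOfNonzero (div_ne_zero ht hc)
    have h := eval₂_reflect_mul_pow (RingHom.id K) ((t - s) / c) n (P.comp (C s + C c * X))
      (by rwa [natDegree_comp, hq, mul_one])
    rw [invOf_eq_inv, inv_div] at h
    simp only [eval₂_id, eval_comp, eval_add, eval_C, eval_mul, eval_X] at h
    rw [mul_div_cancel₀ _ hc, add_sub_cancel] at h
    rw [← h, div_pow]
    field_simp

theorem isReductionCoordinate_inftyCoordinate [IsUltrametricDist K] {s c : K} (hc : c ≠ 0) :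
    IsReductionCoordinate (openDiscAt s ‖c‖)ᶜ ∅ (fun v => inftyCoordinate s c v) := by
  have hc0 : 0 < ‖c‖ := norm_pos_iff.2 hc
  have hne : ∀ t : K, (t : OnePoint K) ∈ ratPoints (openDiscAt s ‖c‖)ᶜ → t - s ≠ 0 := by
    intro t ht h
    rw [coe_mem_ratPoints_compl_openDiscAt, h, norm_zero] at ht
    exact absurd ht (not_le.2 hc0)
  refine ⟨?_, ?_, ?_⟩
  · ext w
    constructor
    · rintro ⟨⟨v, hv⟩, rfl⟩
      induction v using OnePoint.rec with
      | infty => exact ⟨by simp [inftyCoordinate], by simp⟩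
      | coe t =>
        refine ⟨?_, by simp⟩
        change ‖c / (t - s)‖ ≤ 1
        rw [norm_div]
        exact div_le_one_of_le₀ (coe_mem_ratPoints_compl_openDiscAt.1 hv) (norm_nonneg _)
    · rintro ⟨hw, -⟩
      by_cases hw0 : w = 0
      · refine ⟨⟨OnePoint.infty, ?_⟩, hw0.symm⟩
        rintro ⟨y, hy, -⟩
        exact OnePoint.coe_ne_infty y hy.symm
      · refine ⟨⟨((s + c / w : K) : OnePoint K), ?_⟩, ?_⟩
        · rw [coe_mem_ratPoints_compl_openDiscAt, add_sub_cancel_left, norm_div]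
          exact le_div_self hc0.le (norm_pos_iff.2 hw0) hw
        · change c / (s + c / w - s) = w
          rw [add_sub_cancel_left, div_div_cancel₀ hc]
  · refine ⟨1, C c, X - C s, by simp, by compute_degree, ?_⟩
    rintro ⟨v, hv⟩
    induction v using OnePoint.rec with
    | infty => simp [homEval, inftyCoordinate, coeff_X]
    | coe t => simpa [homEval, inftyCoordinate] using hne t hv
  · rintro r ⟨n, P, Q, hP, hQ, h⟩
    refine ⟨reflect n (P.comp (C s + C c * X)), reflect n (Q.comp (C s + C c * X)), ?_⟩
    rintro ⟨v, hv⟩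
    have h1 := h ⟨v, hv⟩
    induction v using OnePoint.rec with
    | infty =>
      rw [h1.2]
      simp only [homEval, OnePoint.elim_infty, inftyCoordinate] at h1 ⊢
      rw [(eval_reflect_comp s hc hP).1, (eval_reflect_comp s hc hQ).1]
      refine ⟨mul_ne_zero (pow_ne_zero _ hc) h1.1, ?_⟩
      rw [mul_div_mul_left _ _ (pow_ne_zero _ hc)]
    | coe t =>
      rw [h1.2]
      simp only [homEval, OnePoint.elim_some, inftyCoordinate] at h1 ⊢
      have ht := hne t hv
      have eP := (eval_reflect_comp s hc hP).2 t (sub_ne_zero.1 ht)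
      have eQ := (eval_reflect_comp s hc hQ).2 t (sub_ne_zero.1 ht)
      have hQ0 : (reflect n (Q.comp (C s + C c * X))).eval (c / (t - s)) ≠ 0 := by
        intro h0
        rw [h0, mul_zero] at eQ
        exact mul_ne_zero (pow_ne_zero _ hc) h1.1 eQ.symm
      refine ⟨hQ0, ?_⟩
      rw [← mul_div_mul_left _ _ (pow_ne_zero n hc), ← eP, ← eQ,
        mul_div_mul_left _ _ (pow_ne_zero n ht)]

end Coordinates

/-! ### Gauss seminorms -/

section Gauss

variable {R : Type*} [CommRing R]

/-- A multiplicative seminorm that is bounded by one on the natural numbers is nonarchimedean. -/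
theorem MulRingSeminorm.isNonarchimedean_of_natCast_le_one (v : MulRingSeminorm R)
    (hv : ∀ n : ℕ, v n ≤ 1) : IsNonarchimedean v := by
  intro f g
  set M := max (v f) (v g) with hM
  have hM0 : 0 ≤ M := (apply_nonneg v f).trans (le_max_left _ _)
  -- The binomial expansion has `m + 1` terms, each at most `M ^ m`. If `v (f + g)` exceeded `M`,
  -- the left side would outgrow the right side exponentially.
  have key : ∀ m : ℕ, v (f + g) ^ m ≤ (m + 1) * M ^ m := by
    intro m
    rw [← map_pow, add_pow]
    calc v (∑ k ∈ Finset.range (m + 1), f ^ k * g ^ (m - k) * (m.choose k : R))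
        ≤ ∑ k ∈ Finset.range (m + 1), v (f ^ k * g ^ (m - k) * (m.choose k : R)) :=
          Finset.le_sum_of_subadditive v (map_zero v).le (map_add_le_add v) _ _
      _ ≤ ∑ k ∈ Finset.range (m + 1), M ^ m := by
          refine Finset.sum_le_sum fun k hk => ?_
          have hkm : k ≤ m := Nat.lt_succ_iff.1 (Finset.mem_range.1 hk)
          rw [map_mul, map_mul, map_pow, map_pow]
          calc v f ^ k * v g ^ (m - k) * v (m.choose k : R)
              ≤ v f ^ k * v g ^ (m - k) := mul_le_of_le_one_right
                (mul_nonneg (pow_nonneg (apply_nonneg v f) _) (pow_nonneg (apply_nonneg v g) _))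
                (hv _)
            _ ≤ M ^ k * M ^ (m - k) := mul_le_mul
                (pow_le_pow_left₀ (apply_nonneg v f) (le_max_left _ _) _)
                (pow_le_pow_left₀ (apply_nonneg v g) (le_max_right _ _) _)
                (pow_nonneg (apply_nonneg v g) _) (pow_nonneg hM0 _)
            _ = M ^ m := by rw [← pow_add, Nat.add_sub_cancel' hkm]
      _ = (m + 1) * M ^ m := by simp
  by_contra! hlt
  rcases hM0.eq_or_lt with h0 | h0
  · have h1 := key 1
    rw [← h0] at h1 hlt
    simp only [pow_one, mul_zero] at h1
    exact absurd h1 (not_le.2 hlt)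
  · obtain ⟨m, hm⟩ := Real.exists_natCast_add_one_lt_pow_of_one_lt ((one_lt_div h0).2 hlt)
    rw [div_pow, lt_div_iff₀ (pow_pos h0 m)] at hm
    exact absurd (key m) (not_le.2 hm)

open Finset in
-- Gauss's lemma. If `i` and `j` are the first indices at which `p` and `q` attain their norms, then
-- in the coefficient of index `i + j` the product of these two coefficients strictly dominates all
-- other terms.
theorem gaussNorm_mul_le_gaussNorm_mul (v : MulRingSeminorm R) (hna : IsNonarchimedean v) {c : ℝ}
    (hc : 0 < c) (p q : R[X]) :
    p.gaussNorm v c * q.gaussNorm v c ≤ (p * q).gaussNorm v c := by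
  have hc0 : 0 ≤ c := le_of_lt hc
  obtain ⟨i, hi_p, hlt_p⟩ := p.exists_min_eq_gaussNorm v hc0
  obtain ⟨j, hj_q, hlt_q⟩ := q.exists_min_eq_gaussNorm v hc0
  by_cases hvpq : v (p.coeff i) = 0 ∨ v (q.coeff j) = 0
  · rw [hi_p, hj_q]
    rcases hvpq with h | h <;> rw [h] <;> simpa using gaussNorm_nonneg v _ hc0
  push Not at hvpq
  have hp0 : 0 < v (p.coeff i) := lt_of_le_of_ne (apply_nonneg v _) hvpq.1.symm
  have hq0 : 0 < v (q.coeff j) := lt_of_le_of_ne (apply_nonneg v _) hvpq.2.symm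
  refine le_of_eq_of_le ?_ ((p * q).le_gaussNorm v hc0 (i + j))
  rw [hi_p, hj_q, coeff_mul, Nat.sum_antidiagonal_eq_sum_range_succ_mk,
    IsNonarchimedean.apply_sum_eq_of_lt hna (k := i) (by simp) (by simp)]
  · simp only [add_tsub_cancel_left, map_mul, pow_add]; ring
  intro x hx hneq
  have hx' : x + (i + j - x) = i + j := by simp at hx; omega
  refine lt_of_mul_lt_mul_right ?_ (pow_nonneg hc0 (i + j))
  have e1 : v (p.coeff x * q.coeff (i + j - x)) * c ^ (i + j) =
      v (p.coeff x) * c ^ x * (v (q.coeff (i + j - x)) * c ^ (i + j - x)) := by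
    rw [map_mul, ← hx', pow_add, hx']; ring
  have e2 : v (p.coeff i * q.coeff (i + j - i)) * c ^ (i + j) =
      v (p.coeff i) * c ^ i * (v (q.coeff j) * c ^ j) := by
    rw [map_mul, add_tsub_cancel_left, pow_add]; ring
  change v (p.coeff x * q.coeff (i + j - x)) * c ^ (i + j) <
    v (p.coeff i * q.coeff (i + j - i)) * c ^ (i + j)
  rw [e1, e2]
  have hi0 : 0 < v (p.coeff i) * c ^ i := mul_pos hp0 (pow_pos hc i)
  have hj0 : 0 < v (q.coeff j) * c ^ j := mul_pos hq0 (pow_pos hc j)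
  rcases lt_or_gt_of_ne hneq with h | h
  · exact (mul_le_mul_of_nonneg_left (hj_q ▸ q.le_gaussNorm v hc0 (i + j - x))
      (mul_nonneg (apply_nonneg v _) (pow_nonneg hc0 x))).trans_lt
      (mul_lt_mul_of_pos_right (hi_p ▸ hlt_p x h) hj0)
  · exact (mul_le_mul_of_nonneg_right (hi_p ▸ p.le_gaussNorm v hc0 x)
      (mul_nonneg (apply_nonneg v _) (pow_nonneg hc0 _))).trans_lt
      (mul_lt_mul_of_pos_left (hj_q ▸ hlt_q _ (by omega)) hi0)

/-- The Gauss seminorm of radius `c` on `R[X]` attached to a seminorm on `R`. -/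
def gaussSeminorm (v : MulRingSeminorm R) (hna : IsNonarchimedean v) (c : ℝ) (hc : 0 ≤ c) :
    MulRingSeminorm R[X] where
  toFun p := p.gaussNorm v c
  map_zero' := gaussNorm_zero v c
  add_le' p q := IsNonarchimedean.add_le (gaussNorm_nonneg v · hc)
    (isNonarchimedean_gaussNorm v hna hc)
  neg' p := by
    refine le_antisymm ?_ ?_
    · obtain ⟨i, hi⟩ := exists_eq_gaussNorm v c (-p)
      rw [hi, coeff_neg, map_neg_eq_map]
      exact le_gaussNorm v p hc i
    · obtain ⟨i, hi⟩ := exists_eq_gaussNorm v c p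
      rw [hi, ← map_neg_eq_map v, ← coeff_neg]
      exact le_gaussNorm v (-p) hc i
  map_one' := by
    rw [← C_1, gaussNorm_C, map_one]
  map_mul' p q := by
    rcases hc.eq_or_lt with rfl | hc
    · simp only [gaussNorm_zero_right, mul_coeff_zero, map_mul]
    · exact le_antisymm (gaussNorm_mul_le v hna p q hc.le)
        (gaussNorm_mul_le_gaussNorm_mul v hna hc p q)

theorem continuous_gaussNorm (v : MulRingSeminorm R) (p : R[X]) :
    Continuous fun c : ℝ => p.gaussNorm v c := by
  unfold gaussNorm
  by_cases h : p.support.Nonempty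
  · simp only [h, ↓reduceDIte]
    exact Continuous.finset_sup'_apply h fun i _ => by fun_prop
  · simp only [h, ↓reduceDIte]
    exact continuous_const

theorem gaussNorm_X_add_C (v : MulRingSeminorm R) (u : R) {c : ℝ} (hc : 0 ≤ c) :
    (X + C u).gaussNorm v c = max (v u) c := by
  refine le_antisymm ?_ (max_le ?_ ?_)
  · obtain ⟨i, hi⟩ := exists_eq_gaussNorm v c (X + C u)
    rw [hi]
    rcases i with _ | _ | i
    · simp
    · simp [coeff_X]
    · simp [coeff_X, hc]
  · have h := le_gaussNorm v (X + C u) hc 0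
    rwa [coeff_add, coeff_X_zero, coeff_C_zero, zero_add, pow_zero, mul_one] at h
  · have h := le_gaussNorm v (X + C u) hc 1
    rwa [coeff_add, coeff_X_one, coeff_C_succ, add_zero, map_one, pow_one, one_mul] at h

/-- The element `X + u` still has Gauss norm `c`, so multiplicativity bounds each term. Applied to
`u` and `-u`, this shows that a translation preserving the disc of radius `c` preserves the Gauss
norm. -/
theorem gaussNorm_comp_X_add_C_le (v : MulRingSeminorm R) (hna : IsNonarchimedean v) {u : R} {c : ℝ}
    (hc : 0 ≤ c) (hu : v u ≤ c) (p : R[X]) :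
    (p.comp (X + C u)).gaussNorm v c ≤ p.gaussNorm v c := by
  rw [comp_eq_sum_left, sum_def]
  obtain ⟨i, -, hi⟩ := IsNonarchimedean.finset_image_add (f := fun p => gaussNorm v c p)
    (gaussNorm_zero v c) (gaussNorm_nonneg v · hc) (isNonarchimedean_gaussNorm v hna hc)
    (fun i => C (p.coeff i) * (X + C u) ^ i) p.support
  refine hi.trans ?_
  have h := map_mul (gaussSeminorm v hna c hc) (C (p.coeff i)) ((X + C u) ^ i)
  rw [map_pow] at h
  change gaussNorm v c _ = gaussNorm v c _ * gaussNorm v c _ ^ i at h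
  rw [h, gaussNorm_C, gaussNorm_X_add_C v u hc, max_eq_right hu]
  exact le_gaussNorm v p hc i

theorem gaussNorm_comp_X_add_C (v : MulRingSeminorm R) (hna : IsNonarchimedean v) {u : R} {c : ℝ}
    (hc : 0 ≤ c) (hu : v u ≤ c) (p : R[X]) :
    (p.comp (X + C u)).gaussNorm v c = p.gaussNorm v c := by
  refine le_antisymm (gaussNorm_comp_X_add_C_le v hna hc hu p) ?_
  have h := gaussNorm_comp_X_add_C_le v hna hc (u := -u) (by rwa [map_neg_eq_map])
    (p.comp (X + C u))
  rwa [comp_assoc, add_comp, X_comp, C_comp, C_neg, neg_add_cancel_right, comp_X] at h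

end Gauss

/-! ### Connectedness of annuli -/

section Annulus

variable {K : Type*} [NormedField K] [IsUltrametricDist K]

namespace BerkA1

theorem isNonarchimedean (y : BerkA1 K) : IsNonarchimedean y.1 := by
  refine y.1.isNonarchimedean_of_natCast_le_one fun n => ?_
  rw [← C_eq_natCast, y.2]
  exact IsUltrametricDist.norm_natCast_le_one K n

/-- The generic Taylor expansion `f ↦ f(T + X)`. -/
def genericTaylor (K : Type*) [Field K] : K[X] →+* K[X][X] :=
  eval₂RingHom (C.comp C) (X + C X)

omit [IsUltrametricDist K] in
-- Expanding about the generic point is the same as expanding about `s` and then translating by `X -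
-- s`. Once the radius is at least the size of `X - s`, this translation no longer changes the Gauss
-- norm.
theorem genericTaylor_eq (s : K) (f : K[X]) :
    genericTaylor K f = ((taylor s f).map C).comp (X + C (X - C s)) := by
  rw [taylor_apply, Polynomial.map_comp, comp_assoc, comp, eval₂_map]
  have e : ((X + C s).map C).comp (X + C (X - C s)) = (X + C X : K[X][X]) := by
    simp [add_assoc]
  rw [e]
  rfl

/-- The point whose seminorm is the supremum over the closed disc of radius `t` around a generic
representative of `y`. -/
def thicken (y : BerkA1 K) (t : ℝ≥0) : BerkA1 K :=
  ⟨{ toFun := fun f => gaussSeminorm y.1 y.isNonarchimedean t t.2 (genericTaylor K f)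
     map_zero' := by simp
     add_le' := fun f g => by rw [map_add]; exact map_add_le_add _ _ _
     neg' := fun f => by rw [map_neg, map_neg_eq_map]
     map_one' := by simp
     map_mul' := fun f g => by rw [map_mul, map_mul] },
   fun a => by
    change gaussNorm y.1 t (genericTaylor K (C a)) = ‖a‖
    simp [genericTaylor, gaussNorm_C, y.2]⟩

theorem thicken_apply (y : BerkA1 K) (t : ℝ≥0) (f : K[X]) :
    (y.thicken t).1 f = (genericTaylor K f).gaussNorm y.1 t := rfl

theorem thicken_X_sub_C (y : BerkA1 K) (t : ℝ≥0) (a : K) :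
    (y.thicken t).1 (X - C a) = max (y.1 (X - C a)) t := by
  rw [thicken_apply]
  have : genericTaylor K (X - C a) = X + C (X - C a) := by
    simp [genericTaylor]; ring
  rw [this]
  exact gaussNorm_X_add_C y.1 _ t.2

theorem thicken_zero (y : BerkA1 K) : y.thicken 0 = y := by
  refine Subtype.ext (DFunLike.ext _ _ fun f => ?_)
  rw [thicken_apply, NNReal.coe_zero, gaussNorm_zero_right, coeff_zero_eq_eval_zero]
  have e : (evalRingHom 0).comp (genericTaylor K) = RingHom.id K[X] := by
    ext <;> simp [genericTaylor]
  exact congrArg y.1 (RingHom.congr_fun e f)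

theorem continuous_thicken (y : BerkA1 K) : Continuous y.thicken := by
  refine continuous_induced_rng.2 (continuous_pi fun f => ?_)
  exact (continuous_gaussNorm y.1 (genericTaylor K f)).comp NNReal.continuous_coe

/-- Points at distance at most `t` from `s` thicken to the maximal point of the closed disc of
centre `s` and radius `t`. -/
theorem thicken_eq_thicken_ofPoint (y : BerkA1 K) {t : ℝ≥0} {s : K} (h : y.1 (X - C s) ≤ t) :
    y.thicken t = (ofPoint s).thicken t := by
  -- After the translation is absorbed, the coefficients are constants of `K`, on which all points
  -- of the line agree.
  have h1 : ∀ y : BerkA1 K, y.1 (X - C s) ≤ t → ∀ f, (y.thicken t).1 f =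
      gaussNorm y.1 t ((taylor s f).map C) := fun y h f => by
    rw [thicken_apply, genericTaylor_eq s]
    exact gaussNorm_comp_X_add_C y.1 y.isNonarchimedean t.2 h _
  have h2 : ∀ (y y' : BerkA1 K) (g : K[X]),
      gaussNorm y.1 t (g.map C) ≤ gaussNorm y'.1 t (g.map C) := fun y y' g => by
    obtain ⟨i, hi⟩ := exists_eq_gaussNorm y.1 t (g.map C)
    rw [hi, coeff_map, y.2, ← y'.2, ← coeff_map]
    exact le_gaussNorm y'.1 _ t.2 i
  refine Subtype.ext (DFunLike.ext _ _ fun f => ?_)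
  rw [h1 y h, h1 (ofPoint s) (by rw [ofPoint_X_sub_C]; simp)]
  exact le_antisymm (h2 _ _ _) (h2 _ _ _)

/-- Each point `y` is joined to a fixed base point by two arcs. Thickening `y` up to its distance
from `s` does not change that distance, and ends at a maximal point of a disc about `s`; then only
the radius of that disc varies, between two values allowed by the annulus. -/
theorem isPreconnected_annulus (s : K) (r R : ℝ) :
    IsPreconnected {y : BerkA1 K | y.1 (X - C s) < R ∧ r < y.1 (X - C s)} := by
  rcases Set.eq_empty_or_nonempty {y : BerkA1 K | y.1 (X - C s) < R ∧ r < y.1 (X - C s)} with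
    h | ⟨y₀, h₀⟩
  · rw [h]; exact isPreconnected_empty
  have hpt : ∀ t : ℝ≥0, ((ofPoint s).thicken t).1 (X - C s) = t := fun t => by
    rw [thicken_X_sub_C, ofPoint_X_sub_C]
    simp
  let ρ : BerkA1 K → ℝ≥0 := fun y => ⟨y.1 (X - C s), apply_nonneg _ _⟩
  have hρ : ∀ y, ((ρ y : ℝ≥0) : ℝ) = y.1 (X - C s) := fun y => rfl
  refine isPreconnected_of_forall ((ofPoint s).thicken (ρ y₀)) fun y hy => ?_
  refine ⟨y.thicken '' Icc 0 (ρ y) ∪ (ofPoint s).thicken '' uIcc (ρ y) (ρ y₀), ?_, ?_, ?_, ?_⟩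
  · rintro _ (⟨t, ht, rfl⟩ | ⟨t, ht, rfl⟩)
    · have ht : (t : ℝ) ≤ y.1 (X - C s) := ht.2
      simp only [mem_ofPred_eq, thicken_X_sub_C, max_eq_left ht]
      exact hy
    · simp only [mem_ofPred_eq, hpt]
      have h1 : min (y.1 (X - C s)) (y₀.1 (X - C s)) ≤ (t : ℝ) := by exact_mod_cast ht.1
      have h2 : (t : ℝ) ≤ max (y.1 (X - C s)) (y₀.1 (X - C s)) := by exact_mod_cast ht.2
      exact ⟨h2.trans_lt (max_lt hy.1 h₀.1), (lt_min hy.2 h₀.2).trans_le h1⟩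
  · exact Or.inr ⟨_, right_mem_uIcc, rfl⟩
  · exact Or.inl ⟨0, ⟨le_rfl, zero_le⟩, y.thicken_zero⟩
  · refine IsPreconnected.union (y.thicken (ρ y)) ⟨_, ⟨zero_le, le_rfl⟩, rfl⟩ ?_
      (isPreconnected_Icc.image _ y.continuous_thicken.continuousOn)
      (isPreconnected_uIcc.image _ (ofPoint s).continuous_thicken.continuousOn)
    rw [y.thicken_eq_thicken_ofPoint (t := ρ y) (s := s) le_rfl]
    exact ⟨_, left_mem_uIcc, rfl⟩

end BerkA1

omit [IsUltrametricDist K] in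
theorem openDiscAt_diff_closedDiscAt (s : K) (r R : ℝ) :
    openDiscAt s R \ closedDiscAt s r = ((↑) : BerkA1 K → BerkP1 K) ''
      {y : BerkA1 K | y.1 (X - C s) < R ∧ r < y.1 (X - C s)} := by
  ext x
  constructor
  · rintro ⟨⟨y, rfl, h⟩, h'⟩
    exact ⟨y, ⟨h, not_le.1 fun h1 => h' ⟨y, rfl, h1⟩⟩, rfl⟩
  · rintro ⟨y, ⟨h, hr⟩, rfl⟩
    refine ⟨⟨y, rfl, h⟩, ?_⟩
    rintro ⟨y', hy, h1⟩
    obtain rfl := OnePoint.coe_injective hy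
    exact absurd h1 (not_le.2 hr)

/-- Open annuli are connected. -/
theorem isPreconnected_openDiscAt_diff_closedDiscAt (s : K) (r R : ℝ) :
    IsPreconnected (openDiscAt s R \ closedDiscAt s r : Set (BerkP1 K)) := by
  rw [openDiscAt_diff_closedDiscAt]
  exact (BerkA1.isPreconnected_annulus s r R).image _ OnePoint.continuous_coe.continuousOn

end Annulus

/-! ### Families of sets whose nerve is a tree -/

/-- The members of the family `U` other than `U root` have parents, and two different members meet
if and only if one is the parent of the other; the intersection is then connected. -/
structure IsTreeFamily {X ι : Type*} [TopologicalSpace X] (U : ι → Set X) (parent : ι → ι)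
    (root : ι) (rank : ι → ℝ) : Prop where
  injective : Function.Injective U
  rank_lt : ∀ i, i ≠ root → rank i < rank (parent i)
  eq_parent : ∀ i j, i ≠ j → (U i ∩ U j).Nonempty →
    (i ≠ root ∧ parent i = j) ∨ (j ≠ root ∧ parent j = i)
  nonempty : ∀ i, i ≠ root → (U i ∩ U (parent i)).Nonempty
  isPreconnected : ∀ i, i ≠ root → IsPreconnected (U i ∩ U (parent i))

/-- A family without repetitions as a set of sets. -/
def familyFinset {X ι : Type*} [Fintype ι] (U : ι → Set X) (hU : Function.Injective U) :
    Finset (Set X) :=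
  Finset.univ.map ⟨U, hU⟩

section Family

variable {X ι : Type*} [Fintype ι] {U : ι → Set X}

theorem mem_familyFinset {hU : Function.Injective U} {A : Set X} :
    A ∈ familyFinset U hU ↔ ∃ i, U i = A := by
  simp [familyFinset]

theorem forall_mem_familyFinset {hU : Function.Injective U} {P : Set X → Prop} :
    (∀ A ∈ familyFinset U hU, P A) ↔ ∀ i, P (U i) := by
  simp [mem_familyFinset]

theorem mem_coreIn_familyFinset {hU : Function.Injective U} {Z : Set X} {i : ι} {x : X} :
    x ∈ coreIn Z (familyFinset U hU) (U i) ↔ x ∈ U i ∧ x ∈ Z ∧ ∀ j, j ≠ i → x ∉ U j := by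
  simp only [coreIn, mem_sdiff, mem_inter_iff, mem_iUnion, mem_familyFinset, not_exists, and_assoc]
  refine and_congr_right fun _ => and_congr_right fun _ => ⟨fun h j hj => ?_, ?_⟩
  · exact h _ ⟨j, rfl⟩ (hU.ne hj)
  · rintro h _ ⟨j, rfl⟩ hj
    exact h j fun e => hj (e ▸ rfl)

theorem componentsOf_eq_singleton [TopologicalSpace X] {A : Set X} (hA : IsPreconnected A)
    (hne : A.Nonempty) : componentsOf A = {A} := by
  ext B
  constructor
  · rintro ⟨x, hx, rfl⟩
    exact hA.connectedComponentIn hx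
  · rintro rfl
    obtain ⟨x, hx⟩ := hne
    exact ⟨x, hx, (hA.connectedComponentIn hx).symm⟩

namespace IsTreeFamily

variable {parent : ι → ι} {root : ι} {rank : ι → ℝ}

omit [Fintype ι] in
-- Three members with a common point would be pairwise parent and child. This triangle is
-- impossible: either one member has two parents, or the rank increases around a cycle.
theorem disjoint_of_ne [TopologicalSpace X] (h : IsTreeFamily U parent root rank) {i j k : ι}
    (hij : i ≠ j) (hik : i ≠ k) (hjk : j ≠ k) : Disjoint (U i) (U j ∩ U k) := by
  rw [Set.disjoint_left]
  rintro x hi ⟨hj, hk⟩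
  have h1 := h.eq_parent i j hij ⟨x, hi, hj⟩
  have h2 := h.eq_parent i k hik ⟨x, hi, hk⟩
  have h3 := h.eq_parent j k hjk ⟨x, hj, hk⟩
  have r := h.rank_lt
  rcases h1 with ⟨a1, rfl⟩ | ⟨a1, e1⟩ <;> rcases h2 with ⟨a2, e2⟩ | ⟨a2, e2⟩ <;>
    rcases h3 with ⟨a3, e3⟩ | ⟨a3, e3⟩ <;>
    have r1 := r _ a1 <;> have r2 := r _ a2 <;> have r3 := r _ a3 <;> grind

variable {K : Type*} [NormedField K] [IsUltrametricDist K] {V : ι → Set (BerkP1 K)}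

omit [IsUltrametricDist K] in
theorem disconnected (h : IsTreeFamily V parent root rank) :
    ∀ A ∈ familyFinset V h.injective, ∀ B ∈ familyFinset V h.injective,
      ∀ C ∈ familyFinset V h.injective, A ≠ B → A ≠ C → B ≠ C →
      ∀ D ∈ componentsOf (B ∩ C), Disjoint A D := by
  simp only [forall_mem_familyFinset]
  rintro i j k hij hik hjk D ⟨x, hx, rfl⟩
  exact (h.disjoint_of_ne (fun e => hij (congrArg V e)) (fun e => hik (congrArg V e))
    (fun e => hjk (congrArg V e))).mono_right (connectedComponentIn_subset _ _)

/-- The vertex of the dual graph given by a member of the family. -/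
def vertex (h : IsTreeFamily V parent root rank) (i : ι) : familyFinset V h.injective :=
  ⟨V i, mem_familyFinset.2 ⟨i, rfl⟩⟩

omit [IsUltrametricDist K] in
theorem vertex_bijective (h : IsTreeFamily V parent root rank) : Function.Bijective h.vertex := by
  refine ⟨fun i j e => h.injective (congrArg Subtype.val e), ?_⟩
  rintro ⟨A, hA⟩
  obtain ⟨i, rfl⟩ := mem_familyFinset.1 hA
  exact ⟨i, rfl⟩

omit [IsUltrametricDist K] in
theorem vertex_ne (h : IsTreeFamily V parent root rank) (i : {i // i ≠ root}) :
    h.vertex i ≠ h.vertex (parent i) := by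
  intro e
  have h1 := h.rank_lt i i.2
  rw [← h.vertex_bijective.1 e] at h1
  exact lt_irrefl _ h1

theorem setOf_forall_mem_sym2 (𝒞 : Finset (Set X)) (a b : 𝒞) :
    {x | ∀ A ∈ s(a, b), x ∈ A.1} = a.1 ∩ b.1 := by
  ext x
  simp only [Sym2.mem_iff, forall_eq_or_imp, forall_eq]
  rfl

/-- The edge of the dual graph joining a member of the family to its parent. -/
def edge (h : IsTreeFamily V parent root rank) (Z : Set (BerkP1 K)) (i : {i // i ≠ root}) :
    DualEdge Z (familyFinset V h.injective) :=
  Sum.inl ⟨(s(h.vertex i, h.vertex (parent i)), V i ∩ V (parent i)), by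
    refine ⟨fun e => h.vertex_ne i (Sym2.mk_isDiag_iff.1 e), ?_⟩
    dsimp only
    rw [setOf_forall_mem_sym2]
    exact (componentsOf_eq_singleton (h.isPreconnected i i.2) (h.nonempty i i.2)).symm ▸ rfl⟩

/-- The edges correspond to the members other than the root: a nonempty intersection comes from a
parent and a child, and is its own only component. Injectivity holds because the rank forbids two
members to be each other's parents. -/
theorem edge_bijective (h : IsTreeFamily V parent root rank) {Z : Set (BerkP1 K)}
    (hZ : ∀ i, ∀ m : MaximalSpectrum (reductionRing (coreIn Z (familyFinset V h.injective) (V i))),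
      ¬ IsOrdinaryDoublePoint (resField K) m) : Function.Bijective (h.edge Z) := by
  constructor
  · intro i j e
    have e1 := congrArg Prod.fst (congrArg Subtype.val (Sum.inl_injective e))
    dsimp only at e1
    rw [Sym2.eq_iff] at e1
    rcases e1 with ⟨e1, -⟩ | ⟨e1, e2⟩
    · exact Subtype.ext (h.vertex_bijective.1 e1)
    · have e1 := h.vertex_bijective.1 e1
      have e2 := h.vertex_bijective.1 e2
      have h1 := h.rank_lt i i.2
      have h2 := h.rank_lt j j.2
      rw [e2] at h1
      rw [← e1] at h2
      exact absurd h1 h2.not_gt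
  · rintro (⟨⟨z, A⟩, hz, hA⟩ | ⟨⟨B, hB⟩, ⟨m, hm⟩⟩)
    · induction z using Sym2.ind with
      | _ a b =>
      obtain ⟨i, rfl⟩ := h.vertex_bijective.2 a
      obtain ⟨j, rfl⟩ := h.vertex_bijective.2 b
      dsimp only at hz hA
      rw [setOf_forall_mem_sym2] at hA
      have hij : i ≠ j := by
        rintro rfl
        exact hz (Sym2.mk_isDiag_iff.2 rfl)
      obtain ⟨x, hx, -⟩ := id hA
      rcases h.eq_parent i j hij ⟨x, hx⟩ with ⟨hi, rfl⟩ | ⟨hj, rfl⟩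
      · refine ⟨⟨i, hi⟩, congrArg Sum.inl (Subtype.ext (Prod.ext rfl ?_))⟩
        have h1 := componentsOf_eq_singleton (h.isPreconnected i hi) (h.nonempty i hi)
        exact (mem_singleton_iff.1 (h1 ▸ hA)).symm
      · refine ⟨⟨j, hj⟩, congrArg Sum.inl (Subtype.ext (Prod.ext Sym2.eq_swap ?_))⟩
        have h1 := componentsOf_eq_singleton (h.isPreconnected j hj) (h.nonempty j hj)
        rw [inter_comm] at hA
        exact (mem_singleton_iff.1 (h1 ▸ hA)).symm
    · obtain ⟨i, rfl⟩ := mem_familyFinset.1 hB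
      exact absurd hm (hZ i m)

theorem finite_dualEdge (h : IsTreeFamily V parent root rank) {Z : Set (BerkP1 K)}
    (hZ : ∀ i, ∀ m : MaximalSpectrum (reductionRing (coreIn Z (familyFinset V h.injective) (V i))),
      ¬ IsOrdinaryDoublePoint (resField K) m) : Finite (DualEdge Z (familyFinset V h.injective)) :=
  Finite.of_surjective _ (h.edge_bijective hZ).2

theorem adj_parent (h : IsTreeFamily V parent root rank) (Z : Set (BerkP1 K))
    (S : Set (OnePoint K)) {i : ι} (hi : i ≠ root) :
    (dualGraph Z (familyFinset V h.injective) S).toSimpleGraph.Adj (h.vertex i)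
      (h.vertex (parent i)) :=
  ⟨h.vertex_ne ⟨i, hi⟩, h.edge Z ⟨i, hi⟩, rfl⟩

theorem connected (h : IsTreeFamily V parent root rank) (Z : Set (BerkP1 K))
    (S : Set (OnePoint K)) :
    (dualGraph Z (familyFinset V h.injective) S).toSimpleGraph.Connected := by
  have key : ∀ i, (dualGraph Z (familyFinset V h.injective) S).toSimpleGraph.Reachable
      (h.vertex i) (h.vertex root) := by
    by_contra! hne
    -- An unreachable member of largest rank has a reachable parent, to which it is adjacent.
    obtain ⟨i, hi, hmax⟩ := (Set.toFinite {i | ¬ (dualGraph Z (familyFinset V h.injective)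
      S).toSimpleGraph.Reachable (h.vertex i) (h.vertex root)}).exists_maximalFor rank _ hne
    have hir : i ≠ root := by
      rintro rfl
      exact hi (SimpleGraph.Reachable.refl _)
    have h1 : (dualGraph Z (familyFinset V h.injective) S).toSimpleGraph.Reachable
        (h.vertex (parent i)) (h.vertex root) := by
      by_contra hp
      exact absurd (hmax hp (h.rank_lt i hir).le) (not_le.2 (h.rank_lt i hir))
    exact hi ((h.adj_parent Z S hir).reachable.trans h1)
  have : Nonempty (familyFinset V h.injective) := ⟨h.vertex root⟩
  refine ⟨fun a b => ?_⟩
  obtain ⟨i, rfl⟩ := h.vertex_bijective.2 a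
  obtain ⟨j, rfl⟩ := h.vertex_bijective.2 b
  exact (key i).trans (key j).symm

theorem firstBetti_eq_zero (h : IsTreeFamily V parent root rank) {Z : Set (BerkP1 K)}
    (hZ : ∀ i, ∀ m : MaximalSpectrum (reductionRing (coreIn Z (familyFinset V h.injective) (V i))),
      ¬ IsOrdinaryDoublePoint (resField K) m) (S : Set (OnePoint K)) :
    (dualGraph Z (familyFinset V h.injective) S).firstBetti = 0 := by
  classical
  have hc := h.connected Z S
  have h1 : Nat.card (dualGraph Z (familyFinset V h.injective) S).toSimpleGraph.ConnectedComponent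
      = 1 := by
    have := hc.preconnected.subsingleton_connectedComponent
    have : Nonempty (dualGraph Z (familyFinset V h.injective) S).toSimpleGraph.ConnectedComponent :=
      ⟨SimpleGraph.connectedComponentMk _ (h.vertex root)⟩
    exact Nat.card_of_subsingleton this.some
  have h2 : Nat.card (familyFinset V h.injective) = Fintype.card ι := by
    rw [← Nat.card_congr (Equiv.ofBijective _ h.vertex_bijective), Nat.card_eq_fintype_card]
  have h3 : Nat.card (DualEdge Z (familyFinset V h.injective)) = Fintype.card ι - 1 := by
    rw [← Nat.card_congr (Equiv.ofBijective _ (h.edge_bijective hZ)), Nat.card_eq_fintype_card]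
    exact Set.card_ne_eq root
  have h4 : 0 < Fintype.card ι := Fintype.card_pos_iff.2 ⟨root⟩
  rw [HalfOpenGraph.firstBetti, h1, h2, h3]
  omega

theorem isTree (h : IsTreeFamily V parent root rank) {Z : Set (BerkP1 K)}
    (hZ : ∀ i, ∀ m : MaximalSpectrum (reductionRing (coreIn Z (familyFinset V h.injective) (V i))),
      ¬ IsOrdinaryDoublePoint (resField K) m) {S : Set (OnePoint K)} (hS : S.Finite) :
    (dualGraph Z (familyFinset V h.injective) S).IsTree where
  finite_vertices := inferInstance
  finite_edges := h.finite_dualEdge hZ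
  finite_halfEdges := by
    have := hS.to_subtype
    exact inferInstanceAs (Finite {h' : S × familyFinset V h.injective //
      BerkP1.ofPoint h'.1.1 ∈ h'.2.1})
  connected := h.connected Z S
  firstBetti_eq_zero := h.firstBetti_eq_zero hZ S

end IsTreeFamily

end Family

/-! ### Discs on the projective line -/

section Discs

variable {K : Type*} [NormedField K]

theorem coe_mem_openDiscAt {s : K} {R : ℝ} {y : BerkA1 K} :
    (y : BerkP1 K) ∈ openDiscAt s R ↔ y.1 (X - C s) < R := by
  constructor
  · rintro ⟨y', hy, h⟩
    obtain rfl := OnePoint.coe_injective hy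
    exact h
  · exact fun h => ⟨y, rfl, h⟩

theorem coe_mem_closedDiscAt {s : K} {r : ℝ} {y : BerkA1 K} :
    (y : BerkP1 K) ∈ closedDiscAt s r ↔ y.1 (X - C s) ≤ r := by
  constructor
  · rintro ⟨y', hy, h⟩
    obtain rfl := OnePoint.coe_injective hy
    exact h
  · exact fun h => ⟨y, rfl, h⟩

theorem coe_mem_closedDiscMinus {s : K} {r : ℝ} {T : Finset K} {y : BerkA1 K} :
    (y : BerkP1 K) ∈ closedDiscMinus s r T ↔
      y.1 (X - C s) ≤ r ∧ ∀ a ∈ T, r ≤ y.1 (X - C a) := by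
  constructor
  · rintro ⟨y', hy, h⟩
    obtain rfl := OnePoint.coe_injective hy
    exact h
  · exact fun h => ⟨y, rfl, h⟩

theorem infty_notMem_openDiscAt {s : K} {R : ℝ} :
    (OnePoint.infty : BerkP1 K) ∉ openDiscAt s R := by
  rintro ⟨y, hy, -⟩
  exact OnePoint.coe_ne_infty y hy.symm

theorem infty_notMem_closedDiscAt {s : K} {r : ℝ} :
    (OnePoint.infty : BerkP1 K) ∉ closedDiscAt s r := by
  rintro ⟨y, hy, -⟩
  exact OnePoint.coe_ne_infty y hy.symm

theorem infty_notMem_closedDiscMinus {s : K} {r : ℝ} {T : Finset K} :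
    (OnePoint.infty : BerkP1 K) ∉ closedDiscMinus s r T := by
  rintro ⟨y, hy, -⟩
  exact OnePoint.coe_ne_infty y hy.symm

/-- The coordinate `(T - s) / c`. -/
def affineGL (s : K) {c : K} (hc : c ≠ 0) : GL (Fin 2) K :=
  Matrix.GeneralLinearGroup.mkOfDetNeZero !![1, -s; 0, c] (by simpa [Matrix.det_fin_two])

/-- The coordinate `c / (T - s)`. -/
def inftyGL (s : K) {c : K} (hc : c ≠ 0) : GL (Fin 2) K :=
  Matrix.GeneralLinearGroup.mkOfDetNeZero !![0, c; 1, -s] (by simpa [Matrix.det_fin_two])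

theorem absLin_one_neg_coe (s : K) (y : BerkA1 K) :
    BerkP1.absLin 1 (-s) (y : BerkP1 K) = y.1 (X - C s) := by
  change y.1 (C 1 * X + C (-s)) = _
  rw [C_1, one_mul, C_neg, sub_eq_add_neg]

theorem absLin_zero_coe (c : K) (y : BerkA1 K) :
    BerkP1.absLin 0 c (y : BerkP1 K) = ‖c‖ := by
  change y.1 (C 0 * X + C c) = _
  rw [C_0, zero_mul, zero_add, y.2]

theorem absLin_infty (a b : K) : BerkP1.absLin a b (OnePoint.infty : BerkP1 K) = ‖a‖ := rfl

theorem absNum_affineGL (s : K) {c : K} (hc : c ≠ 0) (x : BerkP1 K) :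
    BerkP1.absNum (affineGL s hc) x = BerkP1.absLin 1 (-s) x := rfl

theorem absDen_affineGL (s : K) {c : K} (hc : c ≠ 0) (x : BerkP1 K) :
    BerkP1.absDen (affineGL s hc) x = BerkP1.absLin 0 c x := rfl

theorem absNum_inftyGL (s : K) {c : K} (hc : c ≠ 0) (x : BerkP1 K) :
    BerkP1.absNum (inftyGL s hc) x = BerkP1.absLin 0 c x := rfl

theorem absDen_inftyGL (s : K) {c : K} (hc : c ≠ 0) (x : BerkP1 K) :
    BerkP1.absDen (inftyGL s hc) x = BerkP1.absLin 1 (-s) x := rfl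

theorem isClosedDisc_closedDiscAt (s : K) {c : K} (hc : c ≠ 0) :
    IsClosedDisc (closedDiscAt s ‖c‖) := by
  refine ⟨affineGL s hc, ?_⟩
  ext x
  rw [mem_ofPred_eq, absNum_affineGL, absDen_affineGL]
  induction x using OnePoint.rec with
  | infty => simp [infty_notMem_closedDiscAt, absLin_infty]
  | coe y => rw [coe_mem_closedDiscAt, absLin_one_neg_coe, absLin_zero_coe]

theorem isClosedDisc_compl_openDiscAt (s : K) {c : K} (hc : c ≠ 0) :
    IsClosedDisc (openDiscAt s ‖c‖)ᶜ := by
  refine ⟨inftyGL s hc, ?_⟩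
  ext x
  rw [mem_ofPred_eq, absNum_inftyGL, absDen_inftyGL, mem_compl_iff]
  induction x using OnePoint.rec with
  | infty => simp [infty_notMem_openDiscAt, absLin_infty]
  | coe y => rw [coe_mem_openDiscAt, absLin_one_neg_coe, absLin_zero_coe, not_lt]

theorem isOpenDisc_openDiscAt (s : K) {c : K} (hc : c ≠ 0) :
    IsOpenDisc (openDiscAt s ‖c‖) := by
  refine ⟨affineGL s hc, ?_⟩
  ext x
  rw [mem_ofPred_eq, absNum_affineGL, absDen_affineGL]
  induction x using OnePoint.rec with
  | infty => simp [infty_notMem_openDiscAt, absLin_infty]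
  | coe y => rw [coe_mem_openDiscAt, absLin_one_neg_coe, absLin_zero_coe]

theorem isOpenDisc_compl_closedDiscAt (s : K) {c : K} (hc : c ≠ 0) :
    IsOpenDisc (closedDiscAt s ‖c‖)ᶜ := by
  refine ⟨inftyGL s hc, ?_⟩
  ext x
  rw [mem_ofPred_eq, absNum_inftyGL, absDen_inftyGL, mem_compl_iff]
  induction x using OnePoint.rec with
  | infty => simp [infty_notMem_closedDiscAt, absLin_infty]
  | coe y => rw [coe_mem_closedDiscAt, absLin_one_neg_coe, absLin_zero_coe, not_le]

theorem absLin_residue_affineGL (s a : K) {c : K} (hc : c ≠ 0) :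
    BerkP1.absLin (affineGL s hc 0 0 - a * affineGL s hc 1 0)
      (affineGL s hc 0 1 - a * affineGL s hc 1 1) = BerkP1.absLin 1 (-(s + a * c)) := by
  change BerkP1.absLin (1 - a * 0) (-s - a * c) = _
  rw [mul_zero, sub_zero, neg_add, sub_eq_add_neg]

theorem setOf_absLin_lt_absDen_affineGL (s t : K) {c : K} (hc : c ≠ 0) :
    {x | BerkP1.absLin 1 (-t) x < BerkP1.absDen (affineGL s hc) x} = openDiscAt t ‖c‖ := by
  ext x
  rw [mem_ofPred_eq, absDen_affineGL]
  induction x using OnePoint.rec with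
  | infty => simp [infty_notMem_openDiscAt, absLin_infty]
  | coe y => rw [coe_mem_openDiscAt, absLin_one_neg_coe, absLin_zero_coe]

theorem setOf_absDen_lt_absNum_affineGL (s : K) {c : K} (hc : c ≠ 0) :
    {x | BerkP1.absDen (affineGL s hc) x < BerkP1.absNum (affineGL s hc) x} =
      (closedDiscAt s ‖c‖)ᶜ := by
  ext x
  rw [mem_ofPred_eq, absDen_affineGL, absNum_affineGL, mem_compl_iff]
  induction x using OnePoint.rec with
  | infty => simp [infty_notMem_closedDiscAt, absLin_infty]
  | coe y => rw [coe_mem_closedDiscAt, absLin_one_neg_coe, absLin_zero_coe, not_le]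

/-- The residue discs for the coordinate `(T - s) / c`. -/
theorem isResidueDisc_affineGL_iff (s : K) {c : K} (hc : c ≠ 0) (E : Set (BerkP1 K)) :
    IsResidueDisc (affineGL s hc) E ↔
      (∃ t, ‖t - s‖ ≤ ‖c‖ ∧ E = openDiscAt t ‖c‖) ∨ E = (closedDiscAt s ‖c‖)ᶜ := by
  rw [IsResidueDisc, setOf_absDen_lt_absNum_affineGL]
  refine or_congr ⟨?_, ?_⟩ Iff.rfl
  · rintro ⟨a, ha, rfl⟩
    refine ⟨s + a * c, ?_, ?_⟩
    · rw [add_sub_cancel_left, norm_mul]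
      exact mul_le_of_le_one_left (norm_nonneg _) ha
    · rw [absLin_residue_affineGL, setOf_absLin_lt_absDen_affineGL]
  · rintro ⟨t, ht, rfl⟩
    refine ⟨(t - s) / c, ?_, ?_⟩
    · rw [norm_div]
      exact div_le_one_of_le₀ ht (norm_nonneg _)
    · rw [absLin_residue_affineGL, div_mul_cancel₀ _ hc, add_sub_cancel,
        setOf_absLin_lt_absDen_affineGL]

theorem isRationalBasicWideOpen_of_fintype {ι : Type*} [Fintype ι] (g : GL (Fin 2) K)
    (D E : ι → Set (BerkP1 K)) (hD : ∀ i, IsClosedDisc (D i)) (hE : ∀ i, IsResidueDisc g (E i))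
    (hinj : Function.Injective E) (hDE : ∀ i, D i ⊆ E i) :
    IsRationalBasicWideOpen (⋃ i, D i)ᶜ := by
  let e := (Fintype.equivFin ι).symm
  refine ⟨g, Fintype.card ι, D ∘ e, E ∘ e, fun i => hD _, fun i => hE _,
    hinj.comp e.injective, fun i => hDE _, ?_⟩
  rw [compl_inj_iff]
  exact (e.surjective.iUnion_comp D).symm

/-- The complement of a closed disc is a wide open. -/
theorem isRationalBasicWideOpen_compl_closedDiscAt (s : K) {c c' : K} (hc : c ≠ 0)
    (hc' : ‖c‖ < ‖c'‖) : IsRationalBasicWideOpen (closedDiscAt s ‖c‖)ᶜ := by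
  have hc0 : c' ≠ 0 := norm_pos_iff.1 ((norm_nonneg c).trans_lt hc')
  have h := isRationalBasicWideOpen_of_fintype (ι := Unit) (affineGL s hc0)
    (fun _ => closedDiscAt s ‖c‖) (fun _ => openDiscAt s ‖c'‖)
    (fun _ => isClosedDisc_closedDiscAt s hc)
    (fun _ => (isResidueDisc_affineGL_iff s hc0 _).2 (Or.inl ⟨s, by simp, rfl⟩))
    (fun _ _ _ => rfl) (fun _ => by
      rintro x ⟨y, rfl, h⟩
      exact ⟨y, rfl, h.trans_lt hc'⟩)
  rwa [iUnion_const] at h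

theorem isConnectedAffinoid_compl_openDiscAt (s : K) {c : K} (hc : c ≠ 0) :
    IsConnectedAffinoid (openDiscAt s ‖c‖)ᶜ :=
  ⟨⟨OnePoint.infty, infty_notMem_openDiscAt⟩, 0, fun _ => openDiscAt s ‖c‖,
    fun _ => isOpenDisc_openDiscAt s hc, by rw [iUnion_const]⟩

theorem closedDiscMinus_nonempty [IsUltrametricDist K] [IsAlgClosed K] {s c : K} (hc : c ≠ 0)
    {T : Finset K} (hT : ∀ a ∈ T, ‖a - s‖ ≤ ‖c‖) : (closedDiscMinus s ‖c‖ T).Nonempty := by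
  obtain ⟨T', hz⟩ := isReductionCoordinate_affineCoordinate hc hT
  have h := unitDiscMinus_nonempty T'
  rw [← hz.range_eq, range_nonempty_iff_nonempty] at h
  obtain ⟨v⟩ := h
  exact ⟨_, v.2⟩

theorem isConnectedAffinoid_closedDiscMinus [IsUltrametricDist K] [IsAlgClosed K] {s c : K}
    (hc : c ≠ 0) {T : Finset K} (hT : ∀ a ∈ T, ‖a - s‖ ≤ ‖c‖) :
    IsConnectedAffinoid (closedDiscMinus s ‖c‖ T) := by
  refine ⟨closedDiscMinus_nonempty hc hT, T.card, Fin.cons (closedDiscAt s ‖c‖)ᶜ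
    (fun i => openDiscAt (T.equivFin.symm i : K) ‖c‖), fun i => ?_, ?_⟩
  · induction i using Fin.cases with
    | zero => exact isOpenDisc_compl_closedDiscAt s hc
    | succ i => exact isOpenDisc_openDiscAt _ hc
  · ext x
    rw [mem_compl_iff, mem_iUnion, Fin.exists_fin_succ, not_or, not_exists]
    simp only [Fin.cons_zero, Fin.cons_succ, mem_compl_iff, not_not]
    induction x using OnePoint.rec with
    | infty => simp [infty_notMem_closedDiscMinus, infty_notMem_closedDiscAt]
    | coe y =>
      simp only [coe_mem_closedDiscMinus, coe_mem_closedDiscAt, coe_mem_openDiscAt, not_lt]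
      refine and_congr_right fun _ => ⟨fun h i => h _ (T.equivFin.symm i).2, fun h a ha => ?_⟩
      simpa using h (T.equivFin ⟨a, ha⟩)

end Discs

/-! ### Trees of discs -/

/-- A finite tree of nested discs: to the vertex `i` belong the closed disc of centre `center i`
and radius `‖scale i‖`, and the slightly larger open disc of radius `‖outer i‖`. Below the root,
the latter is a residue disc of the closed disc of the parent. -/
structure DiscTree (K : Type*) [NormedField K] (ι : Type*) [PartialOrder ι] [OrderTop ι] where
  center : ι → K
  scale : ι → K
  outer : ι → K
  parent : ι → ι
  scale_ne_zero : ∀ i, scale i ≠ 0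
  scale_lt_outer : ∀ i, ‖scale i‖ < ‖outer i‖
  lt_parent : ∀ i, i ≠ ⊤ → i < parent i
  outer_eq : ∀ i, i ≠ ⊤ → ‖outer i‖ = ‖scale (parent i)‖
  parent_le : ∀ i j, i < j → parent i ≤ j
  outer_le : ∀ i j, i < j → ‖outer i‖ ≤ ‖scale j‖
  center_le : ∀ i j, i ≤ j → ‖center i - center j‖ ≤ ‖scale j‖
  separated : ∀ i j, ‖center i - center j‖ < max ‖outer i‖ ‖outer j‖ → i ≤ j ∨ j ≤ i

theorem BerkA1.norm_sub_le_max {K : Type*} [NormedField K] [IsUltrametricDist K] (y : BerkA1 K)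
    (a b : K) : ‖a - b‖ ≤ max (y.1 (X - C a)) (y.1 (X - C b)) := by
  have h := y.isNonarchimedean (X - C b) (-(X - C a))
  have e : X - C b + -(X - C a) = C (a - b) := by rw [C_sub]; ring
  rw [map_neg_eq_map, e, y.2] at h
  rwa [max_comm]

theorem BerkA1.le_max {K : Type*} [NormedField K] [IsUltrametricDist K] (y : BerkA1 K)
    (a b : K) : y.1 (X - C a) ≤ max (y.1 (X - C b)) ‖b - a‖ := by
  have h := y.isNonarchimedean (X - C b) (C (b - a))
  have e : X - C b + C (b - a) = X - C a := by rw [C_sub]; ring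
  rwa [e, y.2] at h

namespace DiscTree

variable {K : Type*} [NormedField K] {ι : Type*} [PartialOrder ι] [OrderTop ι] (t : DiscTree K ι)

/-- The closed disc of a vertex. -/
def closedDisc (i : ι) : Set (BerkP1 K) := closedDiscAt (t.center i) ‖t.scale i‖

/-- The open disc of a vertex. -/
def openDisc (i : ι) : Set (BerkP1 K) := openDiscAt (t.center i) ‖t.outer i‖

/-- The wide open of a vertex. -/
def wideOpen (i : ι) : Set (BerkP1 K) := t.openDisc i \ ⋃ j, ⋃ (_ : j < i), t.closedDisc j

theorem mem_wideOpen {i : ι} {x : BerkP1 K} :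
    x ∈ t.wideOpen i ↔ x ∈ t.openDisc i ∧ ∀ j < i, x ∉ t.closedDisc j := by
  simp [wideOpen]

theorem outer_ne_zero (i : ι) : t.outer i ≠ 0 :=
  norm_pos_iff.1 ((norm_nonneg _).trans_lt (t.scale_lt_outer i))

theorem closedDisc_subset_openDisc (i : ι) : t.closedDisc i ⊆ t.openDisc i := by
  rintro x ⟨y, rfl, h⟩
  exact ⟨y, rfl, h.trans_lt (t.scale_lt_outer i)⟩

theorem scale_lt_scale {i j : ι} (h : i < j) : ‖t.scale i‖ < ‖t.scale j‖ :=
  (t.scale_lt_outer i).trans_le (t.outer_le i j h)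

/-- A maximal vertex among those above `i` and strictly below `j` must have parent `j`. Hence only
the discs of the children matter among those removed at `j`. -/
theorem exists_child [Finite ι] {i j : ι} (h : i < j) :
    ∃ k, k ≠ ⊤ ∧ t.parent k = j ∧ i ≤ k := by
  obtain ⟨k, ⟨hk1, hk2⟩, hmax⟩ := (Set.toFinite {k | i ≤ k ∧ k < j}).exists_maximal ⟨i, le_rfl, h⟩
  have hk : k ≠ ⊤ := (hk2.trans_le le_top).ne
  refine ⟨k, hk, ?_, hk1⟩
  by_contra hne
  have h1 := t.lt_parent k hk
  exact absurd (hmax ⟨hk1.trans h1.le, (t.parent_le k j hk2).lt_of_ne hne⟩ h1.le)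
    (not_le_of_gt h1)

variable [IsUltrametricDist K]

theorem openDisc_subset_closedDisc {i j : ι} (h : i < j) : t.openDisc i ⊆ t.closedDisc j := by
  rintro x ⟨y, rfl, hy⟩
  refine ⟨y, rfl, (y.le_max _ (t.center i)).trans (max_le ?_ (t.center_le i j h.le))⟩
  exact hy.le.trans (t.outer_le i j h)

theorem closedDisc_mono {i j : ι} (h : i ≤ j) : t.closedDisc i ⊆ t.closedDisc j := by
  rcases h.eq_or_lt with rfl | h
  · exact Subset.rfl
  · exact (t.closedDisc_subset_openDisc i).trans (t.openDisc_subset_closedDisc h)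

theorem openDisc_subset_openDisc_top (i : ι) : t.openDisc i ⊆ t.openDisc ⊤ := by
  rcases (le_top : i ≤ ⊤).eq_or_lt with h | h
  · rw [h]
  · exact (t.openDisc_subset_closedDisc h).trans (t.closedDisc_subset_openDisc ⊤)

theorem le_or_le_of_mem_openDisc {i j : ι} {x : BerkP1 K} (hi : x ∈ t.openDisc i)
    (hj : x ∈ t.openDisc j) : i ≤ j ∨ j ≤ i := by
  obtain ⟨y, rfl, hi⟩ := hi
  rw [openDisc, coe_mem_openDiscAt] at hj
  exact t.separated i j ((y.norm_sub_le_max _ _).trans_lt (max_lt_max hi hj))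

/-- Otherwise the parent of `i` is strictly below `j`, and its closed disc, which is removed at `j`,
contains the whole open disc of `i`. -/
theorem parent_eq_of_mem_wideOpen_of_lt {i j : ι} (h : i < j) {x : BerkP1 K}
    (hi : x ∈ t.wideOpen i) (hj : x ∈ t.wideOpen j) : i ≠ ⊤ ∧ t.parent i = j := by
  have hi0 : i ≠ ⊤ := (h.trans_le le_top).ne
  refine ⟨hi0, ?_⟩
  by_contra hne
  have h1 := (t.parent_le i j h).lt_of_ne hne
  exact (t.mem_wideOpen.1 hj).2 _ h1
    (t.openDisc_subset_closedDisc (t.lt_parent i hi0) (t.mem_wideOpen.1 hi).1)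

theorem parent_eq_of_mem_wideOpen {i j : ι} (h : i ≠ j) {x : BerkP1 K}
    (hi : x ∈ t.wideOpen i) (hj : x ∈ t.wideOpen j) :
    (i ≠ ⊤ ∧ t.parent i = j) ∨ (j ≠ ⊤ ∧ t.parent j = i) := by
  rcases t.le_or_le_of_mem_openDisc (t.mem_wideOpen.1 hi).1 (t.mem_wideOpen.1 hj).1 with h1 | h1
  · exact Or.inl (t.parent_eq_of_mem_wideOpen_of_lt (h1.lt_of_ne h) hi hj)
  · exact Or.inr (t.parent_eq_of_mem_wideOpen_of_lt (h1.lt_of_ne h.symm) hj hi)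

theorem openDisc_diff_closedDisc_subset_wideOpen (i : ι) :
    t.openDisc i \ t.closedDisc i ⊆ t.wideOpen i := fun _ hx =>
  t.mem_wideOpen.2 ⟨hx.1, fun _ hj h => hx.2 (t.closedDisc_mono hj.le h)⟩

theorem wideOpen_inter_wideOpen_parent {i : ι} (hi : i ≠ ⊤) :
    t.wideOpen i ∩ t.wideOpen (t.parent i) = t.openDisc i \ t.closedDisc i := by
  have hp := t.lt_parent i hi
  refine Subset.antisymm (fun x hx => ?_) (fun x hx => ?_)
  · exact ⟨(t.mem_wideOpen.1 hx.1).1, (t.mem_wideOpen.1 hx.2).2 i hp⟩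
  · refine ⟨t.openDisc_diff_closedDisc_subset_wideOpen i hx, t.mem_wideOpen.2
      ⟨t.closedDisc_subset_openDisc _ (t.openDisc_subset_closedDisc hp hx.1), fun j hj h => ?_⟩⟩
    -- No vertex lies strictly between `i` and its parent, so any removed disc that contains `x`
    -- would lie inside the closed disc of `i`.
    rcases t.le_or_le_of_mem_openDisc hx.1 (t.closedDisc_subset_openDisc j h) with h1 | h1
    · rcases h1.eq_or_lt with rfl | h1
      · exact hx.2 h
      · exact absurd (t.parent_le i j h1) (not_le_of_gt hj)
    · exact hx.2 (t.closedDisc_mono h1 h)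

theorem isPreconnected_openDisc_diff_closedDisc (i : ι) :
    IsPreconnected (t.openDisc i \ t.closedDisc i) :=
  isPreconnected_openDiscAt_diff_closedDiscAt _ _ _

theorem openDisc_diff_closedDisc_nonempty (i : ι) : (t.openDisc i \ t.closedDisc i).Nonempty := by
  obtain ⟨r, h1, h2⟩ := exists_between (t.scale_lt_outer i)
  let r' : ℝ≥0 := ⟨r, (norm_nonneg _).trans h1.le⟩
  have h : ((BerkA1.ofPoint (t.center i)).thicken r').1 (X - C (t.center i)) = r := by
    rw [BerkA1.thicken_X_sub_C, BerkA1.ofPoint_X_sub_C, sub_self, norm_zero]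
    exact max_eq_right r'.2
  refine ⟨((BerkA1.ofPoint (t.center i)).thicken r' : BerkA1 K), ?_, ?_⟩
  · rwa [openDisc, coe_mem_openDiscAt, h]
  · rwa [closedDisc, coe_mem_closedDiscAt, h, not_le]

/-! ### The cores of the wide opens and their reductions -/

variable [Fintype ι]

open Classical in
/-- The centres of the children of a vertex. -/
def childCenters (i : ι) : Finset K :=
  (Finset.univ.filter fun j => j ≠ ⊤ ∧ t.parent j = i).image t.center

omit [IsUltrametricDist K] in
theorem forall_mem_childCenters {i : ι} {P : K → Prop} :
    (∀ a ∈ t.childCenters i, P a) ↔ ∀ j, j ≠ ⊤ → t.parent j = i → P (t.center j) := by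
  simp only [childCenters, Finset.mem_image, Finset.mem_filter, Finset.mem_univ, true_and]
  exact ⟨fun h j hj hp => h _ ⟨j, ⟨hj, hp⟩, rfl⟩, fun h a ⟨j, hj, e⟩ => e ▸ h j hj.1 hj.2⟩

omit [IsUltrametricDist K] in
theorem norm_sub_le_of_mem_childCenters (i : ι) :
    ∀ a ∈ t.childCenters i, ‖a - t.center i‖ ≤ ‖t.scale i‖ := by
  rw [forall_mem_childCenters]
  rintro j hj rfl
  exact t.center_le _ _ (t.lt_parent j hj).le

/-- The affinoid of a vertex. -/
def core (i : ι) : Set (BerkP1 K) :=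
  closedDiscMinus (t.center i) ‖t.scale i‖ (t.childCenters i)

omit [IsUltrametricDist K] in
theorem mem_core {i : ι} {x : BerkP1 K} : x ∈ t.core i ↔
    x ∈ t.closedDisc i ∧ ∀ j, j ≠ ⊤ → t.parent j = i → x ∉ t.openDisc j := by
  induction x using OnePoint.rec with
  | infty => simp [core, closedDisc, infty_notMem_closedDiscMinus, infty_notMem_closedDiscAt]
  | coe y =>
    rw [core, coe_mem_closedDiscMinus, forall_mem_childCenters, closedDisc, coe_mem_closedDiscAt]
    refine and_congr_right fun _ => forall_congr' fun j => forall_congr' fun hj =>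
      forall_congr' fun hp => ?_
    rw [openDisc, coe_mem_openDiscAt, not_lt, t.outer_eq j hj, hp]

theorem core_subset_wideOpen (i : ι) : t.core i ⊆ t.wideOpen i := by
  intro x hx
  obtain ⟨h1, h2⟩ := t.mem_core.1 hx
  refine t.mem_wideOpen.2 ⟨t.closedDisc_subset_openDisc i h1, fun j hj h => ?_⟩
  obtain ⟨k, hk, hki, hjk⟩ := t.exists_child hj
  exact h2 k hk hki (t.closedDisc_subset_openDisc k (t.closedDisc_mono hjk h))

/-- This is the comparison with `coreIn`. A point in the wide open of `i` but outside its closed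
disc also belongs to the wide open of the parent; only the root has no parent, and there the
condition on the closed disc of `⊤` replaces the missing member. -/
theorem mem_core_iff {i : ι} {x : BerkP1 K} : x ∈ t.core i ↔
    x ∈ t.wideOpen i ∧ x ∈ t.closedDisc ⊤ ∧ ∀ j, j ≠ i → x ∉ t.wideOpen j := by
  constructor
  · intro hx
    obtain ⟨h1, h2⟩ := t.mem_core.1 hx
    refine ⟨t.core_subset_wideOpen i hx, t.closedDisc_mono le_top h1, fun j hj h => ?_⟩
    rcases t.parent_eq_of_mem_wideOpen hj.symm (t.core_subset_wideOpen i hx) h with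
      ⟨hi, rfl⟩ | ⟨hj', rfl⟩
    · exact (t.mem_wideOpen.1 h).2 i (t.lt_parent i hi) h1
    · exact h2 j hj' rfl (t.mem_wideOpen.1 h).1
  · rintro ⟨h1, h2, h3⟩
    refine t.mem_core.2 ⟨?_, ?_⟩
    · by_cases hi : i = ⊤
      · rwa [hi]
      · by_contra h
        have h4 := (t.wideOpen_inter_wideOpen_parent hi).ge ⟨(t.mem_wideOpen.1 h1).1, h⟩
        exact h3 _ (t.lt_parent i hi).ne' h4.2
    · rintro j hj rfl h
      have h4 := (t.wideOpen_inter_wideOpen_parent hj).ge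
        ⟨h, (t.mem_wideOpen.1 h1).2 j (t.lt_parent j hj)⟩
      exact h3 j (t.lt_parent j hj).ne h4.1

variable [IsAlgClosed K]

theorem isSemistableAffinoid_core (i : ι) : IsSemistableAffinoid (t.core i) :=
  let ⟨_, hz⟩ := isReductionCoordinate_affineCoordinate (t.scale_ne_zero i)
    (t.norm_sub_le_of_mem_childCenters i)
  hz.isSemistableAffinoid (isConnectedAffinoid_closedDiscMinus (t.scale_ne_zero i)
    (t.norm_sub_le_of_mem_childCenters i))

theorem not_isOrdinaryDoublePoint_core (i : ι) (m : MaximalSpectrum (reductionRing (t.core i))) :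
    ¬ IsOrdinaryDoublePoint (resField K) m :=
  let ⟨_, hz⟩ := isReductionCoordinate_affineCoordinate (t.scale_ne_zero i)
    (t.norm_sub_le_of_mem_childCenters i)
  hz.not_isOrdinaryDoublePoint m

theorem reductionGenus_core (i : ι) : reductionGenus (t.core i) = 0 :=
  let ⟨_, hz⟩ := isReductionCoordinate_affineCoordinate (t.scale_ne_zero i)
    (t.norm_sub_le_of_mem_childCenters i)
  hz.reductionGenus_eq_zero

theorem core_nonempty (i : ι) : (t.core i).Nonempty :=
  closedDiscMinus_nonempty (t.scale_ne_zero i) (t.norm_sub_le_of_mem_childCenters i)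

/-- A core is nonempty and meets no wide open but its own. -/
theorem wideOpen_injective : Function.Injective t.wideOpen := by
  intro i j h
  by_contra hij
  obtain ⟨x, hx⟩ := t.core_nonempty i
  have h1 := t.mem_core_iff.1 hx
  exact h1.2.2 j (Ne.symm hij) (h ▸ h1.1)

theorem isTreeFamily : IsTreeFamily t.wideOpen t.parent ⊤ (fun i => ‖t.scale i‖) where
  injective := t.wideOpen_injective
  rank_lt i hi := t.scale_lt_scale (t.lt_parent i hi)
  eq_parent _ _ hij := fun ⟨_, hi, hj⟩ => t.parent_eq_of_mem_wideOpen hij hi hj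
  nonempty i hi := by
    rw [t.wideOpen_inter_wideOpen_parent hi]
    exact t.openDisc_diff_closedDisc_nonempty i
  isPreconnected i hi := by
    rw [t.wideOpen_inter_wideOpen_parent hi]
    exact t.isPreconnected_openDisc_diff_closedDisc i

omit [IsAlgClosed K] in
theorem isRationalBasicWideOpen_wideOpen (i : ι) : IsRationalBasicWideOpen (t.wideOpen i) := by
  classical
  -- The removed closed discs are the exterior of the open disc, indexed by `none`, and the discs of
  -- the children. The former lies in the residue disc of infinity, the latter in residue discs
  -- about the children's centres.
  have hU : t.wideOpen i = (⋃ k : Option {j // j ≠ ⊤ ∧ t.parent j = i},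
      k.elim (t.openDisc i)ᶜ (fun j => t.closedDisc j))ᶜ := by
    ext x
    rw [mem_wideOpen, mem_compl_iff, mem_iUnion, Option.exists, not_or, not_exists]
    simp only [Option.elim_none, Option.elim_some, mem_compl_iff, not_not]
    refine and_congr_right fun _ => ⟨?_, fun h j hj hx => ?_⟩
    · rintro h ⟨j, hj, rfl⟩
      exact h j (t.lt_parent j hj)
    · obtain ⟨k, hk, hki, hjk⟩ := t.exists_child hj
      exact h ⟨k, hk, hki⟩ (t.closedDisc_mono hjk hx)
  rw [hU]
  refine isRationalBasicWideOpen_of_fintype (affineGL (t.center i) (t.scale_ne_zero i)) _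
    (fun k => k.elim (closedDiscAt (t.center i) ‖t.scale i‖)ᶜ
      (fun j => openDiscAt (t.center j) ‖t.scale i‖)) ?_ ?_ ?_ ?_
  · rintro (_ | j)
    · exact isClosedDisc_compl_openDiscAt _ (t.outer_ne_zero i)
    · exact isClosedDisc_closedDiscAt _ (t.scale_ne_zero j)
  · rintro (_ | ⟨j, hj, rfl⟩)
    · exact (isResidueDisc_affineGL_iff _ _ _).2 (Or.inr rfl)
    · exact (isResidueDisc_affineGL_iff _ _ _).2
        (Or.inl ⟨_, t.center_le _ _ (t.lt_parent j hj).le, rfl⟩)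
  · have hne : ∀ j : {j // j ≠ ⊤ ∧ t.parent j = i},
        (closedDiscAt (t.center i) ‖t.scale i‖)ᶜ ≠ openDiscAt (t.center j) ‖t.scale i‖ :=
      fun j h => infty_notMem_openDiscAt (h.le infty_notMem_closedDiscAt)
    -- Children with the same residue disc are comparable by `separated`, and comparable vertices
    -- with the same parent are equal.
    have hle : ∀ j k : {j // j ≠ ⊤ ∧ t.parent j = i},
        openDiscAt (t.center j) ‖t.scale i‖ = openDiscAt (t.center k) ‖t.scale i‖ → j.1 ≤ k.1 := by
      rintro ⟨j, hj, hji⟩ ⟨k, hk, hki⟩ h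
      have h1 : (BerkA1.ofPoint (t.center j) : BerkP1 K) ∈ openDiscAt (t.center j) ‖t.scale i‖ := by
        rw [coe_mem_openDiscAt, BerkA1.ofPoint_X_sub_C, sub_self, norm_zero]
        exact norm_pos_iff.2 (t.scale_ne_zero i)
      rw [h, coe_mem_openDiscAt, BerkA1.ofPoint_X_sub_C] at h1
      have h0 : ‖t.center j - t.center k‖ < ‖t.outer k‖ := by
        rw [t.outer_eq k hk, hki]
        exact h1
      rcases t.separated j k (h0.trans_le (le_max_right _ _)) with h2 | h2
      · exact h2
      · rcases h2.eq_or_lt with h2 | h2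
        · exact h2.ge
        · have h3 := t.parent_le k j h2
          rw [hki, ← hji] at h3
          exact absurd h3 (not_le_of_gt (t.lt_parent j hj))
    rintro (_ | j) (_ | k) h
    · rfl
    · exact absurd h (hne k)
    · exact absurd h.symm (hne j)
    · exact congrArg some (Subtype.ext (le_antisymm (hle j k h) (hle k j h.symm)))
  · rintro (_ | ⟨j, hj, rfl⟩)
    · exact compl_subset_compl.2 (t.closedDisc_subset_openDisc i)
    · rintro x ⟨y, rfl, h⟩
      exact ⟨y, rfl, h.trans_lt (t.scale_lt_scale (t.lt_parent j hj))⟩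

omit [IsAlgClosed K] in
theorem iUnion_wideOpen : ⋃ i, t.wideOpen i = t.openDisc ⊤ := by
  refine Subset.antisymm (iUnion_subset fun i x hx =>
    t.openDisc_subset_openDisc_top i (t.mem_wideOpen.1 hx).1) fun x hx => ?_
  -- A minimal open disc containing `x` has no smaller closed disc that contains `x`.
  obtain ⟨i, hi, hmin⟩ := (Set.toFinite {i | x ∈ t.openDisc i}).exists_minimal ⟨⊤, hx⟩
  refine mem_iUnion.2 ⟨i, t.mem_wideOpen.2 ⟨hi, fun j hj h => ?_⟩⟩
  exact absurd (hmin (t.closedDisc_subset_openDisc j h) hj.le) (not_le_of_gt hj)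

end DiscTree

/-! ### The clusters of a finite set -/

section Clusters

variable {K : Type*} [NormedField K]

open Classical in
/-- The points of `S` in the smallest closed disc containing `s` and `t`. -/
def clusterOf (S : Finset K) (s t : K) : Finset K := S.filter fun u => ‖u - s‖ ≤ ‖t - s‖

theorem mem_clusterOf {S : Finset K} {s t u : K} :
    u ∈ clusterOf S s t ↔ u ∈ S ∧ ‖u - s‖ ≤ ‖t - s‖ := by
  classical
  simp [clusterOf]

/-- The clusters with at least two elements of a finite set `S`: its intersections with closed
discs. -/
abbrev Cluster (S : Finset K) : Type _ :=
  {A : Finset K // ∃ s ∈ S, ∃ t ∈ S, t ≠ s ∧ A = clusterOf S s t}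

namespace Cluster

variable {S : Finset K}

instance : Finite (Cluster S) := by
  refine Finite.of_injective
    (fun A : Cluster S => (⟨A.1, ?_⟩ : S.powerset)) fun A B h => ?_
  · obtain ⟨s, -, t, -, -, h⟩ := A.2
    rw [Finset.mem_powerset, h]
    exact fun u hu => (mem_clusterOf.1 hu).1
  · exact Subtype.ext (congrArg (fun x : S.powerset => x.1) h)

/-- A point of the cluster. -/
def center (A : Cluster S) : K := A.2.choose

/-- A point of the cluster as far as possible from its centre. -/
def mate (A : Cluster S) : K := A.2.choose_spec.2.choose

theorem mate_ne_center (A : Cluster S) : A.mate ≠ A.center :=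
  A.2.choose_spec.2.choose_spec.2.1

theorem eq_clusterOf (A : Cluster S) : A.1 = clusterOf S A.center A.mate :=
  A.2.choose_spec.2.choose_spec.2.2

theorem center_mem (A : Cluster S) : A.center ∈ A.1 := by
  rw [eq_clusterOf]
  exact mem_clusterOf.2 ⟨A.2.choose_spec.1, by simp⟩

theorem mate_mem (A : Cluster S) : A.mate ∈ A.1 := by
  rw [eq_clusterOf]
  exact mem_clusterOf.2 ⟨A.2.choose_spec.2.choose_spec.1, le_rfl⟩

theorem mem_of_mem (A : Cluster S) {u : K} (hu : u ∈ A.1) : u ∈ S := by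
  rw [eq_clusterOf] at hu
  exact (mem_clusterOf.1 hu).1

theorem lt_def {A B : Cluster S} : A < B ↔ A.1 ⊂ B.1 := Iff.rfl

/-- The distance between the points of the cluster that are farthest apart is the norm of this
element. -/
def scale (A : Cluster S) : K := A.mate - A.center

variable [IsUltrametricDist K]

theorem norm_sub_le (A : Cluster S) {u v : K} (hu : u ∈ A.1) (hv : v ∈ A.1) :
    ‖u - v‖ ≤ ‖A.scale‖ := by
  rw [eq_clusterOf, mem_clusterOf] at hu hv
  rw [← sub_sub_sub_cancel_right u v A.center]
  exact (norm_sub_le_max_of_isUltrametricDist _ _).trans (max_le hu.2 hv.2)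

/-- Every point of an ultrametric disc is a centre, so the chosen centre plays no special role. -/
theorem mem_iff (A : Cluster S) {u v : K} (hu : u ∈ A.1) :
    v ∈ A.1 ↔ v ∈ S ∧ ‖v - u‖ ≤ ‖A.scale‖ := by
  refine ⟨fun hv => ⟨A.mem_of_mem hv, A.norm_sub_le hv hu⟩, fun hv => ?_⟩
  rw [eq_clusterOf, mem_clusterOf] at hu ⊢
  refine ⟨hv.1, ?_⟩
  rw [← sub_add_sub_cancel v u]
  exact (IsUltrametricDist.norm_add_le_max _ _).trans (max_le hv.2 hu.2)

theorem le_or_le_of_mem {A B : Cluster S} {u : K} (hA : u ∈ A.1) (hB : u ∈ B.1) :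
    A ≤ B ∨ B ≤ A := by
  rcases le_total ‖A.scale‖ ‖B.scale‖ with h | h
  · left
    intro v hv
    rw [A.mem_iff hA] at hv
    exact (B.mem_iff hB).2 ⟨hv.1, hv.2.trans h⟩
  · right
    intro v hv
    rw [B.mem_iff hB] at hv
    exact (A.mem_iff hA).2 ⟨hv.1, hv.2.trans h⟩

omit [IsUltrametricDist K] in
theorem exists_nearest (A : Cluster S) (h : A.1 ≠ S) :
    ∃ v ∈ S, v ∉ A.1 ∧ ∀ u ∈ S, u ∉ A.1 → ‖v - A.center‖ ≤ ‖u - A.center‖ := by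
  classical
  have hne : (S \ A.1).Nonempty := by
    rw [Finset.sdiff_nonempty]
    exact fun h' => h (Finset.Subset.antisymm (fun u => A.mem_of_mem) h')
  obtain ⟨v, hv, hmin⟩ := Finset.exists_min_image _ (fun u => ‖u - A.center‖) hne
  rw [Finset.mem_sdiff] at hv
  exact ⟨v, hv.1, hv.2, fun u hu hu' => hmin u (Finset.mem_sdiff.2 ⟨hu, hu'⟩)⟩

/-- A point of `S` outside the cluster, as near as possible. -/
def nearest (A : Cluster S) (h : A.1 ≠ S) : K := (A.exists_nearest h).choose

omit [IsUltrametricDist K] in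
theorem nearest_spec (A : Cluster S) (h : A.1 ≠ S) : A.nearest h ∈ S ∧ A.nearest h ∉ A.1 ∧
    ∀ u ∈ S, u ∉ A.1 → ‖A.nearest h - A.center‖ ≤ ‖u - A.center‖ :=
  (A.exists_nearest h).choose_spec

open Classical in
/-- The smallest cluster that properly contains a given one. -/
def parent (A : Cluster S) : Cluster S :=
  if h : A.1 = S then A else
    ⟨clusterOf S A.center (A.nearest h), _, A.mem_of_mem A.center_mem, _,
      (A.nearest_spec h).1,
      fun e => (A.nearest_spec h).2.1 (by rw [e]; exact A.center_mem), rfl⟩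

open Classical in
/-- The distance from a cluster to its complement is the norm of this element; for the whole set it
is prescribed. -/
def outer (ω : K) (A : Cluster S) : K :=
  if h : A.1 = S then ω else A.nearest h - A.center

omit [IsUltrametricDist K] in
theorem outer_of_eq {ω : K} {A : Cluster S} (h : A.1 = S) : A.outer ω = ω := by simp [outer, h]

omit [IsUltrametricDist K] in
theorem outer_of_ne {ω : K} {A : Cluster S} (h : A.1 ≠ S) :
    A.outer ω = A.nearest h - A.center := by simp [outer, h]

omit [IsUltrametricDist K] in
theorem mem_parent {A : Cluster S} (h : A.1 ≠ S) {u : K} :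
    u ∈ A.parent.1 ↔ u ∈ S ∧ ‖u - A.center‖ ≤ ‖A.nearest h - A.center‖ := by
  rw [parent, dif_neg h]
  exact mem_clusterOf

omit [IsUltrametricDist K] in
theorem scale_lt_nearest {A : Cluster S} (h : A.1 ≠ S) :
    ‖A.scale‖ < ‖A.nearest h - A.center‖ := by
  obtain ⟨h1, h2, -⟩ := (A.nearest_spec h)
  by_contra! hle
  exact h2 (A.eq_clusterOf.ge (mem_clusterOf.2 ⟨h1, hle⟩))

omit [IsUltrametricDist K] in
theorem scale_lt_outer {ω : K} (hω : ∀ u ∈ S, ∀ v ∈ S, ‖u - v‖ < ‖ω‖) (A : Cluster S) :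
    ‖A.scale‖ < ‖A.outer ω‖ := by
  by_cases h : A.1 = S
  · rw [outer_of_eq h]
    exact hω _ (A.mem_of_mem A.mate_mem) _ (A.mem_of_mem A.center_mem)
  · rw [outer_of_ne h]
    exact scale_lt_nearest h

omit [IsUltrametricDist K] in
theorem mem_of_lt_outer {ω : K} {A : Cluster S} {u : K} (hu : u ∈ S)
    (h : ‖u - A.center‖ < ‖A.outer ω‖) : u ∈ A.1 := by
  by_cases hA : A.1 = S
  · rwa [hA]
  · by_contra hu'
    rw [outer_of_ne hA] at h
    exact absurd ((A.nearest_spec hA).2.2 u hu hu') (not_le.2 h)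

omit [IsUltrametricDist K] in
theorem lt_parent {A : Cluster S} (h : A.1 ≠ S) : A < A.parent := by
  rw [lt_def, Finset.ssubset_iff_of_subset]
  · exact ⟨A.nearest h, (mem_parent h).2 ⟨(A.nearest_spec h).1, le_rfl⟩,
      (A.nearest_spec h).2.1⟩
  · intro u hu
    refine (mem_parent h).2 ⟨A.mem_of_mem hu, ?_⟩
    rw [eq_clusterOf, mem_clusterOf] at hu
    exact hu.2.trans (scale_lt_nearest h).le

/-- The parent is cut out by the disc about `A.center` through the nearest outside point. Both
points belong to the parent, and no two of its points are farther apart. -/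
theorem outer_eq {ω : K} {A : Cluster S} (h : A.1 ≠ S) : ‖A.outer ω‖ = ‖A.parent.scale‖ := by
  rw [outer_of_ne h]
  refine le_antisymm (norm_sub_le _ ?_ ?_) ?_
  · exact (mem_parent h).2 ⟨(A.nearest_spec h).1, le_rfl⟩
  · exact (mem_parent h).2 ⟨A.mem_of_mem A.center_mem, by simp⟩
  · rw [scale, ← sub_sub_sub_cancel_right _ _ A.center]
    exact (norm_sub_le_max_of_isUltrametricDist _ _).trans
      (max_le ((mem_parent h).1 A.parent.mate_mem).2 ((mem_parent h).1 A.parent.center_mem).2)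

omit [IsUltrametricDist K] in
theorem ne_of_lt {A B : Cluster S} (h : A < B) : A.1 ≠ S := fun e =>
  h.2 (fun _ hu => e.ge (B.mem_of_mem hu))

theorem outer_le {ω : K} {A B : Cluster S} (h : A < B) : ‖A.outer ω‖ ≤ ‖B.scale‖ := by
  have hA := ne_of_lt h
  obtain ⟨u, hu, hu'⟩ := Finset.exists_of_ssubset (lt_def.1 h)
  rw [outer_of_ne hA]
  exact ((A.nearest_spec hA).2.2 u (B.mem_of_mem hu) hu').trans
    (B.norm_sub_le hu (h.le A.center_mem))

theorem parent_le {A B : Cluster S} (h : A < B) : A.parent ≤ B := by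
  have hA := ne_of_lt h
  have h1 := outer_le (ω := 0) h
  rw [outer_of_ne hA] at h1
  intro u hu
  rw [mem_parent hA] at hu
  exact (B.mem_iff (h.le A.center_mem)).2 ⟨hu.1, hu.2.trans h1⟩

/-- If the centre of one cluster lies in the open disc of the other, it is a point of the other
cluster, so the two clusters share a point. -/
theorem le_or_le_of_norm_center_sub_lt {ω : K} {A B : Cluster S}
    (h : ‖A.center - B.center‖ < max ‖A.outer ω‖ ‖B.outer ω‖) : A ≤ B ∨ B ≤ A := by
  rcases lt_max_iff.1 h with h | h
  · rw [norm_sub_rev] at h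
    exact le_or_le_of_mem (mem_of_lt_outer (B.mem_of_mem B.center_mem) h) B.center_mem
  · exact le_or_le_of_mem A.center_mem (mem_of_lt_outer (A.mem_of_mem A.center_mem) h)

omit [IsUltrametricDist K] in
theorem mem_univ_clusters (hS : S.Nontrivial) : ∃ s ∈ S, ∃ t ∈ S, t ≠ s ∧ S = clusterOf S s t := by
  obtain ⟨s, hs, u, hu, hsu⟩ := hS
  -- The disc about `s` through a farthest point of `S` contains all of `S`.
  obtain ⟨t, ht, hmax⟩ := S.exists_max_image (fun v => ‖v - s‖) ⟨s, hs⟩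
  refine ⟨s, hs, t, ht, ?_, ?_⟩
  · rintro rfl
    have h := hmax u hu
    rw [sub_self, norm_zero, norm_le_zero_iff, sub_eq_zero] at h
    exact hsu h.symm
  · ext v
    rw [mem_clusterOf]
    exact ⟨fun hv => ⟨hv, hmax v hv⟩, And.left⟩

/-- The whole set is the largest cluster. -/
@[reducible] def orderTop (hS : S.Nontrivial) : OrderTop (Cluster S) where
  top := ⟨S, mem_univ_clusters hS⟩
  le_top A := fun _ hu => A.mem_of_mem hu

/-- The tree of the smallest discs that contain the clusters. -/
def discTree (hS : S.Nontrivial) {ω : K} (hω : ∀ u ∈ S, ∀ v ∈ S, ‖u - v‖ < ‖ω‖) :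
    letI := orderTop hS
    DiscTree K (Cluster S) :=
  letI := orderTop hS
  have ne_of_ne_top : ∀ A : Cluster S, A ≠ ⊤ → A.1 ≠ S := fun _ hA e => hA (Subtype.ext e)
  { center := center
    scale := scale
    outer := outer ω
    parent := parent
    scale_ne_zero := fun A => sub_ne_zero.2 A.mate_ne_center
    scale_lt_outer := fun A => A.scale_lt_outer hω
    lt_parent := fun A hA => lt_parent (ne_of_ne_top A hA)
    outer_eq := fun A hA => outer_eq (ne_of_ne_top A hA)
    parent_le := fun _ _ h => parent_le h
    outer_le := fun _ _ h => outer_le h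
    center_le := fun A B h => B.norm_sub_le (h A.center_mem) B.center_mem
    separated := fun _ _ h => le_or_le_of_norm_center_sub_lt h }

omit [IsUltrametricDist K] in
theorem exists_cluster_of_ne {u v : K} (hu : u ∈ S) (hv : v ∈ S) (huv : u ≠ v) :
    ∃ A : Cluster S, u ∈ A.1 ∧ v ∈ A.1 ∧ ∀ w ∈ A.1, ‖w - u‖ ≤ ‖v - u‖ :=
  ⟨⟨clusterOf S u v, u, hu, v, hv, huv.symm, rfl⟩, mem_clusterOf.2 ⟨hu, by simp⟩,
    mem_clusterOf.2 ⟨hv, le_rfl⟩, fun _ hw => (mem_clusterOf.1 hw).2⟩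

end Cluster

end Clusters

/-! ### Separation of the points of a finite set -/

namespace DiscTree

variable {K : Type*} [NormedField K] {ι : Type*} [PartialOrder ι] [OrderTop ι]

/-- Every point of `S` lies in at most one of the wide opens, and the points in a wide open lie in
distinct residue discs of its closed disc. -/
structure Separates (t : DiscTree K ι) (S : Set K) : Prop where
  center_top_mem : t.center ⊤ ∈ S
  mem_closedDisc_top : ∀ s ∈ S, BerkP1.ofPoint (s : OnePoint K) ∈ t.closedDisc ⊤
  eq_of_mem : ∀ s ∈ S, ∀ i j, BerkP1.ofPoint (s : OnePoint K) ∈ t.wideOpen i →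
    BerkP1.ofPoint (s : OnePoint K) ∈ t.wideOpen j → i = j
  mem_closedDisc : ∀ s ∈ S, ∀ i, BerkP1.ofPoint (s : OnePoint K) ∈ t.wideOpen i →
    BerkP1.ofPoint (s : OnePoint K) ∈ t.closedDisc i
  eq_of_norm_sub_lt : ∀ i, ∀ u ∈ S, ∀ v ∈ S, BerkP1.ofPoint (u : OnePoint K) ∈ t.wideOpen i →
    BerkP1.ofPoint (v : OnePoint K) ∈ t.wideOpen i → ‖u - v‖ < ‖t.scale i‖ → u = v

end DiscTree

theorem ofPoint_mem_openDiscAt {K : Type*} [NormedField K] {s u : K} {r : ℝ} :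
    BerkP1.ofPoint (u : OnePoint K) ∈ openDiscAt s r ↔ ‖u - s‖ < r := by
  rw [← BerkA1.ofPoint_X_sub_C]
  exact coe_mem_openDiscAt

theorem ofPoint_mem_closedDiscAt {K : Type*} [NormedField K] {s u : K} {r : ℝ} :
    BerkP1.ofPoint (u : OnePoint K) ∈ closedDiscAt s r ↔ ‖u - s‖ ≤ r := by
  rw [← BerkA1.ofPoint_X_sub_C]
  exact coe_mem_closedDiscAt

namespace Cluster

variable {K : Type*} [NormedField K] [IsUltrametricDist K] {S : Finset K}

/-- A point of `S` lies only in the wide open of the smallest cluster containing it. If two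
different points of the wide open of `A` were closer than the diameter of `A`, the cluster spanned
by them would be strictly smaller than `A` and contain both. -/
theorem separates_discTree (hS : S.Nontrivial) {ω : K}
    (hω : ∀ u ∈ S, ∀ v ∈ S, ‖u - v‖ < ‖ω‖) :
    letI := orderTop hS
    (discTree hS hω).Separates (S : Set K) := by
  let _ := orderTop hS
  have key : ∀ u ∈ S, ∀ A, BerkP1.ofPoint (u : OnePoint K) ∈ (discTree hS hω).wideOpen A →
      u ∈ A.1 ∧ ∀ B < A, u ∉ B.1 := by
    intro u hu A h
    obtain ⟨h1, h2⟩ := (discTree hS hω).mem_wideOpen.1 h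
    refine ⟨mem_of_lt_outer hu (ofPoint_mem_openDiscAt.1 h1), fun B hB huB => h2 B hB ?_⟩
    exact ofPoint_mem_closedDiscAt.2 (B.norm_sub_le huB B.center_mem)
  refine ⟨(⊤ : Cluster S).mem_of_mem (center_mem _), fun s hs =>
    ofPoint_mem_closedDiscAt.2 ((⊤ : Cluster S).norm_sub_le hs (center_mem _)),
    fun s hs A B hA hB => ?_, fun s hs A hA => ?_, fun A u hu v hv huA hvA h => ?_⟩
  · obtain ⟨hA1, hA2⟩ := key s hs A hA
    obtain ⟨hB1, hB2⟩ := key s hs B hB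
    rcases le_or_le_of_mem hA1 hB1 with h | h
    · by_contra hne
      exact hB2 A (h.lt_of_ne hne) hA1
    · by_contra hne
      exact hA2 B (h.lt_of_ne (Ne.symm hne)) hB1
  · exact ofPoint_mem_closedDiscAt.2 (A.norm_sub_le (key s hs A hA).1 A.center_mem)
  · by_contra hne
    obtain ⟨B, huB, hvB, hB⟩ := exists_cluster_of_ne hu hv hne
    obtain ⟨huA1, huA2⟩ := key u hu A huA
    have hmate : ‖B.scale‖ ≤ ‖v - u‖ := by
      rw [scale, ← sub_sub_sub_cancel_right _ _ u]
      exact (norm_sub_le_max_of_isUltrametricDist _ _).trans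
        (max_le (hB _ B.mate_mem) (hB _ B.center_mem))
    rw [norm_sub_rev] at h
    refine huA2 B (lt_of_le_of_ne (fun w hw => ?_) ?_) huB
    · exact (A.mem_iff huA1).2 ⟨B.mem_of_mem hw, (hB w hw).trans h.le⟩
    · rintro rfl
      exact absurd h (not_lt.2 hmate)

end Cluster

/-! ### The semistable coverings attached to a tree of discs -/

namespace DiscTree

variable {K : Type*} [NormedField K] [IsUltrametricDist K] {ι : Type*} [PartialOrder ι]
  [OrderTop ι] (t : DiscTree K ι)

theorem isGoodElement_wideOpen {S₀ : Set K} (hS₀ : t.Separates S₀) {S : Set (OnePoint K)}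
    (hS : ∀ s : K, (s : OnePoint K) ∈ S → s ∈ S₀) (i : ι) : IsGoodElement S (t.wideOpen i) := by
  have hinf : BerkP1.ofPoint (OnePoint.infty : OnePoint K) ∉ t.wideOpen i := fun h =>
    infty_notMem_openDiscAt (t.mem_wideOpen.1 h).1
  refine ⟨affineGL (t.center i) (t.scale_ne_zero i), fun u hu v hv hui hvi E hE huE hvE => ?_⟩
  induction u using OnePoint.rec with
  | infty => exact absurd hui hinf
  | coe u =>
  induction v using OnePoint.rec with
  | infty => exact absurd hvi hinf
  | coe v =>
  rcases (isResidueDisc_affineGL_iff _ _ _).1 hE with ⟨a, -, rfl⟩ | rfl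
  · rw [ofPoint_mem_openDiscAt] at huE hvE
    refine congrArg _ (hS₀.eq_of_norm_sub_lt i u (hS u hu) v (hS v hv) hui hvi ?_)
    rw [← sub_sub_sub_cancel_right u v a]
    exact (norm_sub_le_max_of_isUltrametricDist _ _).trans_lt (max_lt huE hvE)
  · exact absurd (hS₀.mem_closedDisc u (hS u hu) i hui) huE

omit [IsUltrametricDist K] in
theorem eq_of_ofPoint_mem_wideOpen {S₀ : Set K} (hS₀ : t.Separates S₀) {S : Set (OnePoint K)}
    (hS : ∀ s : K, (s : OnePoint K) ∈ S → s ∈ S₀) {i j : ι} {s : OnePoint K} (hs : s ∈ S)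
    (hi : BerkP1.ofPoint s ∈ t.wideOpen i) (hj : BerkP1.ofPoint s ∈ t.wideOpen j) : i = j := by
  induction s using OnePoint.rec with
  | infty => exact absurd (t.mem_wideOpen.1 hi).1 infty_notMem_openDiscAt
  | coe s => exact hS₀.eq_of_mem s (hS s hs) i j hi hj

variable [Fintype ι] [IsAlgClosed K]

/-- The covering of the open disc of the root by the wide opens of the vertices. -/
def discCovering : Finset (Set (BerkP1 K)) := familyFinset t.wideOpen t.wideOpen_injective

theorem coreIn_discCovering (i : ι) :
    coreIn (t.closedDisc ⊤) t.discCovering (t.wideOpen i) = t.core i := by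
  ext x
  rw [discCovering, mem_coreIn_familyFinset, mem_core_iff]

theorem not_isOrdinaryDoublePoint_discCovering (i : ι)
    (m : MaximalSpectrum (reductionRing (coreIn (t.closedDisc ⊤)
      (familyFinset t.wideOpen t.isTreeFamily.injective) (t.wideOpen i)))) :
    ¬ IsOrdinaryDoublePoint (resField K) m := by
  have h := t.not_isOrdinaryDoublePoint_core i
  rw [← t.coreIn_discCovering i] at h
  exact h m

theorem isSemistableCoveringDisc_discCovering {β : K} {R : ℝ} (hR : ‖t.outer ⊤‖ = R)
    (hβ : ‖t.center ⊤ - β‖ < R) :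
    IsSemistableCoveringDisc β R (t.center ⊤) ‖t.scale ⊤‖ t.discCovering (t.wideOpen ⊤) := by
  -- The centre of the root is a point of the disc, hence also a centre of it.
  have hY : openDiscAt β R = t.openDisc ⊤ := by
    ext x
    rw [openDisc, hR]
    constructor
    · rintro ⟨y, rfl, h⟩
      refine ⟨y, rfl, (y.le_max _ β).trans_lt (max_lt h ?_)⟩
      rwa [norm_sub_rev]
    · rintro ⟨y, rfl, h⟩
      exact ⟨y, rfl, (y.le_max _ (t.center ⊤)).trans_lt (max_lt h hβ)⟩
  refine
    { covers := ?_
      wideOpen := forall_mem_familyFinset.2 t.isRationalBasicWideOpen_wideOpen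
      finite_edges := t.isTreeFamily.finite_dualEdge t.not_isOrdinaryDoublePoint_discCovering
      disconnected := t.isTreeFamily.disconnected
      core := forall_mem_familyFinset.2 fun i => ?_
      centre := hβ
      radius := ⟨⟨t.scale ⊤, t.scale_ne_zero ⊤, rfl⟩, hR ▸ t.scale_lt_outer ⊤⟩
      root_mem := mem_familyFinset.2 ⟨⊤, rfl⟩
      annulus_subset_root := hY ▸ t.openDisc_diff_closedDisc_subset_wideOpen ⊤
      others_subset := forall_mem_familyFinset.2 fun i hi x hx => ?_
      genus := t.isTreeFamily.firstBetti_eq_zero t.not_isOrdinaryDoublePoint_discCovering _ }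
  · rw [hY, ← t.iUnion_wideOpen]
    ext x
    simp [discCovering, mem_familyFinset]
  · change IsSemistableAffinoid (coreIn (t.closedDisc ⊤) t.discCovering (t.wideOpen i))
    rw [coreIn_discCovering]
    exact t.isSemistableAffinoid_core i
  · have hi : i < ⊤ := lt_top_iff_ne_top.2 fun e => hi (e ▸ rfl)
    exact t.openDisc_subset_closedDisc hi (t.mem_wideOpen.1 hx).1

theorem isGoodCovering_discCovering {S₀ : Set K} (hS₀ : t.Separates S₀) {S : Set (OnePoint K)}
    (hS : ∀ s : K, (s : OnePoint K) ∈ S → s ∈ S₀) : IsGoodCovering t.discCovering S := by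
  refine ⟨fun s hs => ?_, forall_mem_familyFinset.2 (t.isGoodElement_wideOpen hS₀ hS)⟩
  refine forall_mem_familyFinset.2 fun i => ?_
  intro V hV hi hj
  obtain ⟨j, rfl⟩ := mem_familyFinset.1 hV
  rw [t.eq_of_ofPoint_mem_wideOpen hS₀ hS hs hi hj]

/-- The wide opens of the vertices, and the complement of the closed disc of the root. -/
def optionWideOpen (k : Option ι) : Set (BerkP1 K) := k.elim (t.closedDisc ⊤)ᶜ t.wideOpen

open Classical in
/-- The parents for the family `optionWideOpen`, whose root is the complement of a disc. -/
def optionParent (k : Option ι) : Option ι :=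
  k.elim none fun i => if i = ⊤ then none else some (t.parent i)

omit [Fintype ι] [IsAlgClosed K] in
theorem wideOpen_inter_compl_closedDisc {i : ι} {x : BerkP1 K} (hi : x ∈ t.wideOpen i)
    (h : x ∉ t.closedDisc ⊤) : i = ⊤ := by
  by_contra hne
  exact h (t.openDisc_subset_closedDisc (lt_top_iff_ne_top.2 hne) (t.mem_wideOpen.1 hi).1)

omit [Fintype ι] [IsAlgClosed K] in
theorem wideOpen_top_inter : t.wideOpen ⊤ ∩ (t.closedDisc ⊤)ᶜ = t.openDisc ⊤ \ t.closedDisc ⊤ :=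
  Subset.antisymm (fun _ hx => ⟨(t.mem_wideOpen.1 hx.1).1, hx.2⟩) fun _ hx =>
    ⟨t.openDisc_diff_closedDisc_subset_wideOpen ⊤ hx, hx.2⟩

/-- The exterior of the root's closed disc meets no wide open except that of `⊤`, and meets it in
the outermost annulus, so it can be placed above `⊤` as the new root. Its rank is the outer radius,
which exceeds the scale of `⊤`. -/
theorem isTreeFamily_option : IsTreeFamily t.optionWideOpen t.optionParent none
    (fun k => k.elim ‖t.outer ⊤‖ fun i => ‖t.scale i‖) where
  injective := by
    have hne : ∀ i, t.optionWideOpen none ≠ t.optionWideOpen (some i) := fun i h =>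
      infty_notMem_openDiscAt (t.mem_wideOpen.1 (h.le infty_notMem_closedDiscAt)).1
    rintro (_ | i) (_ | j) h
    · rfl
    · exact absurd h (hne j)
    · exact absurd h.symm (hne i)
    · exact congrArg some (t.wideOpen_injective h)
  rank_lt := by
    rintro (_ | i) hi
    · exact absurd rfl hi
    · by_cases h : i = ⊤
      · simpa [optionParent, h] using t.scale_lt_outer ⊤
      · simpa [optionParent, h] using t.scale_lt_scale (t.lt_parent i h)
  eq_parent := by
    rintro (_ | i) (_ | j) hij ⟨x, hx, hx'⟩
    · exact absurd rfl hij
    · obtain rfl := t.wideOpen_inter_compl_closedDisc hx' hx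
      exact Or.inr (by simp [optionParent])
    · obtain rfl := t.wideOpen_inter_compl_closedDisc hx hx'
      exact Or.inl (by simp [optionParent])
    · rcases t.parent_eq_of_mem_wideOpen (fun e => hij (congrArg some e)) hx hx' with
        ⟨h, h'⟩ | ⟨h, h'⟩
      · exact Or.inl (by simp [optionParent, h, h'])
      · exact Or.inr (by simp [optionParent, h, h'])
  nonempty := by
    rintro (_ | i) hi
    · exact absurd rfl hi
    · by_cases h : i = ⊤
      · have := t.openDisc_diff_closedDisc_nonempty ⊤
        rw [← t.wideOpen_top_inter] at this
        simpa [optionParent, h] using! this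
      · simpa [optionParent, h] using! t.isTreeFamily.nonempty i h
  isPreconnected := by
    rintro (_ | i) hi
    · exact absurd rfl hi
    · by_cases h : i = ⊤
      · have := t.isPreconnected_openDisc_diff_closedDisc ⊤
        rw [← t.wideOpen_top_inter] at this
        simpa [optionParent, h] using! this
      · simpa [optionParent, h] using! t.isTreeFamily.isPreconnected i h

/-- The covering of the projective line attached to a tree of discs. -/
def projectiveCovering : Finset (Set (BerkP1 K)) :=
  familyFinset t.optionWideOpen t.isTreeFamily_option.injective

theorem coreIn_projectiveCovering_some (i : ι) :
    coreIn univ t.projectiveCovering (t.optionWideOpen (some i)) = t.core i := by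
  ext x
  rw [projectiveCovering, mem_coreIn_familyFinset, mem_core_iff]
  refine and_congr_right fun _ => ⟨fun ⟨_, h⟩ => ⟨?_, fun j hj => ?_⟩, fun ⟨h1, h2⟩ => ⟨trivial, ?_⟩⟩
  · exact not_not.1 (h none (by simp))
  · exact h (some j) (by simpa)
  · rintro (_ | j) hj
    · exact not_not.2 h1
    · exact h2 j (by simpa using hj)

theorem coreIn_projectiveCovering_none :
    coreIn univ t.projectiveCovering (t.optionWideOpen none) =
      (openDiscAt (t.center ⊤) ‖t.outer ⊤‖)ᶜ := by
  ext x
  change _ ↔ x ∈ (t.openDisc ⊤)ᶜ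
  rw [projectiveCovering, mem_coreIn_familyFinset, mem_compl_iff, ← t.iUnion_wideOpen, mem_iUnion,
    not_exists]
  refine ⟨fun ⟨_, _, h⟩ i => h (some i) (by simp), fun h => ⟨fun h' => ?_, trivial, ?_⟩⟩
  · have h1 := t.closedDisc_subset_openDisc ⊤ h'
    rw [← t.iUnion_wideOpen, mem_iUnion] at h1
    exact h1.elim h
  · rintro (_ | j) hj
    · exact absurd rfl hj
    · exact h j

theorem coreIn_projectiveCovering (k : Option ι) :
    IsSemistableAffinoid (coreIn univ t.projectiveCovering (t.optionWideOpen k)) ∧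
    reductionGenus (coreIn univ t.projectiveCovering (t.optionWideOpen k)) = 0 ∧
    ∀ m : MaximalSpectrum (reductionRing (coreIn univ t.projectiveCovering (t.optionWideOpen k))),
      ¬ IsOrdinaryDoublePoint (resField K) m := by
  rcases k with _ | i
  · rw [coreIn_projectiveCovering_none]
    have hz := isReductionCoordinate_inftyCoordinate (s := t.center ⊤) (t.outer_ne_zero ⊤)
    exact ⟨hz.isSemistableAffinoid (isConnectedAffinoid_compl_openDiscAt _ (t.outer_ne_zero ⊤)),
      hz.reductionGenus_eq_zero, hz.not_isOrdinaryDoublePoint⟩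
  · rw [coreIn_projectiveCovering_some]
    exact ⟨t.isSemistableAffinoid_core i, t.reductionGenus_core i,
      t.not_isOrdinaryDoublePoint_core i⟩

theorem isSemistableCoveringP1_projectiveCovering :
    IsSemistableCoveringP1 t.projectiveCovering where
  covers := by
    rw [eq_univ_iff_forall]
    intro x
    simp only [projectiveCovering, mem_iUnion, mem_familyFinset, exists_prop, exists_exists_eq_and]
    by_cases hx : x ∈ t.closedDisc ⊤
    · have h1 := t.closedDisc_subset_openDisc ⊤ hx
      rw [← t.iUnion_wideOpen, mem_iUnion] at h1
      obtain ⟨i, hi⟩ := h1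
      exact ⟨some i, hi⟩
    · exact ⟨none, hx⟩
  wideOpen := by
    refine forall_mem_familyFinset.2 ?_
    rintro (_ | i)
    · exact isRationalBasicWideOpen_compl_closedDiscAt _ (t.scale_ne_zero ⊤) (t.scale_lt_outer ⊤)
    · exact t.isRationalBasicWideOpen_wideOpen i
  finite_edges := t.isTreeFamily_option.finite_dualEdge fun k => (t.coreIn_projectiveCovering k).2.2
  disconnected := t.isTreeFamily_option.disconnected
  core := forall_mem_familyFinset.2 fun k => (t.coreIn_projectiveCovering k).1
  genus := by
    have h : ∀ U ∈ t.projectiveCovering,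
        (reductionGenus (coreIn univ t.projectiveCovering U) : ℤ) = 0 :=
      forall_mem_familyFinset.2 fun k => mod_cast (t.coreIn_projectiveCovering k).2.1
    have hb := t.isTreeFamily_option.firstBetti_eq_zero
      (fun k => (t.coreIn_projectiveCovering k).2.2) ∅
    rw [curveGenus_eq_zero, Finset.sum_eq_zero h, Nat.cast_zero, zero_add]
    exact hb.symm

theorem isGoodCovering_projectiveCovering {S₀ : Set K} (hS₀ : t.Separates S₀)
    {S : Set (OnePoint K)} (hS : ∀ s : K, (s : OnePoint K) ∈ S → s ∈ S₀) :
    IsGoodCovering t.projectiveCovering S := by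
  have hinf : ∀ s ∈ S, BerkP1.ofPoint s ∉ t.closedDisc ⊤ → s = OnePoint.infty := by
    intro s hs h
    induction s using OnePoint.rec with
    | infty => rfl
    | coe s => exact absurd (hS₀.mem_closedDisc_top s (hS s hs)) h
  have hinf' : ∀ i, BerkP1.ofPoint (OnePoint.infty : OnePoint K) ∉ t.wideOpen i := fun i h =>
    infty_notMem_openDiscAt (t.mem_wideOpen.1 h).1
  constructor
  · intro s hs U hU V hV hsU hsV
    obtain ⟨k, rfl⟩ := mem_familyFinset.1 hU
    obtain ⟨l, rfl⟩ := mem_familyFinset.1 hV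
    rcases k with _ | i <;> rcases l with _ | j
    · rfl
    · rw [hinf s hs hsU] at hsV
      exact absurd hsV (hinf' j)
    · rw [hinf s hs hsV] at hsU
      exact absurd hsU (hinf' i)
    · rw [t.eq_of_ofPoint_mem_wideOpen hS₀ hS hs hsU hsV]
  · refine forall_mem_familyFinset.2 ?_
    rintro (_ | i)
    -- Infinity is the only point of `S` that this member can contain, so any coordinate serves.
    · exact ⟨1, fun u hu v hv hui hvi _ _ _ _ => (hinf u hu hui).trans (hinf v hv hvi).symm⟩
    · exact t.isGoodElement_wideOpen hS₀ hS i

end DiscTree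

/-! ### Existence of semistable coverings -/

section Existence

variable {K : Type*} [NormedField K] [IsUltrametricDist K] [IsAlgClosed K]

/-- A finite set of points of the projective line has a good semistable covering. -/
theorem exists_isSemistableCoveringP1 {x : K} (hx : 1 < ‖x‖) {S : Set (OnePoint K)}
    (hS : S.Finite) : ∃ 𝒞 : Finset (Set (BerkP1 K)),
      IsSemistableCoveringP1 𝒞 ∧ IsGoodCovering 𝒞 S ∧ (dualGraph univ 𝒞 S).IsTree := by
  classical
  -- The finite points of `S`, enlarged by two points so that at least one cluster exists, even if
  -- `S` is empty.
  let S₀ : Finset K := (hS.preimage OnePoint.coe_injective.injOn).toFinset ∪ {0, 1}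
  have hS₀ : S₀.Nontrivial := ⟨0, by simp [S₀], 1, by simp [S₀], zero_ne_one⟩
  obtain ⟨ω, hω⟩ : ∃ ω : K, ∀ u ∈ S₀, ∀ v ∈ S₀, ‖u - v‖ < ‖ω‖ := by
    obtain ⟨q, -, hq⟩ := (S₀ ×ˢ S₀).exists_max_image (fun q => ‖q.1 - q.2‖)
      (hS₀.nonempty.product hS₀.nonempty)
    -- Powers of `x` provide an outer radius in the value group that exceeds the diameter of `S₀`.
    obtain ⟨n, hn⟩ := pow_unbounded_of_one_lt ‖q.1 - q.2‖ hx
    refine ⟨x ^ n, fun u hu v hv => ?_⟩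
    rw [norm_pow]
    exact (hq (u, v) (Finset.mk_mem_product hu hv)).trans_lt hn
  let _ := Cluster.orderTop hS₀
  let _ := Fintype.ofFinite (Cluster S₀)
  let t := Cluster.discTree hS₀ hω
  have hsep : t.Separates (S₀ : Set K) := Cluster.separates_discTree hS₀ hω
  have hmem : ∀ s : K, (s : OnePoint K) ∈ S → s ∈ (S₀ : Set K) := fun s hs => by
    simp [S₀, hs]
  exact ⟨t.projectiveCovering, t.isSemistableCoveringP1_projectiveCovering,
    t.isGoodCovering_projectiveCovering hsep hmem,
    t.isTreeFamily_option.isTree (fun k => (t.coreIn_projectiveCovering k).2.2) hS⟩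

/-- A nonempty finite set of points of an open disc has a good semistable covering. -/
theorem exists_isSemistableCoveringDisc {x : K} (hx : 1 < ‖x‖) (β : K) {a : K} (ha : a ≠ 0)
    {S : Set K} (hS : S.Finite) (hne : S.Nonempty) (hSβ : ∀ s ∈ S, ‖s - β‖ < ‖a‖) :
    ∃ (𝒞 : Finset (Set (BerkP1 K))) (γ : K) (r : ℝ) (root : Set (BerkP1 K)),
      IsSemistableCoveringDisc β ‖a‖ γ r 𝒞 root ∧
      IsGoodCovering 𝒞 ((fun a : K => (a : OnePoint K)) '' S) ∧
      (dualGraph (closedDiscAt γ r) 𝒞 ((fun a : K => (a : OnePoint K)) '' S)).IsTree := by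
  classical
  obtain ⟨s, hs⟩ := hne
  have hx0 : x ≠ 0 := norm_pos_iff.1 (one_pos.trans hx)
  have hax : ‖a / x‖ < ‖a‖ := by
    rw [norm_div]
    exact div_lt_self (norm_pos_iff.2 ha) hx
  -- The extra point ensures a cluster even if `S` has one element; it stays in the disc because `‖a
  -- / x‖ < ‖a‖`.
  let S₀ : Finset K := insert (s + a / x) hS.toFinset
  have hS₀ : S₀.Nontrivial := ⟨s, by simp [S₀, hs], s + a / x, by simp [S₀], by
    simpa using ⟨ha, hx0⟩⟩
  have hSβ₀ : ∀ u ∈ S₀, ‖u - β‖ < ‖a‖ := by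
    intro u hu
    rcases Finset.mem_insert.1 hu with rfl | hu
    · rw [add_sub_right_comm]
      exact (IsUltrametricDist.norm_add_le_max _ _).trans_lt (max_lt (hSβ s hs) hax)
    · exact hSβ u (hS.mem_toFinset.1 hu)
  have hω : ∀ u ∈ S₀, ∀ v ∈ S₀, ‖u - v‖ < ‖a‖ := fun u hu v hv => by
    rw [← sub_sub_sub_cancel_right u v β]
    exact (norm_sub_le_max_of_isUltrametricDist _ _).trans_lt (max_lt (hSβ₀ u hu) (hSβ₀ v hv))
  let _ := Cluster.orderTop hS₀
  let _ := Fintype.ofFinite (Cluster S₀)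
  -- Here `hω` prescribes `a` as the outer value, so that the open disc of the root is the given
  -- disc.
  let t := Cluster.discTree hS₀ hω
  have hsep : t.Separates (S₀ : Set K) := Cluster.separates_discTree hS₀ hω
  have hmem : ∀ s : K, (s : OnePoint K) ∈ (fun a : K => (a : OnePoint K)) '' S →
      s ∈ (S₀ : Set K) := by
    rintro u ⟨v, hv, h⟩
    obtain rfl := OnePoint.coe_injective h
    simp [S₀, hv]
  have ht : ‖t.outer ⊤‖ = ‖a‖ := congrArg _ (Cluster.outer_of_eq rfl)
  exact ⟨t.discCovering, t.center ⊤, ‖t.scale ⊤‖, t.wideOpen ⊤,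
    t.isSemistableCoveringDisc_discCovering ht (hSβ₀ _ hsep.center_top_mem),
    t.isGoodCovering_discCovering hsep hmem,
    t.isTreeFamily.isTree t.not_isOrdinaryDoublePoint_discCovering (hS.image _)⟩

end Existence

end

/-! ### The theorem over `ℂ_[p]` -/

theorem theoremt (p : ℕ) [Fact p.Prime] :
    (∀ S : Set (OnePoint ℂ_[p]), S.Finite →
      ∃ 𝒞 : Finset (Set (BerkP1 ℂ_[p])),
        IsSemistableCoveringP1 𝒞 ∧ IsGoodCovering 𝒞 S ∧ (dualGraph univ 𝒞 S).IsTree) ∧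
    (∀ (β : ℂ_[p]) (R : ℝ), (∃ a : ℂ_[p], a ≠ 0 ∧ ‖a‖ = R) →
      ∀ S : Set ℂ_[p], S.Finite → S.Nonempty → (∀ s ∈ S, ‖s - β‖ < R) →
        ∃ (𝒞 : Finset (Set (BerkP1 ℂ_[p]))) (γ : ℂ_[p]) (r : ℝ) (root : Set (BerkP1 ℂ_[p])),
          IsSemistableCoveringDisc β R γ r 𝒞 root ∧
          IsGoodCovering 𝒞 ((fun a : ℂ_[p] => (a : OnePoint ℂ_[p])) '' S) ∧
          (dualGraph (closedDiscAt γ r) 𝒞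
            ((fun a : ℂ_[p] => (a : OnePoint ℂ_[p])) '' S)).IsTree) := by
  obtain ⟨x, hx⟩ := NormedField.exists_one_lt_norm ℂ_[p]
  refine ⟨fun S hS => exists_isSemistableCoveringP1 hx hS, ?_⟩
  rintro β _ ⟨a, ha, rfl⟩ S hS hne hSβ
  exact exists_isSemistableCoveringDisc hx β ha hS hne hSβ
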